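/- Let $M$ be a smooth $n$-dimensional Hausdorff manifold that admits a countable, locally finite atlas by precompact charts (equivalently, a paracompact manifold with at most countably many components, i.e. a Hausdorff $\sigma$-compact manifold). Fix such an atlas $\{(\Omega_j,\chi_j)\}_j$ with each $\Omega_j$ precompact and each $\chi_j(\Omega_j)\subset\mathbb{R}^n$ bounded, and a smooth partition of unity $\{\varphi_j\}_j$ with $\operatorname{supp}\varphi_j\subset\Omega_j$. For $k\in\mathbb{N}_0$ let $$\mathscr{H}^k_{\mathrm{loc}}(M)=\{u\in\mathscr{D}'(M):\ (\varphi_j u)\circ\chi_j^{-1}\in \mathscr{H}^k(\chi_j(\Omega_j))\ \text{for all } j\},$$ with the topology defined by the seminorms $\|u\|_{k,j}=\|(\varphi_j u)\circ\chi_j^{-1}\|_{\mathscr{H}^k(\chi_j(\Omega_j))}$. Here $\mathscr{D}'(M)$ is the space of complex distributions that transform like functions under changes of charts, and for $U\subset\mathbb{R}^n$ open $\mathscr{H}^k(U)$ is the space of distributions on $U$ all of whose derivatives of order at most $k$ are in $L^2(U)$, with norm $\|v\|_{\mathscr{H}^k(U)}=\big(\sum_{|\alpha|\le k}\|\partial^\alpha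 v\|_{L^2(U)}^2\big)^{1/2}$. Let $C^\infty(M)$ be the space of smooth complex-valued functions on $M$, with the topology of uniform convergence, on compact subsets of chart domains, of all derivatives in the charts. Then: 1. For each $k\in\mathbb{N}_0$, the embedding $\mathscr{H}^{k+1}_{\mathrm{loc}}(M)\hookrightarrow\mathscr{H}^{k}_{\mathrm{loc}}(M)$ is compact, that is, it is injective, continuous, and maps bounded sets to relatively compact sets. 2. $C^\infty(M)=\bigcap_{k\in\mathbb{N}_0}\mathscr{H}^k_{\mathrm{loc}}(M)$ as subspaces of $\mathscr{D}'(M)$, and the topology of $C^\infty(M)$ equals the projective limit topology, i.e. the coarsest topology on the intersection for which all inclusions into the spaces $\mathscr{H}^k_{\mathrm{loc}}(M)$ are continuous. 3. $C^\infty(M)$ is an FS (Fréchet–Schwartz) space. Moreover, for all $m,q\in\mathbb{N}_0$, with $\mathbb{T}^m=(\mathbb{R}/2\pi\mathbb{Z})^m$, the following are FS spaces for the topology of uniform convergence, on compact subsets of chart domains, of all derivatives of the local coefficients: the space $\mathsf{\Lambda}^qC^\infty(M)$ of smooth complex $q$-forms on $M$, the space $\mathsf{\Lambda}^qC^\infty(M\times\mathbb{T}^m)$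 of smooth complex $q$-forms on $M\times\mathbb{T}^m$, and its subspace $\mathsf{\Lambda}^{0,q}C^\infty(M\times\mathbb{T}^m)$ of the forms that involve only differentials coming from $M$. Here an FS space is a Fréchet space in which every neighbourhood $U$ of $0$ admits a neighbourhood $V$ of $0$ such that, for every $\varepsilon>0$, $V$ is covered by finitely many translates of $\varepsilon U$. -/

import Mathlib

open scoped Manifold ContDiff Distributions LineDeriv Topology Pointwise
open MeasureTheory TopologicalSpace Set

noncomputable section

namespace SobolevFS

/-! ### Locally convex spaces -/

/-- A Fréchet–Schwartz space over `ℂ`: a Hausdorff, metrizable (first countable), complete, locally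
convex topological vector space in which every neighbourhood `U` of `0` admits a neighbourhood `V`
of `0` that is, for every `ε > 0`, covered by finitely many translates of `ε U`. -/
structure IsFrechetSchwartz (E : Type*) [AddCommGroup E] [Module ℂ E] [TopologicalSpace E] :
    Prop where
  topologicalAddGroup : IsTopologicalAddGroup E
  continuousSMul : ContinuousSMul ℂ E
  locallyConvex : LocallyConvexSpace ℝ E
  t2 : T2Space E
  firstCountable : FirstCountableTopology E
  complete : @CompleteSpace E (IsTopologicalAddGroup.rightUniformSpace E)
  schwartz : ∀ U ∈ 𝓝 (0 : E), ∃ V ∈ 𝓝 (0 : E), ∀ ε : ℝ, 0 < ε →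
    ∃ F : Set E, F.Finite ∧ V ⊆ F + (ε : ℂ) • U

/-- A compact embedding of topological vector spaces: an injective continuous linear map that sends
bounded sets to relatively compact sets. -/
structure IsCompactEmbedding {E F : Type*} [AddCommGroup E] [Module ℂ E] [TopologicalSpace E]
    [AddCommGroup F] [Module ℂ F] [TopologicalSpace F] (T : E →ₗ[ℂ] F) : Prop where
  injective : Function.Injective T
  continuous : Continuous T
  isCompact_closure_image : ∀ B : Set E, Bornology.IsVonNBounded ℂ B → IsCompact (closure (T '' B))

/-! ### Sobolev spaces on open subsets of `ℝⁿ` -/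

/-- `ℝⁿ` with its Euclidean structure. -/
abbrev Eucl (n : ℕ) := EuclideanSpace ℝ (Fin n)

/-- The distributional partial derivative `∂_i`. -/
def partialDeriv {n : ℕ} {Ω : Opens (Eucl n)} (i : Fin n) : 𝓓'(Ω, ℂ) →ₗ[ℂ] 𝓓'(Ω, ℂ) where
  toFun T := ∂_{EuclideanSpace.single i (1 : ℝ)} T
  map_add' S T := by ext ψ; simp
  map_smul' c T := by ext ψ; simp

/-- The distributional derivative `∂^α`, for a multi-index `α`. -/
def multiDeriv {n : ℕ} {Ω : Opens (Eucl n)} (α : Fin n → ℕ) : 𝓓'(Ω, ℂ) →ₗ[ℂ] 𝓓'(Ω, ℂ) :=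
  ((List.finRange n).map fun i => (partialDeriv i : Module.End ℂ 𝓓'(Ω, ℂ)) ^ α i).prod

/-- The finite set of multi-indices of length at most `k`. -/
def multiIndices (n k : ℕ) : Finset (Fin n → ℕ) :=
  (Fintype.piFinset fun _ => Finset.range (k + 1)).filter fun α => ∑ i, α i ≤ k

theorem mem_multiIndices {n k : ℕ} {α : Fin n → ℕ} : α ∈ multiIndices n k ↔ ∑ i, α i ≤ k := by
  simp only [multiIndices, Finset.mem_filter, Fintype.mem_piFinset, Finset.mem_range,
    and_iff_right_iff_imp]
  intro h i
  have := Finset.single_le_sum (f := α) (fun j _ => Nat.zero_le _) (Finset.mem_univ i)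
  omega

/-- `L²(Ω)`, with respect to Lebesgue measure. -/
abbrev L2 {n : ℕ} (Ω : Opens (Eucl n)) := Lp ℂ 2 (volume.restrict (Ω : Set (Eucl n)))

theorem locallyIntegrableOn_L2 {n : ℕ} {Ω : Opens (Eucl n)} (g : L2 Ω) :
    LocallyIntegrableOn g (Ω : Set (Eucl n)) volume := by
  rw [locallyIntegrableOn_iff Ω.isOpen.isLocallyClosed]
  intro K hK hKc
  have h : MemLp g 2 (volume.restrict K) := (Lp.memLp g).mono_measure (Measure.restrict_mono hK le_rfl)
  have : IsFiniteMeasure (volume.restrict K) := ⟨by simpa using hKc.measure_lt_top⟩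
  exact h.integrable (by norm_num)

/-- The distribution `ψ ↦ ∫_Ω ψ f` defined by a locally integrable function `f` on `Ω`
(with value `0` if `f` is not locally integrable on `Ω`). -/
def ofFun {n : ℕ} (Ω : Opens (Eucl n)) (f : Eucl n → ℂ) : 𝓓'(Ω, ℂ) :=
  TestFunction.integralAgainstBilinCLM (ContinuousLinearMap.lsmul ℝ ℝ) volume f

theorem ofFun_apply {n : ℕ} {Ω : Opens (Eucl n)} {f : Eucl n → ℂ}
    (hf : LocallyIntegrableOn f (Ω : Set (Eucl n)) volume) (ψ : 𝓓(Ω, ℝ)) :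
    ofFun Ω f ψ = ∫ x in (Ω : Set (Eucl n)), ψ x • f x := by
  have h : ofFun Ω f ψ = ∫ x, ψ x • f x :=
    TestFunction.integralAgainstBilinCLM_eq_integral (B := ContinuousLinearMap.lsmul ℝ ℝ) hf
  rw [h, setIntegral_eq_integral_of_forall_compl_eq_zero]
  intro x hx
  rw [image_eq_zero_of_notMem_tsupport fun hx' => hx (ψ.tsupport_subset hx'), zero_smul]

/-- The embedding `L²(Ω) ↪ 𝓓'(Ω)`. -/
def ofL2 {n : ℕ} (Ω : Opens (Eucl n)) : L2 Ω →ₗ[ℂ] 𝓓'(Ω, ℂ) where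
  toFun g := ofFun Ω g
  map_add' f g := by
    ext ψ
    have hf := (TestFunction.integrable_bilin (ContinuousLinearMap.lsmul ℝ ℝ)
      (locallyIntegrableOn_L2 f) ψ).integrableOn (s := (Ω : Set (Eucl n)))
    have hg := (TestFunction.integrable_bilin (ContinuousLinearMap.lsmul ℝ ℝ)
      (locallyIntegrableOn_L2 g) ψ).integrableOn (s := (Ω : Set (Eucl n)))
    change ofFun Ω _ ψ = ofFun Ω _ ψ + ofFun Ω _ ψ
    rw [ofFun_apply (locallyIntegrableOn_L2 (f + g)), ofFun_apply (locallyIntegrableOn_L2 f),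
      ofFun_apply (locallyIntegrableOn_L2 g)]
    refine Eq.trans (integral_congr_ae ?_) (integral_add hf hg)
    filter_upwards [Lp.coeFn_add f g] with x hx
    rw [hx, Pi.add_apply, smul_add]
  map_smul' c f := by
    ext ψ
    change ofFun Ω _ ψ = c • ofFun Ω _ ψ
    rw [ofFun_apply (locallyIntegrableOn_L2 (c • f)), ofFun_apply (locallyIntegrableOn_L2 f),
      ← integral_smul]
    refine integral_congr_ae ?_
    filter_upwards [Lp.coeFn_smul c f] with x hx
    simp only [hx, Pi.smul_apply]
    rw [smul_comm]

theorem ofL2_injective {n : ℕ} (Ω : Opens (Eucl n)) : Function.Injective (ofL2 Ω) := by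
  rw [injective_iff_map_eq_zero]
  intro g hg
  have key := Ω.isOpen.ae_eq_zero_of_integral_contDiff_smul_eq_zero (locallyIntegrableOn_L2 g)
    fun ψ h1 h2 h3 => by
      have h : ofL2 Ω g (⟨ψ, h1, h2, h3⟩ : 𝓓(Ω, ℝ)) = 0 := by rw [hg]; rfl
      exact (TestFunction.integralAgainstBilinCLM_eq_integral
        (B := ContinuousLinearMap.lsmul ℝ ℝ) (locallyIntegrableOn_L2 g)
          (f := (⟨ψ, h1, h2, h3⟩ : 𝓓(Ω, ℝ)))).symm.trans h
  rw [Lp.eq_zero_iff_ae_eq_zero]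
  exact (ae_restrict_iff' Ω.isOpen.measurableSet).2 key

/-- The Sobolev space `H^k(Ω)`: the distributions `u` on `Ω` with `∂^α u ∈ L²(Ω)` for every
multi-index `α` with `|α| ≤ k`. -/
def sobolev {n : ℕ} (k : ℕ) (Ω : Opens (Eucl n)) : Submodule ℂ 𝓓'(Ω, ℂ) :=
  ⨅ α : multiIndices n k, (LinearMap.range (ofL2 Ω)).comap (multiDeriv (α : Fin n → ℕ))

theorem mem_sobolev {n k : ℕ} {Ω : Opens (Eucl n)} {u : 𝓓'(Ω, ℂ)} :
    u ∈ sobolev k Ω ↔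
      ∀ α : Fin n → ℕ, ∑ i, α i ≤ k → ∃ g : L2 Ω, ofL2 Ω g = multiDeriv α u := by
  simp [sobolev, mem_multiIndices]

/-- The `L²` function that represents `∂^α u`, for `u ∈ H^k(Ω)` and `|α| ≤ k`. -/
def derivL2 {n k : ℕ} {Ω : Opens (Eucl n)} (α : multiIndices n k) : sobolev k Ω →ₗ[ℂ] L2 Ω :=
  (LinearEquiv.ofInjective (ofL2 Ω) (ofL2_injective Ω)).symm.toLinearMap ∘ₗ
    ((multiDeriv (α : Fin n → ℕ)).domRestrict (sobolev k Ω)).codRestrict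
      (LinearMap.range (ofL2 Ω)) fun u => (Submodule.mem_iInf _).1 u.2 α

theorem ofL2_derivL2 {n k : ℕ} {Ω : Opens (Eucl n)} (α : multiIndices n k) (u : sobolev k Ω) :
    ofL2 Ω (derivL2 α u) = multiDeriv (α : Fin n → ℕ) (u : 𝓓'(Ω, ℂ)) := by
  have := (LinearEquiv.ofInjective (ofL2 Ω) (ofL2_injective Ω)).apply_symm_apply
    (((multiDeriv (α : Fin n → ℕ)).domRestrict (sobolev k Ω)).codRestrict
      (LinearMap.range (ofL2 Ω)) (fun u => (Submodule.mem_iInf _).1 u.2 α) u)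
  exact congrArg Subtype.val this

/-- The norm `(∑_{|α| ≤ k} ‖∂^α u‖²_{L²(Ω)})^{1/2}` of `H^k(Ω)`. -/
def sobolevNorm {n : ℕ} (k : ℕ) (Ω : Opens (Eucl n)) : Seminorm ℂ (sobolev k Ω) :=
  (normSeminorm ℂ (PiLp 2 fun _ : multiIndices n k => L2 Ω)).comp
    ((WithLp.linearEquiv 2 ℂ (multiIndices n k → L2 Ω)).symm.toLinearMap ∘ₗ
      LinearMap.pi fun α => derivL2 α)

theorem sobolevNorm_apply {n k : ℕ} {Ω : Opens (Eucl n)} (u : sobolev k Ω) :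
    sobolevNorm k Ω u = Real.sqrt (∑ α : multiIndices n k, ‖derivL2 α u‖ ^ 2) := by
  simp [sobolevNorm, PiLp.norm_eq_of_L2]

/-! ### Multiplication of a distribution by a smooth function -/

/-- The product `g ψ` of a function `g`, smooth on `Ω`, with a test function on `Ω`. -/
def mulTest {n : ℕ} {Ω : Opens (Eucl n)} {g : Eucl n → ℝ}
    (hg : ContDiffOn ℝ ∞ g (Ω : Set (Eucl n))) (ψ : 𝓓(Ω, ℝ)) : 𝓓(Ω, ℝ) where
  toFun x := ψ x * g x
  contDiff' := by
    rw [contDiff_iff_contDiffAt]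
    intro x
    by_cases hx : x ∈ tsupport ψ
    · exact ψ.contDiff.contDiffAt.mul
        (hg.contDiffAt (Ω.isOpen.mem_nhds (ψ.tsupport_subset hx)))
    · refine (contDiffAt_const (c := (0 : ℝ))).congr_of_eventuallyEq ?_
      filter_upwards [(isClosed_tsupport ψ).isOpen_compl.mem_nhds hx] with y hy
      rw [image_eq_zero_of_notMem_tsupport hy, zero_mul]
  hasCompactSupport' := ψ.hasCompactSupport.mul_right
  tsupport_subset' := (tsupport_mul_subset_left).trans ψ.tsupport_subset

/-- `ψ ↦ g ψ` as a continuous linear map on test functions. -/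
def mulTestCLM {n : ℕ} {Ω : Opens (Eucl n)} {g : Eucl n → ℝ}
    (hg : ContDiffOn ℝ ∞ g (Ω : Set (Eucl n))) : 𝓓(Ω, ℝ) →L[ℝ] 𝓓(Ω, ℝ) :=
  TestFunction.mkCLM ℝ (mulTest hg)
    (fun ψ θ => by ext x; exact add_mul (ψ x) (θ x) (g x))
    (fun c ψ => by ext x; exact mul_assoc c (ψ x) (g x))
    (fun K hK => by
      obtain ⟨η, h0, h1, -⟩ := exists_contMDiffMap_zero_one_nhds_of_isClosed
        𝓘(ℝ, Eucl n) (n := ⊤) Ω.isOpen.isClosed_compl K.isCompact.isClosed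
        (disjoint_compl_left_iff_subset.2 hK)
      have hs : ContDiff ℝ ∞ fun x => g x * η x := by
        rw [contDiff_iff_contDiffAt]
        intro x
        by_cases hx : x ∈ Ω
        · exact (hg.contDiffAt (Ω.isOpen.mem_nhds hx)).mul η.contMDiff.contDiff.contDiffAt
        · refine (contDiffAt_const (c := (0 : ℝ))).congr_of_eventuallyEq ?_
          filter_upwards [h0.filter_mono (nhds_le_nhdsSet (show x ∈ ((Ω : Set (Eucl n)))ᶜ from hx))]
            with y hy
          rw [hy, mul_zero]
      have hη : ∀ x ∈ K, η x = 1 := fun x hx => h1.self_of_nhdsSet x hx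
      refine ((TestFunction.continuous_ofSupportedIn hK).comp
        (ContDiffMapSupportedIn.bilinLeftCLM (n := ⊤) (ContinuousLinearMap.mul ℝ ℝ) hs
          (K := K)).continuous).congr fun φ => ?_
      ext x
      change φ x * (g x * η x) = φ x * g x
      by_cases hx : x ∈ K
      · rw [hη x hx, mul_one]
      · rw [φ.zero_on_compl hx]; simp)

/-- The product of a distribution on `Ω` with a function `g` that is smooth on `Ω`:
`(g T)(ψ) = T(g ψ)`. -/
def mulDist {n : ℕ} {Ω : Opens (Eucl n)} {g : Eucl n → ℝ}
    (hg : ContDiffOn ℝ ∞ g (Ω : Set (Eucl n))) : 𝓓'(Ω, ℂ) →ₗ[ℂ] 𝓓'(Ω, ℂ) where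
  toFun T := (mulTestCLM hg).precompCompactConvergenceCLM _ T
  map_add' S T := by ext ψ; rfl
  map_smul' c T := by ext ψ; rfl

theorem mulDist_apply {n : ℕ} {Ω : Opens (Eucl n)} {g : Eucl n → ℝ}
    (hg : ContDiffOn ℝ ∞ g (Ω : Set (Eucl n))) (T : 𝓓'(Ω, ℂ)) (ψ : 𝓓(Ω, ℝ)) :
    mulDist hg T ψ = T (mulTest hg ψ) := rfl

/-! ### Spaces of smooth functions and forms on a manifold -/

section Smooth

variable {E : Type*} [NormedAddCommGroup E] [NormedSpace ℝ E]
  {V : Type*} [NormedAddCommGroup V] [NormedSpace ℝ V] [NormedSpace ℂ V] [SMulCommClass ℝ ℂ V]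
  {S : Type*} [AddCommGroup S] [Module ℂ S]

theorem bddAbove_iteratedFDeriv {E V : Type*} [NormedAddCommGroup E] [NormedSpace ℝ E]
    [NormedAddCommGroup V] [NormedSpace ℝ V] {Ω K : Set E} (hΩ : IsOpen Ω) (hK : IsCompact K) (hKΩ : K ⊆ Ω)
    {f : E → V} (hf : ContDiffOn ℝ ∞ f Ω) (i : ℕ) :
    BddAbove (range fun x : K => ‖iteratedFDeriv ℝ i f x‖) := by
  have h1 : ContinuousOn (fun x => iteratedFDeriv ℝ i f x) Ω :=
    (hf.continuousOn_iteratedFDerivWithin (m := i) (by exact_mod_cast le_top)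
      hΩ.uniqueDiffOn).congr fun x hx => (iteratedFDerivWithin_of_isOpen i hΩ hx).symm
  have h2 := hK.bddAbove_image (h1.mono hKΩ).norm
  rwa [image_eq_range] at h2

/-- If every element `s` of `S` has a local representative `rep s` that is smooth on the open set
`Ω`, this is the seminorm `s ↦ sup_{x ∈ K} ‖D^i (rep s)(x)‖` on `S`, for `K ⊆ Ω` compact. -/
def derivSeminorm (rep : S →ₗ[ℂ] (E → V)) {Ω K : Set E} (hΩ : IsOpen Ω) (hK : IsCompact K)
    (hKΩ : K ⊆ Ω) (hrep : ∀ s, ContDiffOn ℝ ∞ (rep s) Ω) (i : ℕ) : Seminorm ℂ S :=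
  Seminorm.of (fun s => ⨆ x : K, ‖iteratedFDeriv ℝ i (rep s) x‖)
    (fun s t => by
      refine Real.iSup_le (fun x => ?_) (add_nonneg (Real.iSup_nonneg fun _ => norm_nonneg _)
        (Real.iSup_nonneg fun _ => norm_nonneg _))
      have hx := hΩ.mem_nhds (hKΩ x.2)
      rw [map_add, iteratedFDeriv_add_apply
        (((hrep s).contDiffAt hx).of_le (by exact_mod_cast le_top))
        (((hrep t).contDiffAt hx).of_le (by exact_mod_cast le_top))]
      exact (norm_add_le _ _).trans (add_le_add
        (le_ciSup (bddAbove_iteratedFDeriv hΩ hK hKΩ (hrep s) i) x)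
        (le_ciSup (bddAbove_iteratedFDeriv hΩ hK hKΩ (hrep t) i) x)))
    (fun c s => by
      rw [Real.mul_iSup_of_nonneg (norm_nonneg c)]
      refine iSup_congr fun x => ?_
      have hx := hΩ.mem_nhds (hKΩ x.2)
      rw [map_smul, iteratedFDeriv_const_smul_apply
        (((hrep s).contDiffAt hx).of_le (by exact_mod_cast le_top)), norm_smul])

theorem derivSeminorm_apply (rep : S →ₗ[ℂ] (E → V)) {Ω K : Set E} (hΩ : IsOpen Ω)
    (hK : IsCompact K) (hKΩ : K ⊆ Ω) (hrep : ∀ s, ContDiffOn ℝ ∞ (rep s) Ω) (i : ℕ) (s : S) :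
    derivSeminorm rep hΩ hK hKΩ hrep i s = ⨆ x : K, ‖iteratedFDeriv ℝ i (rep s) x‖ := rfl

/-- The locally convex topology generated by a family of seminorms. -/
@[reducible]
def seminormTopology {κ : Type*} (p : κ → Seminorm ℂ S) : TopologicalSpace S :=
  ⨅ a, (p a).toSeminormedAddCommGroup.toUniformSpace.toTopologicalSpace

end Smooth

section Manifold

variable {E : Type*} [NormedAddCommGroup E] [NormedSpace ℝ E]
  {H : Type*} [TopologicalSpace H] (I : ModelWithCorners ℝ E H)
  (N : Type*) [TopologicalSpace N] [ChartedSpace H N]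

/-- The charts of the smooth manifold `N` (the `C^∞` maximal atlas). -/
abbrev Chart := IsManifold.maximalAtlas I ∞ N

/-- The index set of the seminorms: a chart `e`, a compact subset `K` of its image in `E`, and an
order of differentiation. -/
structure SeminormIndex where
  e : Chart I N
  K : Set E
  isCompact : IsCompact K
  subset : K ⊆ (e.1.extend I).target
  order : ℕ

/-- The complex vector space of smooth functions `f : N → ℂ`. -/
def smoothFunSubmodule : Submodule ℂ (N → ℂ) where
  carrier := {f | ContMDiff I 𝓘(ℝ, ℂ) ∞ f}
  zero_mem' := contMDiff_const
  add_mem' hf hg := hf.add hg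
  smul_mem' c _ hf := ((contDiff_const_smul c).contMDiff).comp hf

/-- `C^∞(N)`, the space of smooth complex-valued functions on `N`. -/
def SmoothFun : Type _ := smoothFunSubmodule I N

instance : AddCommGroup (SmoothFun I N) := inferInstanceAs (AddCommGroup (smoothFunSubmodule I N))

instance : Module ℂ (SmoothFun I N) := inferInstanceAs (Module ℂ (smoothFunSubmodule I N))

variable {I N}

/-- The underlying function `N → ℂ`. -/
def SmoothFun.val (f : SmoothFun I N) : N → ℂ := Subtype.val f

/-- The representative `f ∘ e⁻¹` of a smooth function in a chart `e`. -/
def SmoothFun.rep (e : Chart I N) : SmoothFun I N →ₗ[ℂ] (E → ℂ) where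
  toFun f := f.val ∘ (e.1.extend I).symm
  map_add' _ _ := rfl
  map_smul' _ _ := rfl

theorem SmoothFun.contDiffOn_rep [IsManifold I ∞ N] (e : Chart I N) (f : SmoothFun I N) :
    ContDiffOn ℝ ∞ (SmoothFun.rep e f) (e.1.extend I).target := by
  have hf : ContMDiff I 𝓘(ℝ, ℂ) ∞ f.val := f.2
  have he := contMDiffOn_extend_symm (I := I) e.2
  rw [← OpenPartialHomeomorph.extend_target'] at he
  exact (hf.comp_contMDiffOn he).contDiffOn

/-- The Fréchet topology of `C^∞(N)`, defined by the seminorms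
`f ↦ sup_{x ∈ K} ‖D^i (f ∘ e⁻¹)(x)‖`, for `e` a chart, `K ⊆ e(dom e)` compact and `i ∈ ℕ`. -/
instance [I.Boundaryless] [IsManifold I ∞ N] : TopologicalSpace (SmoothFun I N) :=
  seminormTopology fun a : SeminormIndex I N =>
    derivSeminorm (SmoothFun.rep a.e) a.e.1.isOpen_extend_target a.isCompact a.subset
      (SmoothFun.contDiffOn_rep a.e) a.order

/-- The pullback of a complex-valued `q`-form on `N` to the image in `E` of the domain of a
chart `e`. -/
def formRep (q : ℕ) (e : Chart I N) :
    (∀ x : N, TangentSpace I x [⋀^Fin q]→L[ℝ] ℂ) →ₗ[ℂ] (E → E [⋀^Fin q]→L[ℝ] ℂ) where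
  toFun η y := (η ((e.1.extend I).symm y)).compContinuousLinearMap
    (mfderiv 𝓘(ℝ, E) I (e.1.extend I).symm y)
  map_add' _ _ := rfl
  map_smul' _ _ := rfl

variable (I N)

/-- The complex vector space of smooth complex-valued `q`-forms on `N`: those whose pullbacks under
the inverses of all charts are smooth. -/
def smoothFormSubmodule (q : ℕ) : Submodule ℂ (∀ x : N, TangentSpace I x [⋀^Fin q]→L[ℝ] ℂ) where
  carrier := {η | ∀ e : Chart I N, ContDiffOn ℝ ∞ (formRep q e η) (e.1.extend I).target}
  zero_mem' e := by rw [map_zero]; exact contDiffOn_const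
  add_mem' hf hg e := by rw [map_add]; exact (hf e).add (hg e)
  smul_mem' c _ hf e := by rw [map_smul]; exact (hf e).const_smul c

/-- `Λ^q C^∞(N)`, the space of smooth complex-valued `q`-forms on `N`. -/
def SmoothForm (q : ℕ) : Type _ := smoothFormSubmodule I N q

instance (q : ℕ) : AddCommGroup (SmoothForm I N q) :=
  inferInstanceAs (AddCommGroup (smoothFormSubmodule I N q))

instance (q : ℕ) : Module ℂ (SmoothForm I N q) :=
  inferInstanceAs (Module ℂ (smoothFormSubmodule I N q))

variable {I N}

/-- The value of a form at a point. -/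
def SmoothForm.val {q : ℕ} (η : SmoothForm I N q) (x : N) : TangentSpace I x [⋀^Fin q]→L[ℝ] ℂ :=
  Subtype.val η x

/-- The topology of `Λ^q C^∞(N)`: uniform convergence on compact subsets of chart domains of the
local representatives with all their derivatives. -/
instance [I.Boundaryless] (q : ℕ) : TopologicalSpace (SmoothForm I N q) :=
  seminormTopology fun a : SeminormIndex I N =>
    derivSeminorm ((formRep q a.e).domRestrict (smoothFormSubmodule I N q))
      a.e.1.isOpen_extend_target a.isCompact a.subset (fun η => η.2 a.e) a.order

end Manifold

/-! ### Forms on `M × 𝕋^m` -/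

section Torus

instance boundaryless_pi {ι : Type*} [Fintype ι] {E H : ι → Type*} [∀ i, NormedAddCommGroup (E i)]
    [∀ i, NormedSpace ℝ (E i)] [∀ i, TopologicalSpace (H i)]
    (I : ∀ i, ModelWithCorners ℝ (E i) (H i)) [∀ i, (I i).Boundaryless] :
    (ModelWithCorners.pi I).Boundaryless where
  range_eq_univ := by
    refine Function.Surjective.range_eq fun y => ?_
    choose x hx using fun i => (range_eq_univ.1 (I i).range_eq_univ) (y i)
    exact ⟨x, funext hx⟩

/-- The torus `𝕋^m = (ℝ / 2πℤ)^m`, as the `m`-fold product of the unit circle. -/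
abbrev Torus (m : ℕ) := Fin m → Circle

/-- The model of the manifold `𝕋^m`. -/
abbrev torusModel (m : ℕ) := ModelWithCorners.pi fun _ : Fin m => 𝓡 1

variable (n : ℕ) (M : Type*) [TopologicalSpace M] [ChartedSpace (Eucl n) M]

/-- `Λ^{0,q} C^∞(M × 𝕋^m)`: the smooth `q`-forms on `M × 𝕋^m` that involve only differentials
coming from `M`, that is, which vanish as soon as one of their arguments is tangent to `𝕋^m`. -/
def horizontalForms (m q : ℕ) :
    Submodule ℂ (SmoothForm ((𝓡 n).prod (torusModel m)) (M × Torus m) q) where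
  carrier := {η | ∀ (p : M × Torus m) (v : Fin q → TangentSpace ((𝓡 n).prod (torusModel m)) p),
    (∃ i, mfderiv ((𝓡 n).prod (torusModel m)) (𝓡 n) Prod.fst p (v i) = 0) → η.val p v = 0}
  zero_mem' _ _ _ := rfl
  add_mem' {η ζ} hη hζ p v h := by
    change η.val p v + ζ.val p v = 0
    rw [hη p v h, hζ p v h, add_zero]
  smul_mem' c η hη p v h := by
    change c • η.val p v = 0
    rw [hη p v h, smul_zero]

end Torus

/-! ### Distributions and local Sobolev spaces on a manifold -/

section Sobolev

variable (n : ℕ) (M : Type*) [TopologicalSpace M] [ChartedSpace (Eucl n) M]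

variable {n M} in
/-- The open subset `e(dom e)` of `ℝⁿ`, for a chart `e`. -/
abbrev Chart.image (e : Chart (𝓡 n) M) : Opens (Eucl n) := ⟨e.1.target, e.1.open_target⟩

/-- `𝓓'(M)`: a distribution on `M` is a family of distributions `u_e ∈ 𝓓'(e(dom e))`, one for each
chart `e`, which transform like functions under changes of charts. If `τ = e' ∘ e⁻¹` and `ψ` is a
test function supported in `e'(dom e ∩ dom e')`, then `u_{e'}(ψ) = u_e(θ)` with
`θ = |det Dτ| (ψ ∘ τ)` on `e(dom e ∩ dom e')`, extended by zero. -/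
def distributionSubmodule : Submodule ℂ (∀ e : Chart (𝓡 n) M, 𝓓'(Chart.image e, ℂ)) where
  carrier := {u | ∀ (e e' : Chart (𝓡 n) M) (ψ : 𝓓(Chart.image e', ℝ)) (θ : 𝓓(Chart.image e, ℝ)),
    tsupport ψ ⊆ (e.1.symm ≫ₕ e'.1).target →
    (∀ x ∈ (e.1.symm ≫ₕ e'.1).source,
      θ x = |(fderiv ℝ (e.1.symm ≫ₕ e'.1) x).det| * ψ ((e.1.symm ≫ₕ e'.1) x)) →
    (∀ x ∉ (e.1.symm ≫ₕ e'.1).source, θ x = 0) → u e' ψ = u e θ}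
  zero_mem' _ _ _ _ _ _ _ := rfl
  add_mem' {u v} hu hv e e' ψ θ h1 h2 h3 := by
    change u e' ψ + v e' ψ = u e θ + v e θ
    rw [hu e e' ψ θ h1 h2 h3, hv e e' ψ θ h1 h2 h3]
  smul_mem' c u hu e e' ψ θ h1 h2 h3 := by
    change c • u e' ψ = c • u e θ
    rw [hu e e' ψ θ h1 h2 h3]

/-- The space `𝓓'(M)`. -/
def ManifoldDistribution : Type _ := distributionSubmodule n M

instance : AddCommGroup (ManifoldDistribution n M) :=
  inferInstanceAs (AddCommGroup (distributionSubmodule n M))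

instance : Module ℂ (ManifoldDistribution n M) :=
  inferInstanceAs (Module ℂ (distributionSubmodule n M))

variable {n M} in
/-- The representative `u_e` of a distribution on `M` in a chart `e`. -/
def ManifoldDistribution.rep (e : Chart (𝓡 n) M) :
    ManifoldDistribution n M →ₗ[ℂ] 𝓓'(Chart.image e, ℂ) where
  toFun u := Subtype.val u e
  map_add' _ _ := rfl
  map_smul' _ _ := rfl

/-- A countable, locally finite atlas of `M` by charts with precompact domains and bounded images,
together with a smooth partition of unity subordinate to it. -/
structure LocalizingAtlas (ι : Type*) where
  countable : Countable ι
  chart : ι → Chart (𝓡 n) M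
  iUnion_source : ⋃ j, (chart j).1.source = univ
  locallyFinite : LocallyFinite fun j => (chart j).1.source
  precompact : ∀ j, IsCompact (closure (chart j).1.source)
  bounded : ∀ j, Bornology.IsBounded (chart j).1.target
  φ : SmoothPartitionOfUnity ι (𝓡 n) M univ
  subordinate : φ.IsSubordinate fun j => (chart j).1.source

variable {n M} {ι : Type*}

theorem LocalizingAtlas.contDiffOn (A : LocalizingAtlas n M ι) (j : ι) :
    ContDiffOn ℝ ∞ (A.φ j ∘ (A.chart j).1.symm) (Chart.image (A.chart j) : Set (Eucl n)) :=
  ((A.φ j).contMDiff.comp_contMDiffOn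
    (contMDiffOn_symm_of_mem_maximalAtlas (A.chart j).2)).contDiffOn

variable (A : LocalizingAtlas n M ι)

/-- `u ↦ (φ_j u) ∘ χ_j⁻¹`, from distributions on `M` to distributions on `χ_j(Ω_j) ⊆ ℝⁿ`. -/
def localize (j : ι) : ManifoldDistribution n M →ₗ[ℂ] 𝓓'(Chart.image (A.chart j), ℂ) :=
  mulDist (A.contDiffOn j) ∘ₗ ManifoldDistribution.rep (A.chart j)

/-- `H^k_loc(M)` as a subspace of `𝓓'(M)`: the distributions `u` such that
`(φ_j u) ∘ χ_j⁻¹ ∈ H^k(χ_j(Ω_j))` for all `j`. -/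
def hloc (k : ℕ) : Submodule ℂ (ManifoldDistribution n M) :=
  ⨅ j, (sobolev k (Chart.image (A.chart j))).comap (localize A j)

/-- `H^k_loc(M)` as a space of its own, to be equipped with its Fréchet topology. -/
def Hloc (k : ℕ) : Type _ := hloc A k

instance (k : ℕ) : AddCommGroup (Hloc A k) := inferInstanceAs (AddCommGroup (hloc A k))

instance (k : ℕ) : Module ℂ (Hloc A k) := inferInstanceAs (Module ℂ (hloc A k))

/-- The map `u ↦ (φ_j u) ∘ χ_j⁻¹` from `H^k_loc(M)` to `H^k(χ_j(Ω_j))`. -/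
def localizeSobolev (k : ℕ) (j : ι) : Hloc A k →ₗ[ℂ] sobolev k (Chart.image (A.chart j)) :=
  ((localize A j).domRestrict (hloc A k)).codRestrict _ fun u => (Submodule.mem_iInf _).1 u.2 j

/-- The topology of `H^k_loc(M)`, defined by the seminorms
`‖u‖_{k,j} = ‖(φ_j u) ∘ χ_j⁻¹‖_{H^k(χ_j(Ω_j))}`. -/
instance (k : ℕ) : TopologicalSpace (Hloc A k) :=
  seminormTopology fun j : ι =>
    (sobolevNorm k (Chart.image (A.chart j))).comp (localizeSobolev A k j)

theorem sobolev_succ_le (k : ℕ) (Ω : Opens (Eucl n)) : sobolev (k + 1) Ω ≤ sobolev k Ω :=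
  fun _ hu => mem_sobolev.2 fun α hα => mem_sobolev.1 hu α (by omega)

theorem hloc_succ_le (k : ℕ) : hloc A (k + 1) ≤ hloc A k :=
  iInf_mono fun _ => Submodule.comap_mono (sobolev_succ_le k _)

/-- The embedding `H^{k+1}_loc(M) ↪ H^k_loc(M)`. -/
def hlocEmbedding (k : ℕ) : Hloc A (k + 1) →ₗ[ℂ] Hloc A k :=
  Submodule.inclusion (hloc_succ_le A k)

/-- The intersection `⋂_k H^k_loc(M) ⊆ 𝓓'(M)`, to be equipped with the projective limit topology. -/
def HlocInter : Type _ := (⨅ k, hloc A k : Submodule ℂ (ManifoldDistribution n M))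

instance : AddCommGroup (HlocInter A) :=
  inferInstanceAs (AddCommGroup (⨅ k, hloc A k : Submodule ℂ (ManifoldDistribution n M)))

instance : Module ℂ (HlocInter A) :=
  inferInstanceAs (Module ℂ (⨅ k, hloc A k : Submodule ℂ (ManifoldDistribution n M)))

/-- The inclusion of `⋂_k H^k_loc(M)` in `H^k_loc(M)`. -/
def HlocInter.incl (k : ℕ) : HlocInter A →ₗ[ℂ] Hloc A k :=
  Submodule.inclusion (iInf_le (hloc A) k)

/-- The projective limit topology on `⋂_k H^k_loc(M)`: the coarsest topology such that all the
inclusions in the spaces `H^k_loc(M)` are continuous. -/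
instance : TopologicalSpace (HlocInter A) :=
  ⨅ k, TopologicalSpace.induced (HlocInter.incl A k) inferInstance

variable {A} in
/-- An element of `⋂_k H^k_loc(M)`, as a distribution on `M`. -/
def HlocInter.toDistribution (u : HlocInter A) : ManifoldDistribution n M := Subtype.val u

/-- The distribution `u` is the one defined by the smooth function `f`: in every chart `e` one has
`u_e(ψ) = ∫ ψ (f ∘ e⁻¹)`. -/
def IsDefinedBy (u : ManifoldDistribution n M) (f : SmoothFun (𝓡 n) M) : Prop :=
  ∀ (e : Chart (𝓡 n) M) (ψ : 𝓓(Chart.image e, ℝ)),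
    ManifoldDistribution.rep e u ψ = ∫ x in e.1.target, ψ x • f.val (e.1.symm x)

end Sobolev

end SobolevFS

end

noncomputable section

namespace SobolevFS

/-! ### Fréchet–Schwartz spaces defined by seminorms -/

section Seminorms

open Filter

variable {S κ : Type*} [AddCommGroup S] [Module ℂ S]

/-! The Fréchet–Schwartz claims rest on Arzelà–Ascoli. Functions and forms are treated together as
objects whose local representatives are smooth, take values in a finite-dimensional space and change
by smooth families of linear maps (`IsLocalRep`). A bound on the derivative of order `i + 1` near a
compact set makes the derivatives of order `i` equicontinuous, so a suitable neighbourhood of zero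
is totally bounded for each seminorm. Countably many compact sets in charts define the topology, and
limits of all derivatives are again smooth. `isFrechetSchwartz_of_isLocalRep` combines these facts;
horizontal forms are a subspace closed under pointwise limits.

The Sobolev claims rest on the Fourier transform. A localization `(φ_j u) ∘ χ_j⁻¹` is supported in a
fixed compact set, so its derivatives in `L²` have Fourier transforms that are monomials times one
continuous function. By Plancherel, high frequencies are small as soon as one more derivative is
bounded, while at bounded frequencies the transforms are uniformly bounded and Lipschitz, hence
controlled by finitely many values; this is Rellich's theorem (`totallyBounded_derivL2`). With
enough derivatives the transform has integrable moments and its inverse transform is smooth, with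
estimates (`exists_smooth_representative`).

To pass to the manifold, `hlocCoord` sends `u` to all the `L²` derivatives of its localizations. It
is a closed embedding into a product of `L²` spaces: its range is cut out by equations that are
continuous after testing. Rellich in each factor and Tychonoff then give the compact embedding. For
the intersection, the local smooth representatives are patched together with cutoffs (`synth`) into
a smooth function. The Leibniz rule bounds Sobolev norms by suprema of derivatives; conversely,
where `φ_j` is bounded below it can be divided out, and Sobolev's estimate bounds the derivatives.
-/

theorem withSeminorms_seminormTopology (p : SeminormFamily ℂ S κ) :
    WithSeminorms (topology := seminormTopology p) p := by
  let _ := seminormTopology p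
  have : IsTopologicalAddGroup S := topologicalAddGroup_iInf fun i =>
    letI := (p i).toSeminormedAddCommGroup
    inferInstance
  exact p.withSeminorms_iff_topologicalSpace_eq_iInf.2 rfl

/-- Bounded subsets of a finite power of a proper space are totally bounded, and a net of the image
lifts to `V`. This finite-dimensional compactness underlies both Arzelà–Ascoli and Rellich. -/
theorem exists_finite_net {X Y W : Type*} [PseudoMetricSpace W] [ProperSpace W] (V : Set X)
    (t : Finset Y) (g : Y → X → W) (hb : ∀ y ∈ t, Bornology.IsBounded (g y '' V))
    {δ : ℝ} (hδ : 0 < δ) :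
    ∃ F ⊆ V, F.Finite ∧ ∀ v ∈ V, ∃ f ∈ F, ∀ y ∈ t, dist (g y v) (g y f) < δ := by
  let G : X → (t → W) := fun x y => g y x
  have hG : Bornology.IsBounded (G '' V) := by
    rw [Bornology.forall_isBounded_image_eval_iff.symm]
    rintro ⟨y, hy⟩
    refine (hb y hy).subset ?_
    rintro _ ⟨_, ⟨x, hx, rfl⟩, rfl⟩
    exact ⟨x, hx, rfl⟩
  have htb : TotallyBounded (G '' V) := hG.isCompact_closure.totallyBounded.subset subset_closure
  obtain ⟨F', hF', hfin, hcov⟩ := htb.exists_subset (Metric.dist_mem_uniformity hδ)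
  obtain ⟨F, hFV, hFfin, hFF'⟩ := (hfin.exists_finset_coe).elim fun F'' h => by
    have : (F'' : Set (t → W)) ⊆ G '' V := h ▸ hF'
    obtain ⟨F, hF, hF2⟩ := exists_subset_image_finite_and.1 ⟨F', hF', hfin, rfl⟩
    exact (⟨F, hF, hF2.1, hF2.2⟩ : ∃ F ⊆ V, F.Finite ∧ F' = G '' F)
  refine ⟨F, hFV, hFfin, fun v hv => ?_⟩
  have := hcov (mem_image_of_mem G hv)
  simp only [mem_iUnion, mem_ofPred_eq] at this
  obtain ⟨w, hw, hd⟩ := this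
  rw [hFF'] at hw
  obtain ⟨f, hf, rfl⟩ := hw
  exact ⟨f, hf, fun y hy => (dist_le_pi_dist (G v) (G f) ⟨y, hy⟩).trans_lt hd⟩

/-- `V` is totally bounded for the seminorm `p`. -/
def SeminormPrecompact (p : Seminorm ℂ S) (V : Set S) : Prop :=
  ∀ ε : ℝ, 0 < ε → ∃ F : Set S, F.Finite ∧ ∀ v ∈ V, ∃ f ∈ F, p (v - f) < ε

theorem SeminormPrecompact.mono {p : Seminorm ℂ S} {V W : Set S} (h : SeminormPrecompact p W)
    (hVW : V ⊆ W) : SeminormPrecompact p V := fun ε hε =>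
  (h ε hε).imp fun _ hF => ⟨hF.1, fun v hv => hF.2 v (hVW hv)⟩

/-- Nets for `p` and for `q` have unrelated centres. For each pair of centres with a common nearby
point of `V`, one such point is chosen; these points form a net for both seminorms, at the cost of
doubling the radius. -/
theorem SeminormPrecompact.sup {p q : Seminorm ℂ S} {V : Set S} (hp : SeminormPrecompact p V)
    (hq : SeminormPrecompact q V) : SeminormPrecompact (p ⊔ q) V := by
  classical
  intro ε hε
  obtain ⟨F, hF, hFV⟩ := hp (ε / 2) (half_pos hε)
  obtain ⟨G, hG, hGV⟩ := hq (ε / 2) (half_pos hε)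
  let c : S × S → S := fun x => if h : ∃ v ∈ V, p (v - x.1) < ε / 2 ∧ q (v - x.2) < ε / 2
    then h.choose else 0
  refine ⟨c '' (F ×ˢ G), (hF.prod hG).image c, fun v hv => ?_⟩
  obtain ⟨f, hf, hvf⟩ := hFV v hv
  obtain ⟨g, hg, hvg⟩ := hGV v hv
  have h : ∃ v ∈ V, p (v - f) < ε / 2 ∧ q (v - g) < ε / 2 := ⟨v, hv, hvf, hvg⟩
  refine ⟨c (f, g), ⟨(f, g), ⟨hf, hg⟩, rfl⟩, ?_⟩
  have hc : c (f, g) = h.choose := dif_pos h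
  obtain ⟨-, h1, h2⟩ := h.choose_spec
  rw [hc]
  have key : ∀ (r : Seminorm ℂ S) (a b x : S), r (a - x) < ε / 2 → r (b - x) < ε / 2 →
      r (a - b) < ε := fun r a b x ha hb => by
    have := map_sub_le_add r (a - x) (b - x)
    rw [sub_sub_sub_cancel_right] at this
    linarith
  rw [Seminorm.sup_apply, max_lt_iff]
  exact ⟨key p _ _ f hvf h1, key q _ _ g hvg h2⟩

theorem seminormPrecompact_finset_sup (s : Finset κ) {p : κ → Seminorm ℂ S} {V : Set S}
    (h : ∀ a ∈ s, SeminormPrecompact (p a) V) : SeminormPrecompact (s.sup p) V := by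
  classical
  induction s using Finset.induction_on with
  | empty => exact fun ε hε => ⟨{0}, finite_singleton 0, fun v _ => ⟨0, rfl, by simpa using hε⟩⟩
  | insert a s _ ih =>
    rw [Finset.sup_insert]
    exact (h a (Finset.mem_insert_self a s)).sup
      (ih fun b hb => h b (Finset.mem_insert_of_mem hb))

/-- A criterion for Fréchet–Schwartz spaces, in terms of a family of seminorms that defines the
topology and of a countable family that defines the same topology. -/
theorem isFrechetSchwartz_of_withSeminorms [TopologicalSpace S] {κ' : Type*} [Countable κ']
    {p : SeminormFamily ℂ S κ} {q : SeminormFamily ℂ S κ'} (hp : WithSeminorms p)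
    (hq : WithSeminorms q) (hsep : ∀ s, (∀ a, p a s = 0) → s = 0)
    (hcomplete : ∀ u : ℕ → S,
      (∀ a, ∀ ε : ℝ, 0 < ε → ∃ N, ∀ m ≥ N, ∀ n ≥ N, p a (u m - u n) < ε) →
        ∃ s, ∀ a, Tendsto (fun n => p a (u n - s)) atTop (𝓝 0))
    (hschwartz : ∀ a, ∃ F : Finset κ, ∃ r : ℝ, 0 < r ∧
      SeminormPrecompact (p a) ((F.sup p).ball 0 r)) :
    IsFrechetSchwartz S := by
  have hG := hp.topologicalAddGroup
  have hfc := hq.firstCountableTopology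
  have hT1 : T1Space S := hp.T1_of_separating fun x hx => by
    contrapose! hx
    exact hsep x hx
  refine ⟨hG, hp.continuousSMul, hp.toLocallyConvexSpace, inferInstance, hfc, ?_, fun U hU => ?_⟩
  · let _ : UniformSpace S := IsTopologicalAddGroup.rightUniformSpace S
    have : IsUniformAddGroup S := isUniformAddGroup_of_addCommGroup
    have : (uniformity S).IsCountablyGenerated := by
      rw [uniformity_eq_comap_nhds_zero]
      infer_instance
    -- The uniformity is countably generated, thanks to the countable family `q`, so Cauchy
    -- sequences suffice.
    refine UniformSpace.complete_of_cauchySeq_tendsto fun u hu => ?_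
    obtain ⟨s, hs⟩ := hcomplete u fun a ε hε => by
      have h0 : (p a).ball 0 ε ∈ 𝓝 (0 : S) :=
        hp.mem_nhds_iff _ _ |>.2 ⟨{a}, ε, hε, by simp⟩
      have h1 : {x : S × S | x.1 - x.2 ∈ (p a).ball 0 ε} ∈ uniformity S := by
        rw [uniformity_eq_comap_nhds_zero_swapped]
        exact preimage_mem_comap h0
      obtain ⟨N, hN⟩ := (cauchySeq_iff.1 hu) _ h1
      exact ⟨N, fun m hm n hn => by simpa [Seminorm.mem_ball] using hN m hm n hn⟩
    refine ⟨s, (hp.tendsto_nhds u s).2 fun a ε hε => ?_⟩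
    exact (hs a).eventually_lt_const hε
  · obtain ⟨s, r, hr, hsU⟩ := (hp.mem_nhds_iff _ _).1 hU
    choose F R hR hF using hschwartz
    refine ⟨⋂ a ∈ s, ((F a).sup p).ball 0 (R a), (biInter_finset_mem s).2 fun a _ =>
      (hp.mem_nhds_iff _ _).2 ⟨F a, R a, hR a, Subset.rfl⟩, fun ε hε => ?_⟩
    -- `U` contains the ball of radius `r` for `s.sup p`, so a net at scale `ε * r` places `v - f`
    -- in `ε U`.
    obtain ⟨T, hT, hcov⟩ := seminormPrecompact_finset_sup s
      (fun a ha => (hF a).mono (iInter₂_subset a ha))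
        (ε * r) (mul_pos hε hr)
    refine ⟨T, hT, fun v hv => ?_⟩
    obtain ⟨f, hf, hvf⟩ := hcov v hv
    have hε' : (ε : ℂ) ≠ 0 := Complex.ofReal_ne_zero.2 hε.ne'
    refine ⟨f, hf, (ε : ℂ) • ((ε : ℂ)⁻¹ • (v - f)), smul_mem_smul_set (hsU ?_), ?_⟩
    · rw [Seminorm.mem_ball, sub_zero, map_smul_eq_mul, norm_inv, Complex.norm_real,
        Real.norm_of_nonneg hε.le, inv_mul_lt_iff₀ hε]
      exact hvf
    · simp only [smul_inv_smul₀ hε', add_sub_cancel]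

end Seminorms

/-! ### Derivatives of smooth functions on compact sets -/

section Calculus

open Filter

variable {E : Type*} [NormedAddCommGroup E] [NormedSpace ℝ E]
  {V : Type*} [NormedAddCommGroup V] [NormedSpace ℝ V]

theorem iteratedFDerivWithin_eq_of_isOpen {Ω : Set E} (hΩ : IsOpen Ω) (f : E → V) (i : ℕ) {x : E}
    (hx : x ∈ Ω) : iteratedFDerivWithin ℝ i f Ω x = iteratedFDeriv ℝ i f x :=
  iteratedFDerivWithin_of_isOpen i hΩ hx

/-- The constant is taken at least `1` so that it is bounded by its positive powers, the form in
which the estimate for derivatives of a composition needs it. -/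
theorem exists_forall_norm_iteratedFDeriv_le {Ω K : Set E} (hΩ : IsOpen Ω) (hK : IsCompact K)
    (hKΩ : K ⊆ Ω) {f : E → V} (hf : ContDiffOn ℝ ∞ f Ω) (k : ℕ) :
    ∃ C : ℝ, 1 ≤ C ∧ ∀ i ≤ k, ∀ x ∈ K, ‖iteratedFDeriv ℝ i f x‖ ≤ C := by
  have h : ∀ i, ∃ C : ℝ, ∀ x ∈ K, ‖iteratedFDeriv ℝ i f x‖ ≤ C := fun i => by
    obtain ⟨C, hC⟩ := bddAbove_iteratedFDeriv hΩ hK hKΩ hf i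
    exact ⟨C, fun x hx => hC ⟨⟨x, hx⟩, rfl⟩⟩
  choose C hC using h
  refine ⟨1 + ∑ i ∈ Finset.range (k + 1), |C i|, le_add_of_nonneg_right
    (Finset.sum_nonneg fun _ _ => abs_nonneg _), fun i hi x hx => ?_⟩
  calc _ ≤ C i := hC i x hx
    _ ≤ |C i| := le_abs_self _
    _ ≤ ∑ i ∈ Finset.range (k + 1), |C i| := Finset.single_le_sum (f := fun i => |C i|)
        (fun _ _ => abs_nonneg _) (Finset.mem_range_succ_iff.2 hi)
    _ ≤ _ := by linarith

/-- The derivatives of `y ↦ A y (g (τ y))`, on a compact set, are bounded by those of `g`, uniformly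
in `g`. -/
theorem exists_norm_iteratedFDeriv_clm_apply_comp_le {E' V' : Type*} [NormedAddCommGroup E']
    [NormedSpace ℝ E'] [NormedAddCommGroup V'] [NormedSpace ℝ V'] {U K : Set E} {Ω : Set E'}
    (hU : IsOpen U) (hΩ : IsOpen Ω) (hK : IsCompact K) (hKU : K ⊆ U) {τ : E → E'}
    (hτ : ContDiffOn ℝ ∞ τ U) (hmaps : MapsTo τ U Ω) {A : E → V →L[ℝ] V'}
    (hA : ContDiffOn ℝ ∞ A U) (k : ℕ) :
    ∃ C : ℝ, 0 ≤ C ∧ ∀ g : E' → V, ContDiffOn ℝ ∞ g Ω → ∀ x ∈ K,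
      ‖iteratedFDeriv ℝ k (fun y => A y (g (τ y))) x‖ ≤
        C * ∑ l ∈ Finset.range (k + 1), ‖iteratedFDeriv ℝ l g (τ x)‖ := by
  obtain ⟨a, ha1, ha⟩ := exists_forall_norm_iteratedFDeriv_le hU hK hKU hA k
  obtain ⟨D, hD1, hD⟩ := exists_forall_norm_iteratedFDeriv_le hU hK hKU hτ k
  have hD0 : 0 ≤ D := zero_le_one.trans hD1
  refine ⟨∑ i ∈ Finset.range (k + 1), (k.choose i : ℝ) * a * ((k - i).factorial * D ^ (k - i)),
    Finset.sum_nonneg fun i _ => by positivity, fun g hg x hx => ?_⟩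
  set G := ∑ l ∈ Finset.range (k + 1), ‖iteratedFDeriv ℝ l g (τ x)‖ with hG
  -- Faà di Bruno's bound for `g ∘ τ`, with the sum `G` majorizing every derivative of `g` at once.
  -- The Leibniz rule for the pairing with `A` follows.
  have hcomp : ∀ j ≤ k, ‖iteratedFDerivWithin ℝ j (g ∘ τ) U x‖ ≤ j.factorial * G * D ^ j := by
    intro j hj
    refine norm_iteratedFDerivWithin_comp_le hg hτ (by exact_mod_cast le_top) hΩ.uniqueDiffOn
      hU.uniqueDiffOn hmaps (hKU hx) (fun i hi => ?_) (fun i hi1 hi => ?_)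
    · rw [iteratedFDerivWithin_eq_of_isOpen hΩ _ _ (hmaps (hKU hx))]
      exact Finset.single_le_sum (f := fun l => ‖iteratedFDeriv ℝ l g (τ x)‖)
        (fun _ _ => norm_nonneg _) (Finset.mem_range_succ_iff.2 (hi.trans hj))
    · rw [iteratedFDerivWithin_eq_of_isOpen hU _ _ (hKU hx)]
      exact (hD i (hi.trans hj) x hx).trans (le_self_pow₀ hD1 (by omega))
  rw [← iteratedFDerivWithin_eq_of_isOpen hU _ _ (hKU hx)]
  refine (norm_iteratedFDerivWithin_clm_apply hA (hg.comp hτ hmaps) hU.uniqueDiffOn (hKU hx)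
    (n := k) (by exact_mod_cast le_top)).trans ?_
  rw [Finset.sum_mul]
  refine Finset.sum_le_sum fun i hi => ?_
  have h1 : ‖iteratedFDerivWithin ℝ i A U x‖ ≤ a := by
    rw [iteratedFDerivWithin_eq_of_isOpen hU _ _ (hKU hx)]
    exact ha i (Finset.mem_range_succ_iff.1 hi) x hx
  calc _ ≤ (k.choose i : ℝ) * a * ((k - i).factorial * G * D ^ (k - i)) := by
        refine mul_le_mul (by gcongr) (hcomp _ (by omega)) (norm_nonneg _) (by positivity)
    _ = _ := by ring

theorem hasFDerivAt_iteratedFDeriv {Ω : Set E} (hΩ : IsOpen Ω) {f : E → V}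
    (hf : ContDiffOn ℝ ∞ f Ω) (i : ℕ) {x : E} (hx : x ∈ Ω) :
    HasFDerivAt (iteratedFDeriv ℝ i f) (iteratedFDeriv ℝ (i + 1) f x).curryLeft x := by
  have h1 : ContDiffAt ℝ 1 (iteratedFDeriv ℝ i f) x :=
    (hf.contDiffAt (hΩ.mem_nhds hx)).iteratedFDeriv_right (by exact_mod_cast le_top)
  have h2 := (h1.differentiableAt one_ne_zero).hasFDerivAt
  rwa [fderiv_iteratedFDeriv] at h2

/-- If all derivatives of a sequence of smooth functions are Cauchy, uniformly on compact sets, then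
the sequence converges to a smooth function with all its derivatives. -/
theorem exists_contDiffOn_tendsto_iteratedFDeriv [FiniteDimensional ℝ E] [CompleteSpace V]
    {Ω : Set E} (hΩ : IsOpen Ω) {f : ℕ → E → V} (hf : ∀ n, ContDiffOn ℝ ∞ (f n) Ω)
    (hc : ∀ K ⊆ Ω, IsCompact K → ∀ i, ∀ ε : ℝ, 0 < ε → ∃ N, ∀ m ≥ N, ∀ n ≥ N, ∀ x ∈ K,
      ‖iteratedFDeriv ℝ i (f m) x - iteratedFDeriv ℝ i (f n) x‖ < ε) :
    ∃ g : E → V, ContDiffOn ℝ ∞ g Ω ∧ ∀ i, ∀ x ∈ Ω,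
      Tendsto (fun n => iteratedFDeriv ℝ i (f n) x) atTop (𝓝 (iteratedFDeriv ℝ i g x)) := by
  have hlim : ∀ i x, ∃ T : E [×i]→L[ℝ] V, x ∈ Ω →
      Tendsto (fun n => iteratedFDeriv ℝ i (f n) x) atTop (𝓝 T) := by
    intro i x
    by_cases hx : x ∈ Ω
    · obtain ⟨T, hT⟩ := cauchySeq_tendsto_of_complete
        (u := fun n => iteratedFDeriv ℝ i (f n) x) <| by
          refine Metric.cauchySeq_iff.2 fun ε hε => ?_
          obtain ⟨N, hN⟩ := hc {x} (singleton_subset_iff.2 hx) isCompact_singleton i ε hε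
          exact ⟨N, fun m hm n hn => by
            rw [dist_eq_norm]
            exact hN m hm n hn x rfl⟩
      exact ⟨T, fun _ => hT⟩
    · exact ⟨0, fun h => absurd h hx⟩
  choose G hG using hlim
  -- Locally uniform convergence at order `i + 1` makes `G (i + 1)` the derivative of `G i`, so the
  -- pointwise limits form a Taylor series of `G 0` and are its derivatives.
  have hloc : ∀ i, TendstoLocallyUniformlyOn (fun n => iteratedFDeriv ℝ i (f n)) (G i) atTop Ω := by
    intro i
    refine (tendstoLocallyUniformlyOn_iff_forall_isCompact hΩ).2 fun K hKΩ hK => ?_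
    refine UniformCauchySeqOn.tendstoUniformlyOn_of_tendsto ?_ fun x hx => hG i x (hKΩ hx)
    refine Metric.uniformCauchySeqOn_iff.2 fun ε hε => ?_
    simpa only [dist_eq_norm] using hc K hKΩ hK i ε hε
  have hder : ∀ i, ∀ x ∈ Ω, HasFDerivAt (G i) (G (i + 1) x).curryLeft x := by
    intro i x hx
    refine hasFDerivAt_of_tendstoLocallyUniformlyOn hΩ
      (f' := fun n y => (iteratedFDeriv ℝ (i + 1) (f n) y).curryLeft)
      (g' := fun y => (G (i + 1) y).curryLeft) ?_
      (fun n y hy => hasFDerivAt_iteratedFDeriv hΩ (hf n) i hy) (fun y hy => hG i y hy) hx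
    exact ((continuousMultilinearCurryLeftEquiv ℝ (fun _ : Fin (i + 1) => E)
      V).isometry.uniformContinuous).comp_tendstoLocallyUniformlyOn (hloc (i + 1))
  have hT : HasFTaylorSeriesUpToOn ((⊤ : ℕ∞) : WithTop ℕ∞) (fun x => (G 0 x).curry0)
      (fun x i => G i x) Ω :=
    ⟨fun _ _ => rfl, fun i _ x hx => (hder i x hx).hasFDerivWithinAt,
      fun i _ x hx => (hder i x hx).continuousAt.continuousWithinAt⟩
  refine ⟨_, hT.contDiffOn, fun i x hx => ?_⟩
  rw [← iteratedFDerivWithin_eq_of_isOpen hΩ _ _ hx,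
    ← hT.eq_iteratedFDerivWithin_of_uniqueDiffOn (by exact_mod_cast le_top) hΩ.uniqueDiffOn hx]
  exact hG i x hx

theorem finiteDimensional_continuousMultilinearMap [FiniteDimensional ℝ E]
    [FiniteDimensional ℝ V] (i : ℕ) : FiniteDimensional ℝ (E [×i]→L[ℝ] V) :=
  FiniteDimensional.of_injective
    (ContinuousMultilinearMap.toMultilinearMapLinear (R' := ℝ) (A := ℝ)
      (M₁ := fun _ : Fin i => E) (M₂ := V)) ContinuousMultilinearMap.toMultilinearMap_injective

theorem finiteDimensional_continuousAlternatingMap [FiniteDimensional ℝ E]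
    [FiniteDimensional ℝ V] (i : ℕ) : FiniteDimensional ℝ (E [⋀^Fin i]→L[ℝ] V) :=
  have := finiteDimensional_continuousMultilinearMap (E := E) (V := V) i
  FiniteDimensional.of_injective
    (ContinuousAlternatingMap.toContinuousMultilinearMapLI (𝕜 := ℝ) (E := E) (F := V)
      (ι := Fin i)).toLinearMap ContinuousAlternatingMap.toContinuousMultilinearMap_injective

/-- Smooth functions whose derivatives of order `i + 1` are bounded on a neighbourhood of `K` are
determined on `K` up to `ε`, with their derivatives of order `i`, by finitely many values. -/
theorem exists_finset_forall_dist_iteratedFDeriv_lt [FiniteDimensional ℝ E] {Ω K : Set E}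
    (hΩ : IsOpen Ω) (hK : IsCompact K) (hKΩ : K ⊆ Ω) (i : ℕ) :
    ∃ K' ⊆ Ω, IsCompact K' ∧ K ⊆ K' ∧ ∀ ε : ℝ, 0 < ε → ∃ t : Finset E, (t : Set E) ⊆ K ∧
      ∀ f g : E → V, ContDiffOn ℝ ∞ f Ω → ContDiffOn ℝ ∞ g Ω →
        (∀ x ∈ K', ‖iteratedFDeriv ℝ (i + 1) f x‖ ≤ 1) →
        (∀ x ∈ K', ‖iteratedFDeriv ℝ (i + 1) g x‖ ≤ 1) →
        (∀ y ∈ t, dist (iteratedFDeriv ℝ i f y) (iteratedFDeriv ℝ i g y) < ε / 3) →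
        ∀ x ∈ K, dist (iteratedFDeriv ℝ i f x) (iteratedFDeriv ℝ i g x) ≤ ε := by
  obtain ⟨r, hr, hrΩ⟩ := hK.exists_cthickening_subset_open hΩ hKΩ
  refine ⟨_, hrΩ, hK.cthickening, Metric.self_subset_cthickening K, fun ε hε => ?_⟩
  -- Balls of this radius about points of `K` stay in the thickening where the derivative of order
  -- `i + 1` is at most `1`, so the mean value inequality gives a variation of at most `ε / 3`.
  have hρ : 0 < min r (ε / 3) := lt_min hr (by positivity)
  obtain ⟨t, htK, htfin, hcov⟩ := hK.finite_cover_balls hρ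
  lift t to Finset E using htfin
  refine ⟨t, htK, fun f g hf hg hf1 hg1 hfg x hx => ?_⟩
  obtain ⟨y, hy, hxy⟩ := mem_iUnion₂.1 (hcov hx)
  have hsub : Metric.ball y (min r (ε / 3)) ⊆ Metric.cthickening r K := fun z hz =>
    Metric.mem_cthickening_of_dist_le z y r K (htK hy)
      ((Metric.mem_ball.1 hz).le.trans (min_le_left _ _))
  have key : ∀ h : E → V, ContDiffOn ℝ ∞ h Ω →
      (∀ x ∈ Metric.cthickening r K, ‖iteratedFDeriv ℝ (i + 1) h x‖ ≤ 1) →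
      dist (iteratedFDeriv ℝ i h x) (iteratedFDeriv ℝ i h y) ≤ ε / 3 := by
    intro h hh hh1
    rw [dist_eq_norm]
    refine ((convex_ball y _).norm_image_sub_le_of_norm_fderiv_le (C := 1)
      (fun z hz => (hasFDerivAt_iteratedFDeriv hΩ hh i (hrΩ (hsub hz))).differentiableAt)
      (fun z hz => ?_) (Metric.mem_ball_self hρ) hxy).trans ?_
    · rw [norm_fderiv_iteratedFDeriv]
      exact hh1 z (hsub hz)
    · rw [one_mul, ← dist_eq_norm]
      exact (Metric.mem_ball.1 hxy).le.trans (min_le_right _ _)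
  calc _ ≤ dist (iteratedFDeriv ℝ i f x) (iteratedFDeriv ℝ i f y)
        + dist (iteratedFDeriv ℝ i f y) (iteratedFDeriv ℝ i g y)
        + dist (iteratedFDeriv ℝ i g y) (iteratedFDeriv ℝ i g x) := dist_triangle4 _ _ _ _
    _ ≤ ε / 3 + ε / 3 + ε / 3 := by
        gcongr
        · exact key f hf hf1
        · exact (hfg y hy).le
        · rw [dist_comm]
          exact key g hg hg1
    _ = ε := by ring

theorem iteratedFDeriv_rep_sub [NormedSpace ℂ V] {S : Type*} [AddCommGroup S]
    [Module ℂ S] {rep : S →ₗ[ℂ] (E → V)} {Ω : Set E} (hΩ : IsOpen Ω)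
    (hrep : ∀ s, ContDiffOn ℝ ∞ (rep s) Ω) (i : ℕ) (s t : S) {x : E} (hx : x ∈ Ω) :
    iteratedFDeriv ℝ i (rep (s - t)) x =
      iteratedFDeriv ℝ i (rep s) x - iteratedFDeriv ℝ i (rep t) x := by
  rw [map_sub, iteratedFDeriv_sub_apply
    (((hrep s).contDiffAt (hΩ.mem_nhds hx)).of_le (by exact_mod_cast le_top))
    (((hrep t).contDiffAt (hΩ.mem_nhds hx)).of_le (by exact_mod_cast le_top))]

variable [NormedSpace ℂ V] [SMulCommClass ℝ ℂ V] {S : Type*} [AddCommGroup S] [Module ℂ S]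
  {rep : S →ₗ[ℂ] (E → V)} {Ω K : Set E} {hΩ : IsOpen Ω} {hK : IsCompact K} {hKΩ : K ⊆ Ω}
  {hrep : ∀ s, ContDiffOn ℝ ∞ (rep s) Ω} {i : ℕ}

theorem norm_le_derivSeminorm (s : S) {x : E} (hx : x ∈ K) :
    ‖iteratedFDeriv ℝ i (rep s) x‖ ≤ derivSeminorm rep hΩ hK hKΩ hrep i s :=
  le_ciSup (bddAbove_iteratedFDeriv hΩ hK hKΩ (hrep s) i) (⟨x, hx⟩ : K)

theorem derivSeminorm_le {s : S} {C : ℝ} (hC : 0 ≤ C)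
    (h : ∀ x ∈ K, ‖iteratedFDeriv ℝ i (rep s) x‖ ≤ C) :
    derivSeminorm rep hΩ hK hKΩ hrep i s ≤ C :=
  Real.iSup_le (fun x => h x x.2) hC

/-- Arzelà–Ascoli: the bound of order `i + 1` gives equicontinuity, and the bound of order `i` gives
relatively compact values, the target being finite-dimensional. The Schwartz property comes from
here. -/
theorem exists_seminormPrecompact_derivSeminorm [FiniteDimensional ℝ E] [FiniteDimensional ℝ V]
    (rep : S →ₗ[ℂ] (E → V)) (hΩ : IsOpen Ω) (hK : IsCompact K) (hKΩ : K ⊆ Ω)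
    (hrep : ∀ s, ContDiffOn ℝ ∞ (rep s) Ω) (i : ℕ) :
    ∃ (K' : Set E) (hK' : IsCompact K') (hKΩ' : K' ⊆ Ω),
      SeminormPrecompact (derivSeminorm rep hΩ hK hKΩ hrep i)
        {s | derivSeminorm rep hΩ hK' hKΩ' hrep i s ≤ 1 ∧
          derivSeminorm rep hΩ hK' hKΩ' hrep (i + 1) s ≤ 1} := by
  obtain ⟨K', hKΩ', hK', hKK', hnet⟩ :=
    exists_finset_forall_dist_iteratedFDeriv_lt (V := V) hΩ hK hKΩ i
  refine ⟨K', hK', hKΩ', fun ε hε => ?_⟩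
  obtain ⟨t, htK, ht⟩ := hnet (ε / 2) (half_pos hε)
  have := finiteDimensional_continuousMultilinearMap (E := E) (V := V) i
  have := FiniteDimensional.proper ℝ (E [×i]→L[ℝ] V)
  obtain ⟨F, hFV, hF, hcov⟩ := exists_finite_net
    {s | derivSeminorm rep hΩ hK' hKΩ' hrep i s ≤ 1 ∧
      derivSeminorm rep hΩ hK' hKΩ' hrep (i + 1) s ≤ 1} t
    (fun y s => iteratedFDeriv ℝ i (rep s) y) (fun y hy => by
      refine (Metric.isBounded_closedBall (x := (0 : E [×i]→L[ℝ] V)) (r := 1)).subset ?_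
      rintro _ ⟨s, hs, rfl⟩
      rw [mem_closedBall_zero_iff]
      exact (norm_le_derivSeminorm s (hKK' (htK hy))).trans hs.1)
    (show 0 < ε / 2 / 3 by positivity)
  refine ⟨F, hF, fun v hv => ?_⟩
  obtain ⟨f, hf, hd⟩ := hcov v hv
  refine ⟨f, hf, (derivSeminorm_le (half_pos hε).le fun x hx => ?_).trans_lt (half_lt_self hε)⟩
  rw [iteratedFDeriv_rep_sub hΩ hrep i v f (hKΩ hx), ← dist_eq_norm]
  exact ht (rep v) (rep f) (hrep v) (hrep f)
    (fun y hy => (norm_le_derivSeminorm v hy).trans hv.2)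
    (fun y hy => (norm_le_derivSeminorm f hy).trans (hFV hf).2) hd x hx

end Calculus

/-! ### Spaces of objects with smooth local representatives on a manifold -/

section LocalRep

open Filter

variable {E : Type*} [NormedAddCommGroup E] [NormedSpace ℝ E]
  {H : Type*} [TopologicalSpace H] {I : ModelWithCorners ℝ E H}
  {N : Type*} [TopologicalSpace N]

theorem mem_extendCoordChange_source {e e' : OpenPartialHomeomorph N H} {y : E} :
    y ∈ (I.extendCoordChange e e').source ↔
      y ∈ (e.extend I).target ∧ (e.extend I).symm y ∈ e'.source := by
  rw [ModelWithCorners.extendCoordChange, PartialEquiv.trans_source, PartialEquiv.symm_source,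
    mem_inter_iff, mem_preimage, OpenPartialHomeomorph.extend_source]

theorem extendCoordChange_apply (e e' : OpenPartialHomeomorph N H) (y : E) :
    I.extendCoordChange e e' y = e'.extend I ((e.extend I).symm y) := rfl

theorem isOpen_extendCoordChange_source [I.Boundaryless] (e e' : OpenPartialHomeomorph N H) :
    IsOpen (I.extendCoordChange e e').source := by
  have h := e.continuousOn_extend_symm (I := I) |>.isOpen_inter_preimage
    e.isOpen_extend_target e'.open_source
  convert h using 1
  ext y
  exact mem_extendCoordChange_source

theorem mapsTo_extendCoordChange (e e' : OpenPartialHomeomorph N H) :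
    MapsTo (I.extendCoordChange e e') (I.extendCoordChange e e').source (e'.extend I).target := by
  intro y hy
  refine (e'.extend I).map_source ?_
  rw [OpenPartialHomeomorph.extend_source]
  exact (mem_extendCoordChange_source.1 hy).2

variable [ChartedSpace H N]
  {V : Type*} [NormedAddCommGroup V] [NormedSpace ℝ V] [NormedSpace ℂ V]
  {S : Type*} [AddCommGroup S] [Module ℂ S]

/-- The local representatives of the elements of `S` are smooth and are related, under changes of
charts, by smooth families of linear maps. -/
structure IsLocalRep (rep : Chart I N → S →ₗ[ℂ] (E → V)) : Prop where
  contDiffOn : ∀ e s, ContDiffOn ℝ ∞ (rep e s) (e.1.extend I).target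
  transition : ∀ e e' : Chart I N, ∃ A : E → V →L[ℝ] V,
    ContDiffOn ℝ ∞ A (I.extendCoordChange e.1 e'.1).source ∧
      ∀ s, ∀ y ∈ (I.extendCoordChange e.1 e'.1).source,
        rep e s y = A y (rep e' s (I.extendCoordChange e.1 e'.1 y))

variable [I.Boundaryless] [SMulCommClass ℝ ℂ V] {rep : Chart I N → S →ₗ[ℂ] (E → V)}

/-- The seminorm `s ↦ sup_{x ∈ K} ‖D^i (rep s)(x)‖` in a chart. -/
def repSeminorm (h : ∀ e s, ContDiffOn ℝ ∞ (rep e s) (e.1.extend I).target)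
    (a : SeminormIndex I N) : Seminorm ℂ S :=
  derivSeminorm (rep a.e) a.e.1.isOpen_extend_target a.isCompact a.subset (h a.e) a.order

/-- Near each point of `a.K` a coordinate change leads into one of the given compact sets, and the
chain rule bounds the derivatives there; compactness leaves finitely many cases. Hence any compact
sets whose interiors cover `N` define the topology. This is applied to a countable cover, for
metrizability, and to the sets where `φ_j` is bounded below. -/
theorem exists_repSeminorm_le_sum [FiniteDimensional ℝ E] (hrep : IsLocalRep rep) {Λ : Type*}
    (b : Λ → SeminormIndex I N)
    (hb : ∀ x : N, ∃ m, x ∈ (b m).e.1.source ∧ ((b m).e.1.extend I) ⁻¹' (b m).K ∈ 𝓝 x)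
    (a : SeminormIndex I N) :
    ∃ (F : Finset (Λ × ℕ)) (C : ℝ), 0 ≤ C ∧ ∀ s, repSeminorm hrep.contDiffOn a s ≤
      C * ∑ c ∈ F, repSeminorm hrep.contDiffOn ⟨(b c.1).e, (b c.1).K, (b c.1).isCompact,
        (b c.1).subset, c.2⟩ s := by
  classical
  set p : Λ × ℕ → Seminorm ℂ S := fun c => repSeminorm hrep.contDiffOn
    ⟨(b c.1).e, (b c.1).K, (b c.1).isCompact, (b c.1).subset, c.2⟩ with hp
  suffices h : ∃ (F : Finset (Λ × ℕ)) (C : ℝ), 0 ≤ C ∧ ∀ s, ∀ y ∈ a.K,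
      ‖iteratedFDeriv ℝ a.order (rep a.e s) y‖ ≤ C * ∑ c ∈ F, p c s by
    obtain ⟨F, C, hC, h⟩ := h
    exact ⟨F, C, hC, fun s => derivSeminorm_le
      (mul_nonneg hC (Finset.sum_nonneg fun _ _ => apply_nonneg _ _)) (h s)⟩
  refine a.isCompact.induction_on (p := fun L => ∃ (F : Finset (Λ × ℕ)) (C : ℝ), 0 ≤ C ∧
    ∀ s, ∀ y ∈ L, ‖iteratedFDeriv ℝ a.order (rep a.e s) y‖ ≤ C * ∑ c ∈ F, p c s)
    ⟨∅, 0, le_rfl, fun _ _ h => h.elim⟩ ?_ ?_ ?_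
  · rintro L L' hLL' ⟨F, C, hC, h⟩
    exact ⟨F, C, hC, fun s y hy => h s y (hLL' hy)⟩
  · rintro L L' ⟨F, C, hC, h⟩ ⟨F', C', hC', h'⟩
    have key : ∀ (G : Finset (Λ × ℕ)) (D : ℝ), 0 ≤ D → D ≤ max C C' → G ⊆ F ∪ F' → ∀ s,
        D * ∑ c ∈ G, p c s ≤ max C C' * ∑ c ∈ F ∪ F', p c s := fun G D hD hDC hG s =>
      mul_le_mul hDC (Finset.sum_le_sum_of_subset_of_nonneg hG fun _ _ _ => apply_nonneg _ _)
        (Finset.sum_nonneg fun _ _ => apply_nonneg _ _) (hD.trans hDC)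
    refine ⟨F ∪ F', max C C', hC.trans (le_max_left _ _), fun s y hy => ?_⟩
    rcases hy with hy | hy
    · exact (h s y hy).trans (key F C hC (le_max_left _ _) Finset.subset_union_left s)
    · exact (h' s y hy).trans (key F' C' hC' (le_max_right _ _) Finset.subset_union_right s)
  · intro y hy
    have hyt := a.subset hy
    obtain ⟨m, hm, hmK⟩ := hb ((a.e.1.extend I).symm y)
    set U := (I.extendCoordChange a.e.1 (b m).e.1).source with hU
    have hUo : IsOpen U := isOpen_extendCoordChange_source _ _
    have hyU : y ∈ U := mem_extendCoordChange_source.2 ⟨hyt, hm⟩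
    obtain ⟨A, hA, hAeq⟩ := hrep.transition a.e (b m).e
    have hW : U ∩ (a.e.1.extend I).symm ⁻¹' (((b m).e.1.extend I) ⁻¹' (b m).K) ∈ 𝓝 y :=
      inter_mem (hUo.mem_nhds hyU) ((a.e.1.continuousAt_extend_symm' hyt).preimage_mem_nhds hmK)
    obtain ⟨L, ⟨hLy, hL⟩, hLW⟩ := (compact_basis_nhds y).mem_iff.1 hW
    obtain ⟨C, hC, hbound⟩ := exists_norm_iteratedFDeriv_clm_apply_comp_le hUo
      ((b m).e.1.isOpen_extend_target (I := I)) hL (hLW.trans inter_subset_left)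
      (ModelWithCorners.contDiffOn_extendCoordChange a.e.2 (b m).e.2)
      (mapsTo_extendCoordChange _ _) hA a.order
    refine ⟨L, mem_nhdsWithin_of_mem_nhds hLy,
      (Finset.range (a.order + 1)).image fun l => (m, l), C, hC, fun s z hz => ?_⟩
    have hzU : z ∈ U := (hLW hz).1
    have heq : rep a.e s =ᶠ[𝓝 z] fun y => A y (rep (b m).e s
        (I.extendCoordChange a.e.1 (b m).e.1 y)) := by
      filter_upwards [hUo.mem_nhds hzU] with y hy using hAeq s y hy
    rw [(heq.iteratedFDeriv ℝ a.order).self_of_nhds,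
      Finset.sum_image fun _ _ _ _ h => congrArg Prod.snd h]
    refine (hbound _ (hrep.contDiffOn _ s) z hz).trans (mul_le_mul_of_nonneg_left
      (Finset.sum_le_sum fun l _ => ?_) hC)
    exact norm_le_derivSeminorm s (hLW hz).2

theorem withSeminorms_repSeminorm_of_cover [FiniteDimensional ℝ E] [TopologicalSpace S]
    (hrep : IsLocalRep rep)
    (htop : WithSeminorms (repSeminorm hrep.contDiffOn)) {Λ : Type*} (b : Λ → SeminormIndex I N)
    (hb : ∀ x : N, ∃ m, x ∈ (b m).e.1.source ∧ ((b m).e.1.extend I) ⁻¹' (b m).K ∈ 𝓝 x) :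
    WithSeminorms (ι := Λ × ℕ) fun c => repSeminorm hrep.contDiffOn ⟨(b c.1).e, (b c.1).K,
      (b c.1).isCompact, (b c.1).subset, c.2⟩ := by
  refine htop.congr (fun c => ⟨{⟨(b c.1).e, (b c.1).K, (b c.1).isCompact, (b c.1).subset, c.2⟩}, 1,
    by simp⟩) (Seminorm.IsBounded.of_real fun a => ?_)
  obtain ⟨F, C, hC, h⟩ := exists_repSeminorm_le_sum hrep b hb a
  refine ⟨F, C * F.card, fun s => (h s).trans ?_⟩
  rw [mul_assoc]
  refine mul_le_mul_of_nonneg_left ?_ hC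
  rw [← nsmul_eq_mul]
  exact Finset.sum_le_card_nsmul _ _ _ fun c hc => Seminorm.le_finset_sup_apply
    (p := fun c : Λ × ℕ => repSeminorm hrep.contDiffOn ⟨(b c.1).e, (b c.1).K, (b c.1).isCompact,
      (b c.1).subset, c.2⟩) hc

variable [IsManifold I ∞ N]

theorem exists_countable_cover_seminormIndex [FiniteDimensional ℝ E] [SigmaCompactSpace N] :
    ∃ Λ : Set N, Λ.Countable ∧ ∃ b : Λ → SeminormIndex I N, ∀ x : N, ∃ m,
      x ∈ (b m).e.1.source ∧ ((b m).e.1.extend I) ⁻¹' (b m).K ∈ 𝓝 x := by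
  let ch : N → Chart I N := fun x => ⟨chartAt H x, IsManifold.chart_mem_maximalAtlas x⟩
  have hx : ∀ x, (ch x).1.extend I x ∈ ((ch x).1.extend I).target := fun x =>
    ((ch x).1.extend I).map_source (by
      rw [OpenPartialHomeomorph.extend_source]
      exact mem_chart_source H x)
  choose K hK hxK hKt using fun x =>
    exists_compact_subset ((ch x).1.isOpen_extend_target (I := I)) (hx x)
  have hO : ∀ x, IsOpen ((ch x).1.source ∩ ((ch x).1.extend I) ⁻¹' interior (K x)) := fun x => by
    have := ((ch x).1.continuousOn_extend (I := I)).isOpen_inter_preimage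
      (ch x).1.isOpen_extend_source isOpen_interior (t := interior (K x))
    rwa [OpenPartialHomeomorph.extend_source] at this
  obtain ⟨Λ, hΛ, hcov⟩ := countable_cover_nhds_of_sigmaCompact fun x =>
    (hO x).mem_nhds ⟨mem_chart_source H x, hxK x⟩
  refine ⟨Λ, hΛ, fun x => ⟨ch x, K x, hK x, hKt x, 0⟩, fun x => ?_⟩
  have hxu : x ∈ ⋃ x ∈ Λ, (ch x).1.source ∩ ((ch x).1.extend I) ⁻¹' interior (K x) := by
    rw [hcov]; trivial
  obtain ⟨y, hy, hxy⟩ := mem_iUnion₂.1 hxu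
  exact ⟨⟨y, hy⟩, hxy.1, mem_of_superset ((hO y).mem_nhds hxy)
    fun z hz => interior_subset (s := K y) hz.2⟩

/-- A space whose elements have smooth local representatives, with the topology of uniform
convergence of these representatives with all their derivatives, is a Fréchet–Schwartz space, as
soon as it contains the limits of its sequences. -/
theorem isFrechetSchwartz_of_isLocalRep [FiniteDimensional ℝ E] [FiniteDimensional ℝ V]
    [SigmaCompactSpace N] [TopologicalSpace S] (hrep : IsLocalRep rep)
    (htop : WithSeminorms (repSeminorm hrep.contDiffOn))
    (hsep : ∀ s, (∀ e, ∀ y ∈ (e.1.extend I).target, rep e s y = 0) → s = 0)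
    (hlim : ∀ (u : ℕ → S) (g : Chart I N → E → V),
      (∀ e, ∀ y ∈ (e.1.extend I).target, Tendsto (fun n => rep e (u n) y) atTop (𝓝 (g e y))) →
      (∀ e, ContDiffOn ℝ ∞ (g e) (e.1.extend I).target) →
      ∃ s, ∀ e, ∀ y ∈ (e.1.extend I).target, rep e s y = g e y) :
    IsFrechetSchwartz S := by
  classical
  obtain ⟨Λ, hΛ, b, hb⟩ := exists_countable_cover_seminormIndex (I := I) (N := N)
  have : Countable Λ := hΛ
  refine isFrechetSchwartz_of_withSeminorms htop
    (withSeminorms_repSeminorm_of_cover hrep htop b hb) (fun s hs => ?_) (fun u hu => ?_)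
    fun a => ?_
  · refine hsep s fun e y hy => ?_
    have h := norm_le_derivSeminorm (hΩ := e.1.isOpen_extend_target (I := I))
      (hK := isCompact_singleton) (hKΩ := singleton_subset_iff.2 hy) (hrep := hrep.contDiffOn e)
      (i := 0) s (mem_singleton y)
    rw [norm_iteratedFDeriv_zero] at h
    exact norm_le_zero_iff.1 (h.trans_eq (hs ⟨e, {y}, isCompact_singleton,
      singleton_subset_iff.2 hy, 0⟩))
  · have hcauchy : ∀ e : Chart I N, ∀ K ⊆ (e.1.extend I).target, IsCompact K → ∀ i, ∀ ε : ℝ,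
        0 < ε → ∃ N, ∀ m ≥ N, ∀ n ≥ N, ∀ x ∈ K,
          ‖iteratedFDeriv ℝ i (rep e (u m)) x - iteratedFDeriv ℝ i (rep e (u n)) x‖ < ε := by
      intro e K hKt hK i ε hε
      obtain ⟨N, hN⟩ := hu ⟨e, K, hK, hKt, i⟩ ε hε
      refine ⟨N, fun m hm n hn x hx => ?_⟩
      rw [← iteratedFDeriv_rep_sub e.1.isOpen_extend_target (hrep.contDiffOn e) i _ _ (hKt hx)]
      exact (norm_le_derivSeminorm _ hx).trans_lt (hN m hm n hn)
    have := FiniteDimensional.complete ℝ V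
    choose g hg hgt using fun e : Chart I N => exists_contDiffOn_tendsto_iteratedFDeriv
      (e.1.isOpen_extend_target (I := I)) (fun n => hrep.contDiffOn e (u n)) (hcauchy e)
    obtain ⟨s, hs⟩ := hlim u g (fun e y hy => by
      have h0 := hgt e 0 y hy
      have h1 := ((continuousMultilinearCurryFin0 ℝ E V).continuous.tendsto _).comp h0
      exact h1) hg
    refine ⟨s, fun a => ?_⟩
    refine Metric.tendsto_atTop.2 fun ε hε => ?_
    obtain ⟨N, hN⟩ := hcauchy a.e a.K a.subset a.isCompact a.order (ε / 2) (half_pos hε)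
    refine ⟨N, fun n hn => ?_⟩
    rw [Real.dist_0_eq_abs, abs_of_nonneg (apply_nonneg _ _)]
    refine (derivSeminorm_le (half_pos hε).le fun x hx => ?_).trans_lt (half_lt_self hε)
    have hxt := a.subset hx
    rw [iteratedFDeriv_rep_sub a.e.1.isOpen_extend_target (hrep.contDiffOn a.e) _ _ _ hxt]
    have heq : rep a.e s =ᶠ[𝓝 x] g a.e := by
      filter_upwards [(a.e.1.isOpen_extend_target (I := I)).mem_nhds hxt] with y hy using hs a.e y hy
    rw [(heq.iteratedFDeriv ℝ a.order).self_of_nhds]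
    -- Let `m → ∞` in the Cauchy estimate for fixed `n`; the threshold does not depend on `x`, so
    -- the bound is uniform on `a.K`.
    exact le_of_tendsto ((tendsto_const_nhds.sub (hgt a.e a.order x hxt)).norm)
      (eventually_atTop.2 ⟨N, fun m hm => (hN n hn m hm x hx).le⟩)
  · obtain ⟨K', hK', hKt', hpre⟩ := exists_seminormPrecompact_derivSeminorm (rep a.e)
      (a.e.1.isOpen_extend_target (I := I)) a.isCompact a.subset (hrep.contDiffOn a.e) a.order
    refine ⟨{⟨a.e, K', hK', hKt', a.order⟩, ⟨a.e, K', hK', hKt', a.order + 1⟩}, 1, one_pos,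
      hpre.mono fun s hs => ?_⟩
    rw [Finset.sup_insert, Finset.sup_singleton, Seminorm.mem_ball, sub_zero, Seminorm.sup_apply,
      max_lt_iff] at hs
    exact ⟨hs.1.le, hs.2.le⟩

end LocalRep

/-! ### Smooth functions and forms -/

section FunctionsAndForms

open Filter

variable {E : Type*} [NormedAddCommGroup E] [NormedSpace ℝ E]
  {H : Type*} [TopologicalSpace H] {I : ModelWithCorners ℝ E H}
  {N : Type*} [TopologicalSpace N] [ChartedSpace H N]

/-- The preferred chart at a point. -/
def preferredChart (I : ModelWithCorners ℝ E H) {N : Type*} [TopologicalSpace N]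
    [ChartedSpace H N] [IsManifold I ∞ N] (x : N) : Chart I N :=
  ⟨chartAt H x, IsManifold.chart_mem_maximalAtlas x⟩

theorem extendCoordChange_symm_apply {e e' : Chart I N} {y : E}
    (hy : y ∈ (I.extendCoordChange e.1 e'.1).source) :
    (e'.1.extend I).symm (I.extendCoordChange e.1 e'.1 y) = (e.1.extend I).symm y := by
  rw [extendCoordChange_apply]
  refine (e'.1.extend I).left_inv ?_
  rw [OpenPartialHomeomorph.extend_source]
  exact (mem_extendCoordChange_source.1 hy).2

theorem contMDiffAt_extend_symm [I.Boundaryless] (e : Chart I N) {y : E}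
    (hy : y ∈ (e.1.extend I).target) :
    ContMDiffAt 𝓘(ℝ, E) I ∞ (e.1.extend I).symm y := by
  have h := contMDiffOn_extend_symm (I := I) e.2
  rw [← OpenPartialHomeomorph.extend_target'] at h
  exact h.contMDiffAt (e.1.isOpen_extend_target.mem_nhds hy)

theorem SmoothFun.ext {f g : SmoothFun I N} (h : ∀ x, f.val x = g.val x) : f = g :=
  Subtype.ext (funext h)

variable {q : ℕ}

/-- The value of a form at a point, as an alternating map on the model space. -/
def formVal (η : ∀ x : N, TangentSpace I x [⋀^Fin q]→L[ℝ] ℂ) (x : N) : E [⋀^Fin q]→L[ℝ] ℂ := η x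

/-- The derivative of the inverse of a chart, as a map on the model space. -/
def chartSymmDeriv (e : Chart I N) (y : E) : E →L[ℝ] E :=
  mfderiv 𝓘(ℝ, E) I (e.1.extend I).symm y

theorem formRep_apply (η : ∀ x : N, TangentSpace I x [⋀^Fin q]→L[ℝ] ℂ) (e : Chart I N) (y : E) :
    formRep q e η y =
      (formVal η ((e.1.extend I).symm y)).compContinuousLinearMap (chartSymmDeriv e y) := rfl

/-- Chain rule for `e⁻¹ = e'⁻¹ ∘ τ`. It shows that representatives of a form in two charts differ by
pullback along `Dτ`. -/
theorem chartSymmDeriv_eq_comp [I.Boundaryless] {e e' : Chart I N} {y : E}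
    (hy : y ∈ (I.extendCoordChange e.1 e'.1).source) :
    chartSymmDeriv e y = (chartSymmDeriv e' (I.extendCoordChange e.1 e'.1 y)).comp
      (fderiv ℝ (I.extendCoordChange e.1 e'.1) y) := by
  have hyo := (isOpen_extendCoordChange_source e.1 e'.1 (I := I)).mem_nhds hy
  have h1 : MDifferentiableAt 𝓘(ℝ, E) I (e'.1.extend I).symm (I.extendCoordChange e.1 e'.1 y) :=
    (contMDiffAt_extend_symm _ (mapsTo_extendCoordChange _ _ hy)).mdifferentiableAt (by simp)
  have h2 : MDifferentiableAt 𝓘(ℝ, E) 𝓘(ℝ, E) (I.extendCoordChange e.1 e'.1) y :=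
    (((ModelWithCorners.contDiffOn_extendCoordChange e.2 e'.2).contDiffAt
      hyo).differentiableAt (by simp)).mdifferentiableAt
  have h3 := mfderiv_comp y h1 h2
  have h4 : (e'.1.extend I).symm ∘ I.extendCoordChange e.1 e'.1 =ᶠ[𝓝 y] (e.1.extend I).symm := by
    filter_upwards [hyo] with z hz using extendCoordChange_symm_apply hz
  rw [h4.mfderiv_eq, mfderiv_eq_fderiv] at h3
  exact h3

/-- Pullback is polynomial in the linear map. For multilinear maps this is the smoothness of a
continuous multilinear map; a linear left inverse of the inclusion of alternating maps, continuous
by finite dimension, carries it over. -/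
theorem contDiffOn_compContinuousLinearMapCLM [FiniteDimensional ℝ E] {U : Set E}
    {L : E → E →L[ℝ] E} (hL : ContDiffOn ℝ ∞ L U) :
    ContDiffOn ℝ ∞ (fun y => (ContinuousAlternatingMap.compContinuousLinearMapCLM (L y) :
      (E [⋀^Fin q]→L[ℝ] ℂ) →L[ℝ] (E [⋀^Fin q]→L[ℝ] ℂ))) U := by
  have h1 := finiteDimensional_continuousAlternatingMap (E := E) (V := ℂ) q
  have h2 := finiteDimensional_continuousMultilinearMap (E := E) (V := ℂ) q
  refine contDiffOn_clm_apply.2 fun β => ?_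
  obtain ⟨R, hR⟩ := LinearMap.exists_leftInverse_of_injective
    ((ContinuousAlternatingMap.toContinuousMultilinearMapLI (𝕜 := ℝ) (E := E) (F := ℂ)
      (ι := Fin q)).toLinearMap) (LinearMap.ker_eq_bot.2
        ContinuousAlternatingMap.toContinuousMultilinearMap_injective)
  have h3 : ContDiffOn ℝ ∞ (fun y => β.toContinuousMultilinearMap.compContinuousLinearMap
      fun _ => L y) U := by
    have h4 := ContinuousMultilinearMap.contDiff (𝕜 := ℝ) (E := fun _ : Fin q => E →L[ℝ] E)
      (F := (E [×q]→L[ℝ] ℂ) →L[ℝ] (E [×q]→L[ℝ] ℂ)) (n := ∞)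
      (ContinuousMultilinearMap.compContinuousLinearMapContinuousMultilinear ℝ
        (fun _ : Fin q => E) (fun _ : Fin q => E) ℂ)
    exact (h4.comp_contDiffOn (contDiffOn_pi.2 fun _ => hL)).clm_apply
      (contDiffOn_const (c := β.toContinuousMultilinearMap))
  refine ((LinearMap.toContinuousLinearMap R).contDiff.comp_contDiffOn h3).congr fun y _ => ?_
  exact (DFunLike.congr_fun hR (β.compContinuousLinearMap (L y))).symm

/-- The local representatives of a smooth form. -/
def SmoothForm.rep (e : Chart I N) : SmoothForm I N q →ₗ[ℂ] (E → E [⋀^Fin q]→L[ℝ] ℂ) :=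
  (formRep q e).domRestrict (smoothFormSubmodule I N q)

theorem SmoothForm.isLocalRep [I.Boundaryless] [FiniteDimensional ℝ E] :
    IsLocalRep (SmoothForm.rep :
      Chart I N → SmoothForm I N q →ₗ[ℂ] (E → E [⋀^Fin q]→L[ℝ] ℂ)) where
  contDiffOn e η := η.2 e
  transition e e' := by
    refine ⟨fun y => ContinuousAlternatingMap.compContinuousLinearMapCLM
      (fderiv ℝ (I.extendCoordChange e.1 e'.1) y), contDiffOn_compContinuousLinearMapCLM ?_,
      fun η y hy => ?_⟩
    · exact (ModelWithCorners.contDiffOn_extendCoordChange e.2 e'.2).fderiv_of_isOpen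
        (isOpen_extendCoordChange_source _ _) (by simp)
    · change formRep q e η.1 y = (formRep q e' η.1 _).compContinuousLinearMap _
      rw [formRep_apply, formRep_apply, extendCoordChange_symm_apply hy,
        chartSymmDeriv_eq_comp hy]
      rfl

theorem SmoothForm.withSeminorms [I.Boundaryless] [FiniteDimensional ℝ E] :
    WithSeminorms (repSeminorm (SmoothForm.isLocalRep (I := I) (N := N) (q := q)).contDiffOn) :=
  withSeminorms_seminormTopology _

variable [IsManifold I ∞ N]

theorem extChartAt_mem_target (x : N) :
    extChartAt I x x ∈ ((preferredChart I x).1.extend I).target :=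
  mem_extChartAt_target x

theorem preferredChart_symm_extChartAt (x : N) :
    ((preferredChart I x).1.extend I).symm (extChartAt I x x) = x :=
  extChartAt_to_inv x

theorem SmoothFun.isLocalRep :
    IsLocalRep (SmoothFun.rep : Chart I N → SmoothFun I N →ₗ[ℂ] (E → ℂ)) where
  contDiffOn e f := SmoothFun.contDiffOn_rep e f
  transition _ _ := ⟨fun _ => ContinuousLinearMap.id ℝ ℂ, contDiffOn_const, fun f _ hy =>
    congrArg f.val (extendCoordChange_symm_apply hy).symm⟩

theorem SmoothFun.withSeminorms [I.Boundaryless] :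
    WithSeminorms (repSeminorm (SmoothFun.isLocalRep (I := I) (N := N)).contDiffOn) :=
  withSeminorms_seminormTopology _

theorem contMDiff_of_rep_eq [I.Boundaryless] {f : N → ℂ} {g : Chart I N → E → ℂ}
    (hg : ∀ e, ContDiffOn ℝ ∞ (g e) (e.1.extend I).target)
    (hfg : ∀ e, ∀ y ∈ (e.1.extend I).target, f ((e.1.extend I).symm y) = g e y) :
    ContMDiff I 𝓘(ℝ, ℂ) ∞ f := by
  intro x
  have h1 : ContMDiffAt 𝓘(ℝ, E) 𝓘(ℝ, ℂ) ∞ (g (preferredChart I x)) (extChartAt I x x) :=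
    ((hg _).contDiffAt ((preferredChart I x).1.isOpen_extend_target.mem_nhds
      (extChartAt_mem_target x))).contMDiffAt
  refine (h1.comp x (contMDiffAt_extChartAt (I := I) (n := ∞))).congr_of_eventuallyEq ?_
  filter_upwards [extChartAt_source_mem_nhds (I := I) x] with z hz
  have := hfg (preferredChart I x) (extChartAt I x z) ((extChartAt I x).map_source hz)
  exact (congrArg f ((extChartAt I x).left_inv hz)).symm.trans this

theorem SmoothFun.isFrechetSchwartz [I.Boundaryless] [FiniteDimensional ℝ E]
    [SigmaCompactSpace N] : IsFrechetSchwartz (SmoothFun I N) := by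
  refine isFrechetSchwartz_of_isLocalRep SmoothFun.isLocalRep SmoothFun.withSeminorms
    (fun f hf => SmoothFun.ext fun x => ?_) fun u g hu hg => ?_
  · have := hf (preferredChart I x) _ (extChartAt_mem_target x)
    exact (congrArg f.val (preferredChart_symm_extChartAt x)).symm.trans this
  · let f : N → ℂ := fun x => g (preferredChart I x) (extChartAt I x x)
    have hf : ∀ x, Tendsto (fun n => (u n).val x) atTop (𝓝 (f x)) := fun x => by
      have := hu (preferredChart I x) _ (extChartAt_mem_target x)
      refine this.congr fun n => congrArg (u n).val (preferredChart_symm_extChartAt x)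
    have hfg : ∀ e : Chart I N, ∀ y ∈ (e.1.extend I).target,
        f ((e.1.extend I).symm y) = g e y := fun e y hy =>
      tendsto_nhds_unique (hf _) (hu e y hy)
    exact ⟨⟨f, contMDiff_of_rep_eq hg hfg⟩, hfg⟩

/-- The derivative of the preferred chart at a point, as a map on the model space. -/
def preferredChartDeriv (I : ModelWithCorners ℝ E H) {N : Type*} [TopologicalSpace N]
    [ChartedSpace H N] [IsManifold I ∞ N] (x : N) : E →L[ℝ] E :=
  mfderiv I 𝓘(ℝ, E) (extChartAt I x) x

theorem chartSymmDeriv_comp_preferredChartDeriv [I.Boundaryless] (x : N) :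
    (chartSymmDeriv (preferredChart I x) (extChartAt I x x)).comp (preferredChartDeriv I x) =
      ContinuousLinearMap.id ℝ E := by
  have h1 : MDifferentiableAt 𝓘(ℝ, E) I ((preferredChart I x).1.extend I).symm
      (extChartAt I x x) :=
    (contMDiffAt_extend_symm _ (extChartAt_mem_target x)).mdifferentiableAt (by simp)
  have h2 : MDifferentiableAt I 𝓘(ℝ, E) (extChartAt I x) x :=
    (contMDiffAt_extChartAt (I := I) (n := ∞)).mdifferentiableAt (by simp)
  have h3 := mfderiv_comp x h1 h2
  have h4 : ((preferredChart I x).1.extend I).symm ∘ extChartAt I x =ᶠ[𝓝 x] id := by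
    filter_upwards [extChartAt_source_mem_nhds (I := I) x] with z hz
    exact (extChartAt I x).left_inv hz
  rw [h4.mfderiv_eq, mfderiv_id] at h3
  exact h3.symm

/-- The derivative of the chart inverts that of its inverse, so a form can be rebuilt pointwise from
its representatives. -/
theorem formVal_eq [I.Boundaryless] (η : ∀ x : N, TangentSpace I x [⋀^Fin q]→L[ℝ] ℂ) (x : N) :
    formVal η x = (formRep q (preferredChart I x) η
      (extChartAt I x x)).compContinuousLinearMap (preferredChartDeriv I x) := by
  rw [formRep_apply, preferredChart_symm_extChartAt]
  ext v
  simp only [ContinuousAlternatingMap.compContinuousLinearMap_apply]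
  congr 1
  ext1 i
  exact (DFunLike.congr_fun (chartSymmDeriv_comp_preferredChartDeriv (I := I) x) (v i)).symm

theorem SmoothForm.eq_zero_of_rep [I.Boundaryless] {η : SmoothForm I N q}
    (h : ∀ e : Chart I N, ∀ y ∈ (e.1.extend I).target, SmoothForm.rep e η y = 0) : η = 0 := by
  refine Subtype.ext (funext fun x => ?_)
  have h1 := h (preferredChart I x) _ (extChartAt_mem_target x)
  have h2 := formVal_eq η.1 x
  rw [show formRep q (preferredChart I x) η.1 (extChartAt I x x) = 0 from h1] at h2
  exact h2.trans (map_zero (ContinuousAlternatingMap.compContinuousLinearMapCLM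
    (preferredChartDeriv I x)))

/-- The limit is defined at `x` through the preferred chart there. Then `u n` converges to it
pointwise on `N`, and uniqueness of limits identifies its representative in every chart with `g`, so
no compatibility of the `g e` has to be checked. The pointwise convergence is kept for use on closed
subspaces. -/
theorem SmoothForm.exists_rep_eq_of_tendsto [I.Boundaryless] [FiniteDimensional ℝ E]
    (u : ℕ → SmoothForm I N q) (g : Chart I N → E → E [⋀^Fin q]→L[ℝ] ℂ)
    (hu : ∀ e : Chart I N, ∀ y ∈ (e.1.extend I).target,
      Tendsto (fun n => SmoothForm.rep e (u n) y) atTop (𝓝 (g e y)))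
    (hg : ∀ e, ContDiffOn ℝ ∞ (g e) (e.1.extend I).target) :
    ∃ η : SmoothForm I N q, (∀ e, ∀ y ∈ (e.1.extend I).target, SmoothForm.rep e η y = g e y) ∧
      ∀ x, Tendsto (fun n => formVal (u n).1 x) atTop (𝓝 (formVal η.1 x)) := by
  let η₀ : N → E [⋀^Fin q]→L[ℝ] ℂ := fun x =>
    (g (preferredChart I x) (extChartAt I x x)).compContinuousLinearMap (preferredChartDeriv I x)
  let η : ∀ x : N, TangentSpace I x [⋀^Fin q]→L[ℝ] ℂ := η₀
  have hη : ∀ x, Tendsto (fun n => formVal (u n).1 x) atTop (𝓝 (formVal η x)) := by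
    intro x
    have h1 := ((ContinuousAlternatingMap.compContinuousLinearMapCLM
      (preferredChartDeriv I x)).continuous.tendsto _).comp
        (hu (preferredChart I x) _ (extChartAt_mem_target x))
    refine Tendsto.congr (fun n => ?_) h1
    exact (formVal_eq (u n).1 x).symm
  have hηg : ∀ e : Chart I N, ∀ y ∈ (e.1.extend I).target, formRep q e η y = g e y := by
    intro e y hy
    have h1 := ((ContinuousAlternatingMap.compContinuousLinearMapCLM
      (chartSymmDeriv e y)).continuous.tendsto _).comp (hη ((e.1.extend I).symm y))
    exact tendsto_nhds_unique h1 (hu e y hy)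
  exact ⟨⟨η, fun e => (hg e).congr (hηg e)⟩, hηg, hη⟩

theorem SmoothForm.isFrechetSchwartz [I.Boundaryless] [FiniteDimensional ℝ E]
    [SigmaCompactSpace N] : IsFrechetSchwartz (SmoothForm I N q) := by
  have := finiteDimensional_continuousAlternatingMap (E := E) (V := ℂ) q
  exact isFrechetSchwartz_of_isLocalRep SmoothForm.isLocalRep SmoothForm.withSeminorms
    (fun _ => SmoothForm.eq_zero_of_rep) fun u g hu hg =>
      (SmoothForm.exists_rep_eq_of_tendsto u g hu hg).imp fun _ h => h.1

/-- A subspace of the space of smooth forms that is closed for pointwise convergence is a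
Fréchet–Schwartz space. -/
theorem SmoothForm.isFrechetSchwartz_submodule [I.Boundaryless] [FiniteDimensional ℝ E]
    [SigmaCompactSpace N] (P : Submodule ℂ (SmoothForm I N q))
    (hP : ∀ (u : ℕ → SmoothForm I N q) (η : SmoothForm I N q), (∀ n, u n ∈ P) →
      (∀ x, Tendsto (fun n => formVal (u n).1 x) atTop (𝓝 (formVal η.1 x))) → η ∈ P) :
    IsFrechetSchwartz P := by
  have := finiteDimensional_continuousAlternatingMap (E := E) (V := ℂ) q
  have hrep : IsLocalRep fun e : Chart I N => SmoothForm.rep e ∘ₗ P.subtype :=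
    ⟨fun e η => SmoothForm.isLocalRep.contDiffOn e η.1, fun e e' =>
      (SmoothForm.isLocalRep.transition e e').imp fun A hA => ⟨hA.1, fun η => hA.2 η.1⟩⟩
  refine isFrechetSchwartz_of_isLocalRep hrep
    (Topology.IsInducing.withSeminorms (SmoothForm.withSeminorms (I := I) (N := N) (q := q))
      (f := P.subtype) ⟨rfl⟩)
    (fun η h => Subtype.ext (SmoothForm.eq_zero_of_rep h)) fun u g hu hg => ?_
  obtain ⟨η, hη, hlim⟩ := SmoothForm.exists_rep_eq_of_tendsto (fun n => (u n).1) g hu hg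
  exact ⟨⟨η, hP _ η (fun n => (u n).2) hlim⟩, hη⟩

end FunctionsAndForms

/-! ### Forms on products with tori -/

section TorusForms

open Filter

/-- Changes between product charts act coordinate by coordinate. -/
instance isManifold_pi {ι : Type*} [Fintype ι] {E H : ι → Type*} [∀ i, NormedAddCommGroup (E i)]
    [∀ i, NormedSpace ℝ (E i)] [∀ i, TopologicalSpace (H i)]
    (I : ∀ i, ModelWithCorners ℝ (E i) (H i)) (k : WithTop ℕ∞) (N : ι → Type*)
    [∀ i, TopologicalSpace (N i)] [∀ i, ChartedSpace (H i) (N i)] [∀ i, IsManifold (I i) k (N i)] :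
    IsManifold (ModelWithCorners.pi I) k (∀ i, N i) := by
  refine isManifold_of_contDiffOn _ _ _ ?_
  rintro _ _ ⟨f, hf, rfl⟩ ⟨g, hg, rfl⟩
  refine contDiffOn_pi.2 fun i => ?_
  have h := (contDiffGroupoid k (I i)).compatible (hf i trivial) (hg i trivial)
  rw [contDiffGroupoid, mem_groupoid_of_pregroupoid] at h
  have h1 : ContDiffOn ℝ k (I i ∘ ((f i).symm ≫ₕ g i) ∘ (I i).symm)
    ((I i).symm ⁻¹' ((f i).symm ≫ₕ g i).source ∩ range (I i)) := h.1
  refine h1.comp (ContinuousLinearMap.proj (R := ℝ) (φ := E) i).contDiff.contDiffOn ?_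
  rintro _ ⟨hy, x, rfl⟩
  refine ⟨?_, mem_range_self (x i)⟩
  rw [mem_preimage, OpenPartialHomeomorph.trans_source] at hy ⊢
  exact ⟨hy.1 i trivial, hy.2 i trivial⟩

variable (n : ℕ) (M : Type*) [TopologicalSpace M] [ChartedSpace (Eucl n) M]
    [IsManifold (𝓡 n) ∞ M] [SigmaCompactSpace M]

theorem isFrechetSchwartz_smoothForm_torus (m q : ℕ) :
    IsFrechetSchwartz (SmoothForm ((𝓡 n).prod (torusModel m)) (M × Torus m) q) :=
  SmoothForm.isFrechetSchwartz

/-- Horizontality says that certain evaluations at fixed vectors vanish, which survives pointwise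
limits. -/
theorem isFrechetSchwartz_horizontalForms (m q : ℕ) :
    IsFrechetSchwartz (horizontalForms n M m q) := by
  refine SmoothForm.isFrechetSchwartz_submodule _ fun u η hu hlim p v h => ?_
  have h1 := ((continuous_eval_const (F := (Eucl n × (Fin m → Eucl 1)) [⋀^Fin q]→L[ℝ] ℂ)
    v).tendsto _).comp (hlim p)
  exact tendsto_nhds_unique h1 (tendsto_const_nhds.congr fun k => (hu k p v h).symm)

end TorusForms

/-! ### The Fourier transform of integrable functions -/

section Fourier

open scoped FourierTransform SchwartzMap
open Filter

variable {n : ℕ}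

theorem integral_fourier_smul_eq_flip {f g : Eucl n → ℂ} (hf : Integrable f) (hg : Integrable g) :
    ∫ ξ, 𝓕 f ξ • g ξ = ∫ x, f x • 𝓕 g x := by
  have h := VectorFourier.integral_fourierIntegral_smul_eq_flip (L := innerₗ (Eucl n))
    Real.continuous_fourierChar continuous_inner hf hg
  rwa [flip_innerₗ] at h

theorem L2_norm_sq {α : Type*} [MeasurableSpace α] {μ : Measure α} (g : Lp ℂ 2 μ) :
    ‖g‖ ^ 2 = ∫ x, ‖g x‖ ^ 2 ∂μ := by
  rw [@norm_sq_eq_re_inner ℂ, L2.inner_def]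
  have h : ∀ x, inner ℂ (g x) (g x) = ((‖g x‖ ^ 2 : ℝ) : ℂ) := fun x => by
    rw [inner_self_eq_norm_sq_to_K]; norm_cast
  simp_rw [h]
  exact (congrArg RCLike.re (integral_ofReal (𝕜 := ℂ))).trans (RCLike.ofReal_re _)

/-- Against a test function, both the `L²` transform and the integral transform can be moved to the
other factor, so they define the same distribution. -/
theorem fourier_toLp_ae_eq {f : Eucl n → ℂ} (hf : Integrable f) (hf2 : MemLp f 2) :
    (𝓕 (hf2.toLp f) : Lp ℂ 2 (volume : Measure (Eucl n))) =ᵐ[volume] 𝓕 f := by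
  have hcont : Continuous (𝓕 f) := VectorFourier.fourierIntegral_continuous
    Real.continuous_fourierChar continuous_inner hf
  refine ae_eq_of_integral_contDiff_smul_eq ((Lp.memLp _).locallyIntegrable (by norm_num))
    hcont.locallyIntegrable fun ψ hψ hψc => ?_
  have hc : HasCompactSupport fun x => (ψ x : ℂ) := hψc.comp_left Complex.ofReal_zero
  let θ : 𝓢(Eucl n, ℂ) := hc.toSchwartzMap (Complex.ofRealCLM.contDiff.comp hψ)
  have hθ : ∀ x, θ x = ψ x := fun x => rfl
  have h := congrArg (fun T => T θ) (Lp.fourier_toTemperedDistribution_eq (hf2.toLp f))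
  simp only [TemperedDistribution.fourier_apply, Lp.toTemperedDistribution_apply] at h
  have h1 : ∫ x, 𝓕 θ x • (hf2.toLp f) x = ∫ x, 𝓕 θ x • f x := integral_congr_ae (by
    filter_upwards [hf2.coeFn_toLp] with x hx
    rw [hx])
  have h2 : ∫ x, 𝓕 θ x • f x = ∫ x, θ x • 𝓕 f x :=
    integral_fourier_smul_eq_flip θ.integrable hf
  simp only [Complex.real_smul, ← hθ]
  exact (h1.symm.trans h).symm.trans h2 

/-- **Plancherel's theorem** for functions in `L¹ ∩ L²`. -/
theorem memLp_fourier {f : Eucl n → ℂ} (hf : Integrable f) (hf2 : MemLp f 2) :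
    MemLp (𝓕 f) 2 ∧ ∫ ξ, ‖𝓕 f ξ‖ ^ 2 = ∫ x, ‖f x‖ ^ 2 := by
  have h := fourier_toLp_ae_eq hf hf2
  refine ⟨(Lp.memLp (𝓕 (hf2.toLp f))).ae_eq h, ?_⟩
  have h1 := L2_norm_sq (𝓕 (hf2.toLp f))
  rw [Lp.norm_fourier_eq, L2_norm_sq] at h1
  calc _ = ∫ ξ, ‖(𝓕 (hf2.toLp f) : Lp ℂ 2 (volume : Measure (Eucl n))) ξ‖ ^ 2 :=
        integral_congr_ae (by filter_upwards [h] with x hx; rw [hx])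
    _ = _ := h1.symm.trans (integral_congr_ae (by
        filter_upwards [hf2.coeFn_toLp] with x hx; rw [hx]))

/-- Fourier inversion in weak form, since `f` need not be continuous: the test function, being
Schwartz, is written as a transform, and the transform is then moved across twice, up to a
reflection. -/
theorem integral_smul_fourierInv_fourier {f : Eucl n → ℂ} (hf : Integrable f)
    (hf' : Integrable (𝓕 f)) {ψ : Eucl n → ℝ} (hψ : ContDiff ℝ ∞ ψ) (hψc : HasCompactSupport ψ) :
    ∫ x, ψ x • f x = ∫ x, ψ x • 𝓕⁻ (𝓕 f) x := by
  have hc : HasCompactSupport fun x => (ψ x : ℂ) := hψc.comp_left Complex.ofReal_zero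
  let θ : 𝓢(Eucl n, ℂ) := hc.toSchwartzMap (Complex.ofRealCLM.contDiff.comp hψ)
  have hθ : ∀ x, θ x = ψ x := fun x => rfl
  have h1 : ∀ x, 𝓕 (𝓕⁻ θ) x = θ x := fun x => by rw [FourierTransform.fourier_fourierInv_eq]
  simp only [Complex.real_smul, ← hθ]
  calc ∫ x, θ x * f x = ∫ x, 𝓕 (⇑(𝓕⁻ θ : 𝓢(Eucl n, ℂ))) x • f x := by simp_rw [← h1]; rfl
    _ = ∫ x, (𝓕⁻ θ : 𝓢(Eucl n, ℂ)) x • 𝓕 f x :=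
      integral_fourier_smul_eq_flip (𝓕⁻ θ : 𝓢(Eucl n, ℂ)).integrable hf
    _ = ∫ x, 𝓕 (⇑θ) (-x) • 𝓕 f x := by
      refine integral_congr_ae (ae_of_all _ fun x => ?_)
      simp only
      rw [← Real.fourierInv_eq_fourier_neg, SchwartzMap.fourierInv_coe]
    _ = ∫ x, 𝓕 (⇑θ) x • 𝓕 f (-x) := by
      rw [← integral_neg_eq_self]; simp
    _ = ∫ x, θ x • 𝓕 (fun x => 𝓕 f (-x)) x :=
      integral_fourier_smul_eq_flip θ.integrable hf'.comp_neg
    _ = _ := by simp_rw [← Real.fourierInv_eq_fourier_comp_neg]; rfl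

theorem contDiff_fourierInv {F : Eucl n → ℂ} (hF : ∀ i : ℕ, Integrable fun ξ => ‖ξ‖ ^ i * ‖F ξ‖) :
    ContDiff ℝ ∞ (𝓕⁻ F) := by
  rw [Real.fourierInv_eq_fourier_comp_neg]
  refine Real.contDiff_fourier (N := ⊤) fun i _ => ?_
  simpa using (hF i).comp_neg

theorem norm_iteratedFDeriv_fourierInv_le {F : Eucl n → ℂ} (hFm : AEStronglyMeasurable F)
    (hF : ∀ i : ℕ, Integrable fun ξ => ‖ξ‖ ^ i * ‖F ξ‖) (i : ℕ) (x : Eucl n) :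
    ‖iteratedFDeriv ℝ i (𝓕⁻ F) x‖ ≤ (2 * Real.pi) ^ i * ∫ ξ, ‖ξ‖ ^ i * ‖F ξ‖ := by
  have hF' : ∀ i : ℕ, Integrable fun ξ => ‖ξ‖ ^ i * ‖F (-ξ)‖ := fun i => by
    simpa using (hF i).comp_neg
  have hm : AEStronglyMeasurable fun ξ => F (-ξ) :=
    hFm.comp_quasiMeasurePreserving (Measure.measurePreserving_neg volume).quasiMeasurePreserving
  rw [Real.fourierInv_eq_fourier_comp_neg,
    Real.iteratedFDeriv_fourier (N := ⊤) (fun j _ => hF' j) hm (n := i) le_top]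
  refine (VectorFourier.norm_fourierIntegral_le_integral_norm _ _ _ _ _).trans ?_
  rw [← integral_const_mul]
  have h2 : ∫ ξ, (2 * Real.pi) ^ i * (‖ξ‖ ^ i * ‖F ξ‖) =
      ∫ ξ, (2 * Real.pi) ^ i * (‖ξ‖ ^ i * ‖F (-ξ)‖) := by
    rw [← integral_neg_eq_self]; simp
  rw [h2]
  refine integral_mono_of_nonneg (ae_of_all _ fun _ => norm_nonneg _) ((hF' i).const_mul _)
    (ae_of_all _ fun ξ => ?_)
  refine (VectorFourier.norm_fourierPowSMulRight_le _ _ _ _).trans ?_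
  -- Only an inequality: in dimension zero this norm vanishes.
  have h1 : ‖innerSL ℝ (E := Eucl n)‖ ^ i ≤ 1 := pow_le_one₀ (ContinuousLinearMap.opNorm_nonneg _) (norm_innerSL_le ℝ)
  calc (2 * Real.pi * ‖innerSL ℝ (E := Eucl n)‖) ^ i * ‖ξ‖ ^ i * ‖F (-ξ)‖
      = ‖innerSL ℝ (E := Eucl n)‖ ^ i * ((2 * Real.pi) ^ i * (‖ξ‖ ^ i * ‖F (-ξ)‖)) := by ring
    _ ≤ 1 * ((2 * Real.pi) ^ i * (‖ξ‖ ^ i * ‖F (-ξ)‖)) := by gcongr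
    _ = _ := one_mul _

end Fourier

/-! ### Distributions supported in a compact set and their Fourier transforms -/

section SuppIn

open Filter
open scoped FourierTransform

variable {n : ℕ} {Ω : Opens (Eucl n)} {K : Set (Eucl n)}

/-- The distribution `T` is supported in `K`. -/
def SuppIn (K : Set (Eucl n)) (T : 𝓓'(Ω, ℂ)) : Prop :=
  ∀ ψ : 𝓓(Ω, ℝ), Disjoint (tsupport ψ) K → T ψ = 0

/-- Test functions with equal germs along `K` have a difference whose support misses `K`. -/
theorem SuppIn.congr {T : 𝓓'(Ω, ℂ)} (hT : SuppIn K T) {ψ θ : 𝓓(Ω, ℝ)}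
    (h : ∀ x ∈ K, ψ =ᶠ[𝓝 x] θ) : T ψ = T θ := by
  rw [← sub_eq_zero, ← map_sub]
  refine hT _ (disjoint_left.2 fun x hx hxK => ?_)
  rw [tsupport, mem_closure_iff_frequently] at hx
  obtain ⟨y, hy, hy'⟩ := (hx.and_eventually (h x hxK)).exists
  exact hy (by simp [hy'])

theorem partialDeriv_apply (i : Fin n) (T : 𝓓'(Ω, ℂ)) (ψ : 𝓓(Ω, ℝ)) :
    partialDeriv i T ψ = -T (∂_{EuclideanSpace.single i (1 : ℝ)} ψ) := by
  change (∂_{EuclideanSpace.single i (1 : ℝ)} T) ψ = _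
  rw [Distribution.lineDerivOp_apply_apply, map_neg]

theorem lineDerivOp_testFunction_apply (v : Eucl n) (ψ : 𝓓(Ω, ℝ)) (x : Eucl n) :
    (∂_{v} ψ) x = fderiv ℝ ψ x v := by
  change (TestFunction.lineDerivCLM ℝ v ψ : 𝓓(Ω, ℝ)) x = _
  rw [TestFunction.lineDerivCLM_apply_of_le (by exact_mod_cast le_top),
    (ψ.contDiff.differentiable (by simp)).differentiableAt.lineDeriv_eq_fderiv]

theorem SuppIn.partialDeriv {T : 𝓓'(Ω, ℂ)} (hT : SuppIn K T) (i : Fin n) :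
    SuppIn K (partialDeriv i T) := fun ψ hψ => by
  rw [partialDeriv_apply, hT, neg_zero]
  refine hψ.mono_left (closure_minimal (fun x hx => ?_) (isClosed_tsupport ψ))
  rw [Function.mem_support, lineDerivOp_testFunction_apply] at hx
  by_contra h
  refine hx ?_
  rw [notMem_tsupport_iff_eventuallyEq] at h
  rw [h.fderiv_eq]
  simp

/-- The cutoff is `1` near each point of `K`, not only on `K`, so that its derivatives do not
contribute. -/
theorem exists_cutoff (hK : IsCompact K) (hKΩ : K ⊆ Ω) :
    ∃ η : 𝓓(Ω, ℝ), ∀ x ∈ K, ∀ᶠ y in 𝓝 x, η y = 1 := by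
  obtain ⟨L, hL, hKL, hLΩ⟩ := exists_compact_between hK Ω.isOpen hKΩ
  obtain ⟨f, h1, h0, -⟩ := exists_contMDiffMap_one_nhds_of_subset_interior
    𝓘(ℝ, Eucl n) (n := ⊤) hK.isClosed hKL
  have hsub : tsupport f ⊆ L := closure_minimal (fun x hx => by_contra fun h => hx (h0 x h))
    hL.isClosed
  exact ⟨⟨f, f.contMDiff.contDiff, hL.of_isClosed_subset (isClosed_tsupport _) hsub,
    hsub.trans hLΩ⟩, fun x hx => h1.filter_mono (nhds_le_nhdsSet hx)⟩

variable (Ω) in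
/-- The extension by zero of an `L²` function on `Ω`. -/
def zeroExt (g : L2 Ω) : Eucl n → ℂ := indicator (Ω : Set (Eucl n)) g

theorem memLp_zeroExt (g : L2 Ω) : MemLp (zeroExt Ω g) 2 :=
  (memLp_indicator_iff_restrict Ω.isOpen.measurableSet).2 (Lp.memLp g)

theorem integral_norm_sq_zeroExt (g : L2 Ω) : ∫ x, ‖zeroExt Ω g x‖ ^ 2 = ‖g‖ ^ 2 := by
  rw [L2_norm_sq, ← integral_indicator Ω.isOpen.measurableSet]
  refine integral_congr_ae (ae_of_all _ fun x => ?_)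
  by_cases hx : x ∈ (Ω : Set (Eucl n)) <;> simp [zeroExt, hx]

theorem ofL2_apply (g : L2 Ω) (ψ : 𝓓(Ω, ℝ)) :
    ofL2 Ω g ψ = ∫ x, ψ x • zeroExt Ω g x := by
  change ofFun Ω g ψ = _
  rw [ofFun_apply (locallyIntegrableOn_L2 g), ← integral_indicator Ω.isOpen.measurableSet]
  refine integral_congr_ae (ae_of_all _ fun x => ?_)
  by_cases hx : x ∈ (Ω : Set (Eucl n)) <;> simp [zeroExt, hx]

theorem integrable_smul_zeroExt (g : L2 Ω) (ψ : 𝓓(Ω, ℝ)) :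
    Integrable fun x => ψ x • zeroExt Ω g x := by
  have h : LocallyIntegrableOn (zeroExt Ω g) (Ω : Set (Eucl n)) volume :=
    ((memLp_zeroExt g).locallyIntegrable (by norm_num)).locallyIntegrableOn _
  exact TestFunction.integrable_bilin (ContinuousLinearMap.lsmul ℝ ℝ) h ψ

theorem SuppIn.ae_zeroExt_eq_zero {g : L2 Ω} (hg : SuppIn K (ofL2 Ω g)) (hK : IsClosed K) :
    ∀ᵐ x, x ∉ K → zeroExt Ω g x = 0 := by
  have h : ∀ᵐ x, x ∈ (Ω : Set (Eucl n)) ∩ Kᶜ → zeroExt Ω g x = 0 := by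
    refine (Ω.isOpen.inter hK.isOpen_compl).ae_eq_zero_of_integral_contDiff_smul_eq_zero
      (((memLp_zeroExt g).locallyIntegrable (by norm_num)).locallyIntegrableOn _)
      fun ψ h1 h2 h3 => ?_
    let θ : 𝓓(Ω, ℝ) := ⟨ψ, h1, h2, h3.trans inter_subset_left⟩
    exact (ofL2_apply g θ).symm.trans (hg θ (disjoint_left.2 fun x hx => (h3 hx).2))
  filter_upwards [h] with x hx hxK
  by_cases hxΩ : x ∈ (Ω : Set (Eucl n))
  · exact hx ⟨hxΩ, hxK⟩
  · exact indicator_of_notMem hxΩ _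

theorem SuppIn.integrable_zeroExt {g : L2 Ω} (hg : SuppIn K (ofL2 Ω g)) (hK : IsCompact K) :
    Integrable (zeroExt Ω g) := by
  have : IsFiniteMeasure (volume.restrict K) := ⟨by simpa using hK.measure_lt_top⟩
  have h : IntegrableOn (zeroExt Ω g) K :=
    ((memLp_zeroExt g).mono_measure Measure.restrict_le_self).integrable (by norm_num)
  refine (integrable_indicator_iff hK.measurableSet).2 h |>.congr ?_
  filter_upwards [hg.ae_zeroExt_eq_zero hK.isClosed] with x hx
  by_cases hxK : x ∈ K <;> simp [hxK, hx]

/-- Cauchy–Schwarz on `K`, which has finite volume. -/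
theorem SuppIn.integral_norm_zeroExt_le {g : L2 Ω} (hg : SuppIn K (ofL2 Ω g))
    (hK : IsCompact K) : ∫ x, ‖zeroExt Ω g x‖ ≤ Real.sqrt (volume.real K) * ‖g‖ := by
  have : IsFiniteMeasure (volume.restrict K) := ⟨by simpa using hK.measure_lt_top⟩
  have hL : MemLp (zeroExt Ω g) 2 (volume.restrict K) :=
    (memLp_zeroExt g).mono_measure Measure.restrict_le_self
  have h1 : ∫ x, ‖zeroExt Ω g x‖ = ∫ x in K, ‖zeroExt Ω g x‖ := by
    rw [← integral_indicator hK.measurableSet]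
    refine integral_congr_ae ?_
    filter_upwards [hg.ae_zeroExt_eq_zero hK.isClosed] with x hx
    by_cases hxK : x ∈ K <;> simp [hxK, hx]
  have h2 := integral_mul_norm_le_Lp_mul_Lq (μ := volume.restrict K) (p := 2) (q := 2)
    Real.HolderConjugate.two_two (f := fun _ => (1 : ℂ)) (g := zeroExt Ω g) (memLp_const _)
    (by simpa using hL)
  simp only [norm_one, one_mul, integral_const, measureReal_restrict_apply_univ, smul_eq_mul,
    Real.rpow_two, ← Real.sqrt_eq_rpow, one_pow, mul_one] at h2
  rw [h1]
  refine h2.trans (mul_le_mul_of_nonneg_left ?_ (Real.sqrt_nonneg _))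
  rw [Real.sqrt_le_left (norm_nonneg _), ← integral_norm_sq_zeroExt]
  exact setIntegral_le_integral ((memLp_zeroExt g).integrable_norm_pow (by norm_num))
    (ae_of_all _ fun _ => by positivity)

end SuppIn

/-! ### Derivatives become monomial factors under the Fourier transform -/

section FourierDist

open Filter
open scoped FourierTransform

variable {n : ℕ} {Ω : Opens (Eucl n)} {K : Set (Eucl n)}

theorem contDiff_phase (ξ : Eucl n) {f : ℝ → ℝ} (hf : ContDiff ℝ ∞ f) :
    ContDiff ℝ ∞ fun x : Eucl n => f (2 * Real.pi * inner ℝ x ξ) :=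
  hf.comp (contDiff_const.mul (contDiff_id.inner ℝ contDiff_const))

/-- The test function `x ↦ f(2π⟨x, ξ⟩) η(x)`. -/
def phaseTest (ξ : Eucl n) {f : ℝ → ℝ} (hf : ContDiff ℝ ∞ f) (η : 𝓓(Ω, ℝ)) : 𝓓(Ω, ℝ) :=
  mulTest (contDiff_phase ξ hf).contDiffOn η

theorem phaseTest_apply (ξ : Eucl n) {f : ℝ → ℝ} (hf : ContDiff ℝ ∞ f) (η : 𝓓(Ω, ℝ))
    (x : Eucl n) : phaseTest ξ hf η x = η x * f (2 * Real.pi * inner ℝ x ξ) := rfl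

/-- The Fourier transform of `η T`, as a function. -/
def fourierDist (η : 𝓓(Ω, ℝ)) (T : 𝓓'(Ω, ℂ)) (ξ : Eucl n) : ℂ :=
  T (phaseTest ξ Real.contDiff_cos η) - Complex.I * T (phaseTest ξ Real.contDiff_sin η)

/-- Near `K` the cutoff is `1`, so only the phase is differentiated. Test functions are real-valued,
so the exponential is split into cosine and sine, and both are covered by a general `f`. -/
theorem SuppIn.apply_phaseTest_deriv {T : 𝓓'(Ω, ℂ)} (hT : SuppIn K T) {η : 𝓓(Ω, ℝ)}
    (hη : ∀ x ∈ K, ∀ᶠ y in 𝓝 x, η y = 1) (ξ : Eucl n) (i : Fin n) {f g : ℝ → ℝ}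
    (hf : ContDiff ℝ ∞ f) (hg : ContDiff ℝ ∞ g) (hfg : deriv f = g) :
    T (∂_{EuclideanSpace.single i (1 : ℝ)} (phaseTest ξ hf η)) =
      (2 * Real.pi * ξ i : ℝ) • T (phaseTest ξ hg η) := by
  rw [← map_smul]
  refine hT.congr fun x hx => ?_
  filter_upwards [(hη x hx).eventually_nhds] with y hy
  rw [lineDerivOp_testFunction_apply]
  have h1 : (phaseTest ξ hf η : Eucl n → ℝ) =ᶠ[𝓝 y]
      fun z => f (2 * Real.pi * inner ℝ z ξ) := by
    filter_upwards [hy] with z hz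
    rw [phaseTest_apply, hz, one_mul]
  have h2 : HasFDerivAt (fun z : Eucl n => 2 * Real.pi * inner ℝ z ξ)
      ((2 * Real.pi) • (innerSL ℝ ξ)) y := by
    have := ((innerSL ℝ ξ).hasFDerivAt (x := y)).const_smul (2 * Real.pi)
    refine this.congr_of_eventuallyEq (Eventually.of_forall fun z => ?_)
    simp [real_inner_comm]
  have h3 : HasDerivAt f (g (2 * Real.pi * inner ℝ y ξ)) (2 * Real.pi * inner ℝ y ξ) :=
    hfg ▸ (hf.differentiable (by simp)).differentiableAt.hasDerivAt
  have h4 : HasFDerivAt (fun z : Eucl n => f (2 * Real.pi * inner ℝ z ξ))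
      (g (2 * Real.pi * inner ℝ y ξ) • ((2 * Real.pi) • innerSL ℝ ξ)) y := h3.comp_hasFDerivAt y h2
  rw [h1.fderiv_eq, h4.fderiv]
  have hin : inner ℝ ξ (EuclideanSpace.single i (1 : ℝ)) = ξ i := by
    simp [EuclideanSpace.inner_single_right]
  change g (2 * Real.pi * inner ℝ y ξ) • ((2 * Real.pi) • inner ℝ ξ (EuclideanSpace.single i (1 : ℝ)))
    = (2 * Real.pi * ξ i) • phaseTest ξ hg η y
  rw [phaseTest_apply, hy.self_of_nhds, hin]
  simp only [smul_eq_mul]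
  ring

theorem fourierDist_partialDeriv {T : 𝓓'(Ω, ℂ)} (hT : SuppIn K T) {η : 𝓓(Ω, ℝ)}
    (hη : ∀ x ∈ K, ∀ᶠ y in 𝓝 x, η y = 1) (ξ : Eucl n) (i : Fin n) :
    fourierDist η (partialDeriv i T) ξ =
      (2 * Real.pi * Complex.I * ξ i) * fourierDist η T ξ := by
  have h1 := hT.apply_phaseTest_deriv hη ξ i Real.contDiff_sin Real.contDiff_cos
    (by ext; simp)
  have h2 := hT.apply_phaseTest_deriv hη ξ i Real.contDiff_cos Real.contDiff_sin.neg
    (by ext; simp)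
  have h3 : phaseTest ξ Real.contDiff_sin.neg η = -phaseTest ξ Real.contDiff_sin η := by
    ext x
    change η x * -Real.sin _ = -(η x * Real.sin _)
    ring
  rw [h3, map_neg] at h2
  rw [fourierDist, partialDeriv_apply, partialDeriv_apply, h1, h2, fourierDist]
  simp only [Complex.real_smul]
  push_cast
  linear_combination (2 * Real.pi * ξ i * T (phaseTest ξ Real.contDiff_sin η) : ℂ) * Complex.I_sq

/-- The two conclusions are proved together: each further factor requires the previous derivative to
be supported in `K`. -/
theorem suppIn_multiDeriv_and_fourierDist {T : 𝓓'(Ω, ℂ)} (hT : SuppIn K T) {η : 𝓓(Ω, ℝ)}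
    (hη : ∀ x ∈ K, ∀ᶠ y in 𝓝 x, η y = 1) (α : Fin n → ℕ) :
    SuppIn K (multiDeriv α T) ∧ ∀ ξ, fourierDist η (multiDeriv α T) ξ =
      (∏ i, (2 * Real.pi * Complex.I * ξ i) ^ α i) * fourierDist η T ξ := by
  have hpow : ∀ (S : 𝓓'(Ω, ℂ)), SuppIn K S → ∀ (i : Fin n) (m : ℕ),
      SuppIn K ((((partialDeriv i : Module.End ℂ 𝓓'(Ω, ℂ)) ^ m)) S) ∧ ∀ ξ,
        fourierDist η (((partialDeriv i : Module.End ℂ 𝓓'(Ω, ℂ)) ^ m) S) ξ =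
          (2 * Real.pi * Complex.I * ξ i) ^ m * fourierDist η S ξ := by
    intro S hS i m
    induction m with
    | zero => exact ⟨hS, fun ξ => by simp⟩
    | succ m ih =>
      rw [pow_succ', Module.End.mul_apply]
      refine ⟨ih.1.partialDeriv i, fun ξ => ?_⟩
      rw [fourierDist_partialDeriv ih.1 hη, ih.2, pow_succ']
      ring
  simp only [Fin.prod_univ_def, multiDeriv]
  induction List.finRange n with
  | nil => exact ⟨hT, fun ξ => by simp⟩
  | cons i l ih =>
    simp only [List.map_cons, List.prod_cons, Module.End.mul_apply]
    refine ⟨(hpow _ ih.1 i _).1, fun ξ => ?_⟩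
    rw [(hpow _ ih.1 i _).2, ih.2, ← mul_assoc]

theorem SuppIn.multiDeriv {T : 𝓓'(Ω, ℂ)} (hT : SuppIn K T) (hK : IsCompact K) (hKΩ : K ⊆ Ω)
    (α : Fin n → ℕ) : SuppIn K (multiDeriv α T) :=
  let ⟨_, hη⟩ := exists_cutoff hK hKΩ
  (suppIn_multiDeriv_and_fourierDist hT hη α).1

theorem SuppIn.fourierDist_ofL2 {g : L2 Ω} (hg : SuppIn K (ofL2 Ω g)) (hK : IsCompact K)
    {η : 𝓓(Ω, ℝ)} (hη : ∀ x ∈ K, ∀ᶠ y in 𝓝 x, η y = 1) (ξ : Eucl n) :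
    fourierDist η (ofL2 Ω g) ξ = 𝓕 (zeroExt Ω g) ξ := by
  have hint : ∀ {f : ℝ → ℝ} (hf : ContDiff ℝ ∞ f),
      Integrable fun x => phaseTest ξ hf η x • zeroExt Ω g x := fun hf =>
    integrable_smul_zeroExt g _
  rw [fourierDist, ofL2_apply, ofL2_apply, ← integral_const_mul, ← integral_sub (hint _)
    ((hint _).const_mul _), Real.fourier_eq']
  refine integral_congr_ae ?_
  filter_upwards [hg.ae_zeroExt_eq_zero hK.isClosed] with x hx
  by_cases hxK : x ∈ K
  · simp only [phaseTest_apply, (hη x hxK).self_of_nhds, one_mul, Complex.real_smul, smul_eq_mul]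
    rw [Complex.exp_mul_I, ← Complex.ofReal_cos, ← Complex.ofReal_sin, neg_mul, neg_mul,
      Real.cos_neg, Real.sin_neg]
    push_cast
    ring
  · simp [hx hxK]

/-- The Fourier transform of the `L²` function that represents a derivative. -/
theorem fourier_zeroExt_of_multiDeriv {T : 𝓓'(Ω, ℂ)} (hT : SuppIn K T) (hK : IsCompact K)
    (hKΩ : K ⊆ Ω) {α : Fin n → ℕ} {g g' : L2 Ω} (hg : ofL2 Ω g = T)
    (hg' : ofL2 Ω g' = SobolevFS.multiDeriv α T) (ξ : Eucl n) :
    𝓕 (zeroExt Ω g') ξ = (∏ i, (2 * Real.pi * Complex.I * ξ i) ^ α i) * 𝓕 (zeroExt Ω g) ξ := by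
  obtain ⟨η, hη⟩ := exists_cutoff hK hKΩ
  have h := suppIn_multiDeriv_and_fourierDist hT hη α
  rw [← SuppIn.fourierDist_ofL2 (hg'.symm ▸ h.1) hK hη, hg', h.2,
    ← SuppIn.fourierDist_ofL2 (hg.symm ▸ hT) hK hη, hg]

end FourierDist

/-! ### Rellich's theorem and Sobolev's embedding theorem on open subsets of `ℝⁿ` -/

section Rellich

open Filter
open scoped FourierTransform

variable {n : ℕ} {Ω : Opens (Eucl n)} {K : Set (Eucl n)}

theorem SuppIn.sub {S T : 𝓓'(Ω, ℂ)} (hS : SuppIn K S) (hT : SuppIn K T) : SuppIn K (S - T) :=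
  fun ψ hψ => by
    change S ψ - T ψ = 0
    rw [hS ψ hψ, hT ψ hψ, sub_zero]

theorem SuppIn.continuous_fourier {g : L2 Ω} (hg : SuppIn K (ofL2 Ω g)) (hK : IsCompact K) :
    Continuous (𝓕 (zeroExt Ω g)) :=
  VectorFourier.fourierIntegral_continuous Real.continuous_fourierChar continuous_inner
    (hg.integrable_zeroExt hK)

theorem SuppIn.integrable_norm_sq_fourier {g : L2 Ω} (hg : SuppIn K (ofL2 Ω g))
    (hK : IsCompact K) : Integrable fun ξ => ‖𝓕 (zeroExt Ω g) ξ‖ ^ 2 :=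
  (memLp_fourier (hg.integrable_zeroExt hK) (memLp_zeroExt g)).1.integrable_norm_pow (by norm_num)

theorem SuppIn.integral_norm_sq_fourier {g : L2 Ω} (hg : SuppIn K (ofL2 Ω g))
    (hK : IsCompact K) : ∫ ξ, ‖𝓕 (zeroExt Ω g) ξ‖ ^ 2 = ‖g‖ ^ 2 := by
  rw [(memLp_fourier (hg.integrable_zeroExt hK) (memLp_zeroExt g)).2, integral_norm_sq_zeroExt]

theorem SuppIn.norm_fourier_le {g : L2 Ω} (hg : SuppIn K (ofL2 Ω g)) (hK : IsCompact K)
    (ξ : Eucl n) : ‖𝓕 (zeroExt Ω g) ξ‖ ≤ Real.sqrt (volume.real K) * ‖g‖ :=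
  (VectorFourier.norm_fourierIntegral_le_integral_norm _ _ _ _ _).trans
    (hg.integral_norm_zeroExt_le hK)

theorem SuppIn.fourier_zeroExt_sub {g h : L2 Ω} (hg : SuppIn K (ofL2 Ω g))
    (hh : SuppIn K (ofL2 Ω h)) (hK : IsCompact K) (ξ : Eucl n) :
    𝓕 (zeroExt Ω (g - h)) ξ = 𝓕 (zeroExt Ω g) ξ - 𝓕 (zeroExt Ω h) ξ := by
  have hint : ∀ {g : L2 Ω}, SuppIn K (ofL2 Ω g) →
      Integrable fun v => Real.fourierChar (-inner ℝ v ξ) • zeroExt Ω g v := fun hg =>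
    (Real.fourierIntegral_convergent_iff ξ).2 (hg.integrable_zeroExt hK)
  rw [Real.fourier_eq, Real.fourier_eq, Real.fourier_eq, ← integral_sub (hint hg) (hint hh)]
  refine integral_congr_ae ?_
  filter_upwards [(ae_restrict_iff' Ω.isOpen.measurableSet).1 (Lp.coeFn_sub g h)] with x hx
  rw [← smul_sub]
  by_cases hxΩ : x ∈ (Ω : Set (Eucl n))
  · simp only [zeroExt, indicator_of_mem hxΩ, hx hxΩ, Pi.sub_apply]
  · simp only [zeroExt, indicator_of_notMem hxΩ, sub_zero]

theorem norm_fourierChar_sub_le (a b : ℝ) :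
    ‖(Real.fourierChar a : ℂ) - Real.fourierChar b‖ ≤ 2 * Real.pi * |a - b| := by
  have h1 : (Real.fourierChar a : ℂ) - Real.fourierChar b =
      Real.fourierChar b * (Complex.exp (Complex.I * (2 * Real.pi * (a - b) : ℝ)) - 1) := by
    rw [Real.fourierChar_apply, Real.fourierChar_apply, mul_sub, ← Complex.exp_add, mul_one]
    congr 2
    push_cast
    ring
  rw [h1, norm_mul, Circle.norm_coe, one_mul]
  refine (Real.norm_exp_I_mul_ofReal_sub_one_le).trans_eq ?_
  rw [Real.norm_eq_abs, abs_mul, abs_of_pos Real.two_pi_pos]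

/-- On `K` the characters are Lipschitz in the frequency, with a constant proportional to `r`. This
makes the transforms of an `L²`-bounded family equicontinuous. -/
theorem SuppIn.norm_fourier_sub_le {g : L2 Ω} (hg : SuppIn K (ofL2 Ω g)) (hK : IsCompact K)
    {r : ℝ} (hr : ∀ x ∈ K, ‖x‖ ≤ r) (ξ ζ : Eucl n) :
    ‖𝓕 (zeroExt Ω g) ξ - 𝓕 (zeroExt Ω g) ζ‖ ≤
      2 * Real.pi * r * ‖ξ - ζ‖ * (Real.sqrt (volume.real K) * ‖g‖) := by
  have hint : ∀ ξ : Eucl n, Integrable fun v =>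
      Real.fourierChar (-inner ℝ v ξ) • zeroExt Ω g v := fun ξ =>
    (Real.fourierIntegral_convergent_iff ξ).2 (hg.integrable_zeroExt hK)
  rw [Real.fourier_eq, Real.fourier_eq, ← integral_sub (hint ξ) (hint ζ)]
  calc _ ≤ ∫ v, 2 * Real.pi * r * ‖ξ - ζ‖ * ‖zeroExt Ω g v‖ := by
        refine norm_integral_le_of_norm_le ((hg.integrable_zeroExt hK).norm.const_mul _) ?_
        filter_upwards [hg.ae_zeroExt_eq_zero hK.isClosed] with x hx
        by_cases hxK : x ∈ K
        · rw [Circle.smul_def, Circle.smul_def, ← sub_smul, norm_smul]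
          refine mul_le_mul_of_nonneg_right ((norm_fourierChar_sub_le _ _).trans ?_)
            (norm_nonneg _)
          rw [mul_assoc (2 * Real.pi)]
          refine mul_le_mul_of_nonneg_left ?_ Real.two_pi_pos.le
          rw [neg_sub_neg, ← inner_sub_right, norm_sub_rev]
          exact (abs_real_inner_le_norm _ _).trans
            (mul_le_mul_of_nonneg_right (hr x hxK) (norm_nonneg _))
        · simp [hx hxK]
    _ = 2 * Real.pi * r * ‖ξ - ζ‖ * ∫ v, ‖zeroExt Ω g v‖ := integral_const_mul _ _
    _ ≤ _ := by
        -- For empty `K` the radius `r` could be negative, but then both sides vanish.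
        rcases K.eq_empty_or_nonempty with rfl | ⟨x, hx⟩
        · have h0 : ∫ v, ‖zeroExt Ω g v‖ = 0 := by
            refine integral_eq_zero_of_ae ?_
            filter_upwards [hg.ae_zeroExt_eq_zero isClosed_empty] with x hx
            simp [hx (notMem_empty x)]
          rw [h0]; simp
        · have : 0 ≤ r := (norm_nonneg x).trans (hr x hx)
          exact mul_le_mul_of_nonneg_left (hg.integral_norm_zeroExt_le hK)
            (by have := Real.pi_pos; positivity)

/-- Plancherel, split at `‖ξ‖ = R`. Inside the ball the bound `δ` applies; outside, `R² |f̂|² ≤ ‖ξ‖²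
|f̂|²`, which is at most the sum of the `|f̂'_i|²` because `(2π)² ≥ 1`. -/
theorem norm_sq_le_of_fourier {f : L2 Ω} (hf : SuppIn K (ofL2 Ω f)) (hK : IsCompact K)
    {f' : Fin n → L2 Ω} (hf' : ∀ i, SuppIn K (ofL2 Ω (f' i)))
    (h : ∀ i ξ, 𝓕 (zeroExt Ω (f' i)) ξ = (2 * Real.pi * Complex.I * ξ i) * 𝓕 (zeroExt Ω f) ξ)
    {R δ : ℝ} (hR : 0 < R) (hδ : ∀ ξ, ‖ξ‖ ≤ R → ‖𝓕 (zeroExt Ω f) ξ‖ ≤ δ) :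
    ‖f‖ ^ 2 ≤ volume.real (Metric.closedBall (0 : Eucl n) R) * δ ^ 2 +
      (R ^ 2)⁻¹ * ∑ i, ‖f' i‖ ^ 2 := by
  have hB : MeasurableSet (Metric.closedBall (0 : Eucl n) R) := measurableSet_closedBall
  have hBf : volume (Metric.closedBall (0 : Eucl n) R) ≠ ⊤ :=
    (isCompact_closedBall _ _).measure_lt_top.ne
  have hint1 : Integrable ((Metric.closedBall (0 : Eucl n) R).indicator fun _ => δ ^ 2) :=
    (integrable_indicator_iff hB).2 (integrableOn_const hBf)
  have hint2 : Integrable fun ξ => (R ^ 2)⁻¹ * ∑ i, ‖𝓕 (zeroExt Ω (f' i)) ξ‖ ^ 2 :=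
    (integrable_finsetSum _ fun i _ => (hf' i).integrable_norm_sq_fourier hK).const_mul _
  have h1 : ∫ ξ, (R ^ 2)⁻¹ * ∑ i, ‖𝓕 (zeroExt Ω (f' i)) ξ‖ ^ 2 =
      (R ^ 2)⁻¹ * ∑ i, ‖f' i‖ ^ 2 := by
    rw [integral_const_mul, integral_finsetSum _ fun i _ =>
      (hf' i).integrable_norm_sq_fourier hK]
    simp_rw [fun i => (hf' i).integral_norm_sq_fourier hK]
  have h2 : ∫ ξ, (Metric.closedBall (0 : Eucl n) R).indicator (fun _ => δ ^ 2) ξ =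
      volume.real (Metric.closedBall (0 : Eucl n) R) * δ ^ 2 := by
    rw [integral_indicator_const _ hB, smul_eq_mul]
  rw [← hf.integral_norm_sq_fourier hK, ← h1, ← h2, ← integral_add hint1 hint2]
  refine integral_mono (hf.integrable_norm_sq_fourier hK) (hint1.add hint2) fun ξ => ?_
  have hnn : 0 ≤ (R ^ 2)⁻¹ * ∑ i, ‖𝓕 (zeroExt Ω (f' i)) ξ‖ ^ 2 := by positivity
  simp only
  by_cases hξ : ξ ∈ Metric.closedBall (0 : Eucl n) R
  · rw [indicator_of_mem hξ]
    have := pow_le_pow_left₀ (norm_nonneg _) (hδ ξ (by simpa using hξ)) 2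
    linarith
  · rw [indicator_of_notMem hξ, zero_add, inv_mul_eq_div, le_div_iff₀ (by positivity)]
    have hξ' : R < ‖ξ‖ := by simpa using hξ
    have h3 : ∀ i, (ξ i) ^ 2 * ‖𝓕 (zeroExt Ω f) ξ‖ ^ 2 ≤ ‖𝓕 (zeroExt Ω (f' i)) ξ‖ ^ 2 := by
      intro i
      rw [h, norm_mul, mul_pow]
      refine mul_le_mul_of_nonneg_right ?_ (by positivity)
      simp only [norm_mul, Complex.norm_ofNat, Complex.norm_real, Complex.norm_I, mul_one,
        Real.norm_eq_abs, abs_of_pos Real.pi_pos, mul_pow, sq_abs]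
      have : (1 : ℝ) ≤ 2 ^ 2 * Real.pi ^ 2 := by nlinarith [Real.pi_gt_three]
      nlinarith [sq_nonneg (ξ i)]
    calc ‖𝓕 (zeroExt Ω f) ξ‖ ^ 2 * R ^ 2 ≤ ‖𝓕 (zeroExt Ω f) ξ‖ ^ 2 * ‖ξ‖ ^ 2 := by gcongr
      _ = ∑ i, (ξ i) ^ 2 * ‖𝓕 (zeroExt Ω f) ξ‖ ^ 2 := by
        rw [EuclideanSpace.real_norm_sq_eq, mul_comm, Finset.sum_mul]
      _ ≤ _ := Finset.sum_le_sum fun i _ => h3 i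

/-- The radius `R` makes the high frequencies of differences negligible. On the ball of radius `R`
the transforms are equi-Lipschitz, so values on a finite net determine them up to `3 * δ`, and those
values range over a bounded subset of a finite power of `ℂ`. -/
theorem totallyBounded_of_fourier (hK : IsCompact K) (B : Set (L2 Ω)) (C : ℝ)
    (h : ∀ g ∈ B, SuppIn K (ofL2 Ω g) ∧ ‖g‖ ≤ C ∧ ∀ i, ∃ g' : L2 Ω, SuppIn K (ofL2 Ω g') ∧
      ‖g'‖ ≤ C ∧
        ∀ ξ, 𝓕 (zeroExt Ω g') ξ = (2 * Real.pi * Complex.I * ξ i) * 𝓕 (zeroExt Ω g) ξ) :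
    TotallyBounded B := by
  rcases B.eq_empty_or_nonempty with rfl | ⟨g₀, hg₀⟩
  · exact totallyBounded_empty
  have hC : 0 ≤ C := (norm_nonneg _).trans (h g₀ hg₀).2.1
  obtain ⟨r, hr0, hr⟩ : ∃ r : ℝ, 0 ≤ r ∧ ∀ x ∈ K, ‖x‖ ≤ r := by
    obtain ⟨r, hr⟩ := hK.isBounded.exists_norm_le
    exact ⟨max r 0, le_max_right _ _, fun x hx => (hr x hx).trans (le_max_left _ _)⟩
  rw [Metric.totallyBounded_iff]
  intro ε hε
  -- Chosen so that `4 * C * (n + 1) ≤ ε * R`; differences of derivatives have norm at most `2 * C`,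
  -- so the tail is at most `ε ^ 2 / 4`. The summand `1` keeps `R` positive when `C = 0`.
  set R : ℝ := 1 + 4 * C * (n + 1) / ε with hRdef
  have hR : 0 < R := by positivity
  have hRε : (R ^ 2)⁻¹ * (n * (2 * C) ^ 2) ≤ ε ^ 2 / 4 := by
    rw [inv_mul_le_iff₀ (by positivity)]
    have h1 : 4 * C * (n + 1) ≤ ε * R := by
      have : ε * R = ε + 4 * C * (n + 1) := by rw [hRdef]; field_simp
      linarith
    have h2 : (4 * C * (n + 1)) ^ 2 ≤ (ε * R) ^ 2 := pow_le_pow_left₀ (by positivity) h1 2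
    have h3 : (n : ℝ) ≤ (n + 1) ^ 2 := by nlinarith [Nat.cast_nonneg (α := ℝ) n]
    nlinarith [mul_le_mul_of_nonneg_left h3 (sq_nonneg C)]
  set v := volume.real (Metric.closedBall (0 : Eucl n) R)
  have hv : 0 ≤ v := measureReal_nonneg
  obtain ⟨δ, hδ, hδv⟩ : ∃ δ : ℝ, 0 < δ ∧ v * (3 * δ) ^ 2 ≤ ε ^ 2 / 4 := by
    refine ⟨ε / (6 * (v + 1)), by positivity, ?_⟩
    have : (3 * (ε / (6 * (v + 1)))) = ε / 2 * (v + 1)⁻¹ := by field_simp; norm_num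
    rw [this, mul_pow]
    have h1 : v * ((v + 1)⁻¹) ^ 2 ≤ 1 := by
      rw [inv_pow, ← div_eq_mul_inv, div_le_one (by positivity)]
      nlinarith
    nlinarith [sq_nonneg ε]
  set A : ℝ := Real.sqrt (volume.real K) * C
  have hA : 0 ≤ A := by positivity
  set L : ℝ := 2 * Real.pi * r
  have hL : 0 ≤ L := by have := Real.pi_pos; positivity
  -- `L * A` is a common Lipschitz constant of the transforms, so they vary by at most `δ` on each
  -- ball of the net; the `+ 1` avoids division by zero.
  obtain ⟨t, -, htfin, ht⟩ := Metric.totallyBounded_iff.1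
    (isCompact_closedBall (0 : Eucl n) R).totallyBounded (δ / (L * A + 1)) (by positivity) |>.imp
      fun t ht => (⟨trivial, ht.1, ht.2⟩ : True ∧ _ ∧ _)
  have hlip : ∀ g ∈ B, ∀ ξ ζ, dist ξ ζ < δ / (L * A + 1) →
      ‖𝓕 (zeroExt Ω g) ξ - 𝓕 (zeroExt Ω g) ζ‖ ≤ δ := by
    intro g hg ξ ζ hd
    obtain ⟨h1, h2, -⟩ := h g hg
    rw [dist_eq_norm, lt_div_iff₀ (by positivity)] at hd
    calc _ ≤ L * ‖ξ - ζ‖ * (Real.sqrt (volume.real K) * ‖g‖) := h1.norm_fourier_sub_le hK hr ξ ζ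
      _ ≤ L * ‖ξ - ζ‖ * A := mul_le_mul_of_nonneg_left
        (mul_le_mul_of_nonneg_left h2 (Real.sqrt_nonneg _)) (by positivity)
      _ ≤ δ := by nlinarith [norm_nonneg (ξ - ζ)]
  obtain ⟨F, hFB, hFfin, hF⟩ := exists_finite_net B htfin.toFinset
    (fun ξ (g : L2 Ω) => 𝓕 (zeroExt Ω g) ξ) (fun ξ _ => by
      refine (Metric.isBounded_closedBall (x := (0 : ℂ)) (r := A)).subset ?_
      rintro _ ⟨g, hg, rfl⟩
      rw [mem_closedBall_zero_iff]
      obtain ⟨h1, h2, -⟩ := h g hg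
      exact (h1.norm_fourier_le hK ξ).trans (mul_le_mul_of_nonneg_left h2 (Real.sqrt_nonneg _))) hδ
  refine ⟨F, hFfin, fun g hg => ?_⟩
  obtain ⟨f, hf, hgf⟩ := hF g hg
  obtain ⟨hg1, hg2, hg3⟩ := h g hg
  obtain ⟨hf1, hf2, hf3⟩ := h f (hFB hf)
  choose g' hg'1 hg'2 hg'3 using hg3
  choose f' hf'1 hf'2 hf'3 using hf3
  refine mem_iUnion₂.2 ⟨f, hf, ?_⟩
  rw [Metric.mem_ball, dist_eq_norm]
  refine lt_of_pow_lt_pow_left₀ 2 hε.le ?_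
  have key := norm_sq_le_of_fourier (f := g - f) (f' := fun i => g' i - f' i) (δ := 3 * δ)
    (by rw [map_sub]; exact hg1.sub hf1) hK
    (fun i => by rw [map_sub]; exact (hg'1 i).sub (hf'1 i))
    (fun i ξ => by
      rw [(hg'1 i).fourier_zeroExt_sub (hf'1 i) hK, hg1.fourier_zeroExt_sub hf1 hK, hg'3, hf'3,
        mul_sub]) hR
    (fun ξ hξ => by
      obtain ⟨ζ, hζ, hd⟩ := mem_iUnion₂.1 (ht (mem_closedBall_zero_iff.2 hξ))
      rw [hg1.fourier_zeroExt_sub hf1 hK]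
      have h1 := hlip g hg ξ ζ hd
      have h2 := hlip f (hFB hf) ξ ζ hd
      have h3 := hgf ζ (htfin.mem_toFinset.2 hζ)
      rw [dist_eq_norm] at h3
      have h4 : 𝓕 (zeroExt Ω g) ξ - 𝓕 (zeroExt Ω f) ξ =
        (𝓕 (zeroExt Ω g) ξ - 𝓕 (zeroExt Ω g) ζ) - (𝓕 (zeroExt Ω f) ξ - 𝓕 (zeroExt Ω f) ζ) +
          (𝓕 (zeroExt Ω g) ζ - 𝓕 (zeroExt Ω f) ζ) := by ring
      rw [h4]
      refine (norm_add_le _ _).trans ?_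
      have := norm_sub_le (𝓕 (zeroExt Ω g) ξ - 𝓕 (zeroExt Ω g) ζ)
        (𝓕 (zeroExt Ω f) ξ - 𝓕 (zeroExt Ω f) ζ)
      linarith)
  have hsum : ∑ i, ‖g' i - f' i‖ ^ 2 ≤ n * (2 * C) ^ 2 := by
    refine (Finset.sum_le_card_nsmul _ _ ((2 * C) ^ 2) fun i _ => ?_).trans_eq (by simp)
    refine pow_le_pow_left₀ (norm_nonneg _) ((norm_sub_le _ _).trans ?_) 2
    linarith [hg'2 i, hf'2 i]
  have : (R ^ 2)⁻¹ * ∑ i, ‖g' i - f' i‖ ^ 2 ≤ (R ^ 2)⁻¹ * (n * (2 * C) ^ 2) :=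
    mul_le_mul_of_nonneg_left hsum (by positivity)
  nlinarith [sq_pos_of_pos hε]

theorem norm_derivL2_le {k : ℕ} (α : multiIndices n k) (u : sobolev k Ω) :
    ‖derivL2 α u‖ ≤ sobolevNorm k Ω u := by
  rw [sobolevNorm_apply]
  refine Real.le_sqrt_of_sq_le ?_
  exact Finset.single_le_sum (f := fun α => ‖derivL2 α u‖ ^ 2) (fun _ _ => by positivity)
    (Finset.mem_univ α)

theorem multiDeriv_zero (T : 𝓓'(Ω, ℂ)) : multiDeriv 0 T = T := by
  have h : ∀ l : List (Fin n),
      (l.map fun i => (partialDeriv i : Module.End ℂ 𝓓'(Ω, ℂ)) ^ (0 : Fin n → ℕ) i).prod = 1 := by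
    intro l
    induction l with
    | nil => rfl
    | cons i l ih => rw [List.map_cons, List.prod_cons, ih]; simp
  rw [multiDeriv, h]
  rfl

theorem fourier_derivL2 {k : ℕ} {u : sobolev k Ω} (hu : SuppIn K (u : 𝓓'(Ω, ℂ)))
    (hK : IsCompact K) (hKΩ : K ⊆ Ω) (α : multiIndices n k) (ξ : Eucl n) :
    𝓕 (zeroExt Ω (derivL2 α u)) ξ = (∏ i, (2 * Real.pi * Complex.I * ξ i) ^ (α : Fin n → ℕ) i) *
      𝓕 (zeroExt Ω (derivL2 ⟨0, mem_multiIndices.2 (by simp)⟩ u)) ξ :=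
  fourier_zeroExt_of_multiDeriv hu hK hKΩ
    ((ofL2_derivL2 _ _).trans (multiDeriv_zero _)) (ofL2_derivL2 α u) ξ

theorem suppIn_derivL2 {k : ℕ} {u : sobolev k Ω} (hu : SuppIn K (u : 𝓓'(Ω, ℂ)))
    (hK : IsCompact K) (hKΩ : K ⊆ Ω) (α : multiIndices n k) :
    SuppIn K (ofL2 Ω (derivL2 α u)) := by
  rw [ofL2_derivL2]
  exact hu.multiDeriv hK hKΩ _

/-- **Rellich's theorem**, for distributions supported in a fixed compact set. -/
theorem totallyBounded_derivL2 (hK : IsCompact K) (hKΩ : K ⊆ Ω) {k : ℕ} (α : multiIndices n k)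
    (C : ℝ) : TotallyBounded {g : L2 Ω | ∃ u : sobolev (k + 1) Ω, SuppIn K (u : 𝓓'(Ω, ℂ)) ∧
      sobolevNorm (k + 1) Ω u ≤ C ∧ ofL2 Ω g = multiDeriv (α : Fin n → ℕ) (u : 𝓓'(Ω, ℂ))} := by
  refine totallyBounded_of_fourier hK _ C ?_
  rintro g ⟨u, hu, huC, hg⟩
  have hα := mem_multiIndices.1 α.2
  let α' : multiIndices n (k + 1) := ⟨α, mem_multiIndices.2 (by omega)⟩
  have hg' : g = derivL2 α' u := ofL2_injective Ω (hg.trans (ofL2_derivL2 α' u).symm)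
  rw [hg']
  refine ⟨suppIn_derivL2 hu hK hKΩ α', (norm_derivL2_le _ _).trans huC, fun i => ?_⟩
  -- Here the extra order of regularity is spent: `∂_i ∂^α` has order at most `k + 1`.
  let β : multiIndices n (k + 1) := ⟨(α : Fin n → ℕ) + Pi.single i 1, mem_multiIndices.2 (by
    simp only [Pi.add_apply, Finset.sum_add_distrib, Finset.sum_pi_single', Finset.mem_univ,
      if_true]
    omega)⟩
  refine ⟨derivL2 β u, suppIn_derivL2 hu hK hKΩ β, (norm_derivL2_le _ _).trans huC, fun ξ => ?_⟩
  rw [fourier_derivL2 hu hK hKΩ β, fourier_derivL2 hu hK hKΩ α', ← mul_assoc]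
  congr 1
  simp only [β, α', Pi.add_apply, pow_add, Finset.prod_mul_distrib]
  rw [mul_comm, Finset.prod_eq_single i (fun j _ hj => by simp [hj]) (by simp)]
  simp

end Rellich

/-! ### Sobolev's embedding theorem -/

section SobolevEmbedding

open Filter
open scoped FourierTransform

variable {n : ℕ} {Ω : Opens (Eucl n)} {K : Set (Eucl n)}

/-- Some coordinate satisfies `|ξ i| ≥ ‖ξ‖ / n`, by averaging. The summand `1` is needed for `n = m
= 0`. -/
theorem norm_pow_le_one_add_sum (ξ : Eucl n) (m : ℕ) :
    ‖ξ‖ ^ m ≤ 1 + (n : ℝ) ^ m * ∑ i, |ξ i| ^ m := by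
  have hnn : 0 ≤ (n : ℝ) ^ m * ∑ i, |ξ i| ^ m := by positivity
  rcases n.eq_zero_or_pos with rfl | hn
  · have : ξ = 0 := Subsingleton.elim _ _
    subst this
    rcases m.eq_zero_or_pos with rfl | hm
    · simp
    · simp [hm.ne']
  have h1 : ∃ i ∈ Finset.univ, ‖ξ‖ / n ≤ |ξ i| := by
    refine Finset.exists_le_of_sum_le ⟨⟨0, hn⟩, Finset.mem_univ _⟩ ?_
    simp only [Finset.sum_const, Finset.card_univ, Fintype.card_fin, nsmul_eq_mul]
    rw [mul_div_cancel₀ _ (by positivity)]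
    refine le_of_sq_le_sq ?_ (Finset.sum_nonneg fun i _ => abs_nonneg _)
    rw [EuclideanSpace.real_norm_sq_eq]
    simpa using Finset.sum_sq_le_sq_sum_of_nonneg (s := Finset.univ) (f := fun i => |ξ i|)
      fun i _ => abs_nonneg _
  obtain ⟨i, -, hi⟩ := h1
  rw [div_le_iff₀ (by positivity)] at hi
  have h2 := pow_le_pow_left₀ (norm_nonneg ξ) hi m
  have h3 := Finset.single_le_sum (f := fun i => |ξ i| ^ m) (fun _ _ => by positivity)
    (Finset.mem_univ i)
  have h4 := mul_le_mul_of_nonneg_left h3 (show 0 ≤ (n : ℝ) ^ m by positivity)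
  rw [mul_pow, mul_comm] at h2
  simp only at h4
  linarith

/-- Only `u` and the pure derivatives `∂_i^m u` are needed: their transforms are bounded pointwise
by `L¹` norms, hence on `K` by `L²` norms, and the powers `|ξ i| ^ m` dominate the weight. -/
theorem norm_fourier_weight_le (hK : IsCompact K) (hKΩ : K ⊆ Ω) (m : ℕ) {u : sobolev m Ω}
    (hu : SuppIn K (u : 𝓓'(Ω, ℂ))) (ξ : Eucl n) :
    (1 + ‖ξ‖) ^ m * ‖𝓕 (zeroExt Ω (derivL2 ⟨0, mem_multiIndices.2 (by simp)⟩ u)) ξ‖ ≤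
      2 ^ m * (2 + (n : ℝ) ^ m * n) * Real.sqrt (volume.real K) * sobolevNorm m Ω u := by
  set F := 𝓕 (zeroExt Ω (derivL2 ⟨0, mem_multiIndices.2 (by simp)⟩ u)) ξ
  set N := Real.sqrt (volume.real K) * sobolevNorm m Ω u
  have hN : ∀ α : multiIndices n m, ‖𝓕 (zeroExt Ω (derivL2 α u)) ξ‖ ≤ N := fun α =>
    ((suppIn_derivL2 hu hK hKΩ α).norm_fourier_le hK ξ).trans 
      (mul_le_mul_of_nonneg_left (norm_derivL2_le α u) (Real.sqrt_nonneg _))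
  have h1 : ∀ i, |ξ i| ^ m * ‖F‖ ≤ N := fun i => by
    refine le_trans ?_ (hN ⟨Pi.single i m, mem_multiIndices.2 (by simp)⟩)
    rw [fourier_derivL2 hu hK hKΩ, norm_mul]
    refine mul_le_mul_of_nonneg_right ?_ (norm_nonneg _)
    rw [Finset.prod_eq_single i (fun j _ hj => by simp [hj]) (by simp)]
    simp only [Pi.single_eq_same, norm_pow, norm_mul, Complex.norm_ofNat, Complex.norm_real,
      Complex.norm_I, mul_one, Real.norm_eq_abs, abs_of_pos Real.pi_pos]
    refine pow_le_pow_left₀ (abs_nonneg _) ?_ m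
    nlinarith [Real.pi_gt_three, abs_nonneg (ξ i)]
  have h2 : (1 + ‖ξ‖) ^ m ≤ 2 ^ m * (1 + ‖ξ‖ ^ m) := by
    refine (add_pow_le zero_le_one (norm_nonneg ξ) m).trans ?_
    rw [one_pow]
    gcongr
    · norm_num
    · omega
  calc (1 + ‖ξ‖) ^ m * ‖F‖
      ≤ 2 ^ m * (1 + (1 + (n : ℝ) ^ m * ∑ i, |ξ i| ^ m)) * ‖F‖ := by
        refine mul_le_mul_of_nonneg_right (h2.trans ?_) (norm_nonneg _)
        gcongr
        exact norm_pow_le_one_add_sum ξ m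
    _ = 2 ^ m * (2 * ‖F‖ + (n : ℝ) ^ m * ∑ i, |ξ i| ^ m * ‖F‖) := by
        rw [← Finset.sum_mul]; ring
    _ ≤ 2 ^ m * (2 * N + (n : ℝ) ^ m * ∑ i : Fin n, N) := by
        gcongr with i _
        · exact hN _
        · exact h1 i
    _ = _ := by simp only [Finset.sum_const, Finset.card_univ, Fintype.card_fin, nsmul_eq_mul, N]; ring

/-- **Sobolev's embedding theorem**, for distributions supported in a fixed compact set. -/
theorem exists_smooth_representative (hK : IsCompact K) (hKΩ : K ⊆ Ω) :
    ∃ C : ℕ → ℝ, ∀ T : 𝓓'(Ω, ℂ), SuppIn K T → (∀ k, T ∈ sobolev k Ω) →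
      ∃ v : Eucl n → ℂ, ContDiff ℝ ∞ v ∧ T = ofFun Ω v ∧
        ∀ i x (h : T ∈ sobolev (n + 1 + i) Ω),
          ‖iteratedFDeriv ℝ i v x‖ ≤ C i * sobolevNorm (n + 1 + i) Ω ⟨T, h⟩ := by
  let c : ℕ → ℝ := fun m => 2 ^ m * (2 + (n : ℝ) ^ m * n) * Real.sqrt (volume.real K)
  -- The exponent exceeds the dimension, so `w` is integrable; hence the loss of `n + 1`
  -- derivatives.
  let w : Eucl n → ℝ := fun ξ => (1 + ‖ξ‖) ^ (-((n + 1 : ℕ) : ℝ))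
  have hw : Integrable w := integrable_one_add_norm (by simp)
  refine ⟨fun i => (2 * Real.pi) ^ i * ((∫ ξ, w ξ) * c (n + 1 + i)), fun T hT hs => ?_⟩
  let g : L2 Ω := derivL2 ⟨0, mem_multiIndices.2 (by simp)⟩ (⟨T, hs 0⟩ : sobolev 0 Ω)
  have hg : ofL2 Ω g = T := (ofL2_derivL2 _ _).trans (multiDeriv_zero _)
  have hgK : SuppIn K (ofL2 Ω g) := hg.symm ▸ hT
  set F := 𝓕 (zeroExt Ω g) with hFdef
  have hFc : Continuous F := hgK.continuous_fourier hK
  -- The `L²` representative does not depend on the order, so one function `F` satisfies all the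
  -- decay estimates.
  have hgm : ∀ m, derivL2 ⟨0, mem_multiIndices.2 (by simp)⟩ (⟨T, hs m⟩ : sobolev m Ω) = g :=
    fun m => ofL2_injective Ω (((ofL2_derivL2 _ _).trans (multiDeriv_zero _)).trans hg.symm)
  have hF : ∀ i ξ, ‖ξ‖ ^ i * ‖F ξ‖ ≤
      w ξ * (c (n + 1 + i) * sobolevNorm (n + 1 + i) Ω ⟨T, hs _⟩) := fun i ξ => by
    have h1 := norm_fourier_weight_le hK hKΩ (n + 1 + i) (u := ⟨T, hs _⟩) hT ξ
    rw [hgm] at h1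
    have h2 : w ξ * (1 + ‖ξ‖) ^ (n + 1) = 1 := by
      simp only [w]
      rw [Real.rpow_neg (by positivity), Real.rpow_natCast]
      exact inv_mul_cancel₀ (by positivity)
    calc ‖ξ‖ ^ i * ‖F ξ‖ ≤ (1 + ‖ξ‖) ^ i * ‖F ξ‖ := by gcongr; linarith
      _ = w ξ * ((1 + ‖ξ‖) ^ (n + 1 + i) * ‖F ξ‖) := by
        rw [pow_add]
        linear_combination (-(1 + ‖ξ‖) ^ i * ‖F ξ‖) * h2
      _ ≤ _ := by
        refine mul_le_mul_of_nonneg_left h1 ?_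
        simp only [w]; positivity
  have hFi : ∀ i : ℕ, Integrable fun ξ => ‖ξ‖ ^ i * ‖F ξ‖ := fun i =>
    (hw.mul_const _).mono' (by fun_prop) (ae_of_all _ fun ξ => by
      rw [Real.norm_of_nonneg (by positivity)]; exact hF i ξ)
  refine ⟨𝓕⁻ F, contDiff_fourierInv hFi, ?_, fun i x h => ?_⟩
  · have hFint : Integrable F := by
      have := hFi 0
      simp only [pow_zero, one_mul] at this
      exact (integrable_norm_iff hFc.aestronglyMeasurable).1 this
    ext ψ
    rw [← hg, ofL2_apply, ofFun_apply
      ((contDiff_fourierInv hFi).continuous.locallyIntegrable.locallyIntegrableOn _),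
      setIntegral_eq_integral_of_forall_compl_eq_zero fun x hx => by
        rw [image_eq_zero_of_notMem_tsupport fun hx' => hx (ψ.tsupport_subset hx'), zero_smul]]
    exact integral_smul_fourierInv_fourier (hgK.integrable_zeroExt hK) hFint ψ.contDiff
      ψ.hasCompactSupport
  · refine (norm_iteratedFDeriv_fourierInv_le hFc.aestronglyMeasurable hFi i x).trans ?_
    rw [mul_assoc]
    refine mul_le_mul_of_nonneg_left ?_ (by have := Real.pi_pos; positivity)
    refine (integral_mono (hFi i) (hw.mul_const _) (hF i)).trans_eq ?_
    rw [integral_mul_const]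
    simp only [mul_assoc]

end SobolevEmbedding

/-! ### Derivatives of distributions defined by functions -/

section OfFun

open Filter

variable {n : ℕ} {Ω : Opens (Eucl n)} {K : Set (Eucl n)}

theorem eqOn_of_ofFun_eq {f g : Eucl n → ℂ} (hf : ContinuousOn f Ω) (hg : ContinuousOn g Ω)
    (h : ofFun Ω f = ofFun Ω g) : EqOn f g Ω := by
  have hf' := hf.locallyIntegrableOn (μ := volume) Ω.isOpen.measurableSet
  have hg' := hg.locallyIntegrableOn (μ := volume) Ω.isOpen.measurableSet
  have h0 := Ω.isOpen.ae_eq_zero_of_integral_contDiff_smul_eq_zero (hf'.sub hg')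
    fun ψ h1 h2 h3 => by
      let θ : 𝓓(Ω, ℝ) := ⟨ψ, h1, h2, h3⟩
      have h4 := TestFunction.integralAgainstBilinCLM_eq_integral
        (B := ContinuousLinearMap.lsmul ℝ ℝ) (hf'.sub hg') (f := θ)
      have h5 := congrArg (fun T => T θ) h
      simp only [ofFun_apply hf', ofFun_apply hg'] at h5
      have hi : ∀ {f : Eucl n → ℂ}, LocallyIntegrableOn f (Ω : Set (Eucl n)) volume →
          IntegrableOn (fun x => θ x • f x) Ω := fun hf =>
        (TestFunction.integrable_bilin (ContinuousLinearMap.lsmul ℝ ℝ) hf θ).integrableOn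
      rw [← sub_eq_zero, ← integral_sub (hi hf') (hi hg')] at h5
      rw [← h5, setIntegral_eq_integral_of_forall_compl_eq_zero fun x hx => by
        rw [image_eq_zero_of_notMem_tsupport fun hx' => hx (θ.tsupport_subset hx')]; simp]
      simp only [Pi.sub_apply, smul_sub]
      rfl
  have h1 : f =ᵐ[volume.restrict (Ω : Set (Eucl n))] g := by
    refine (ae_restrict_iff' Ω.isOpen.measurableSet).2 ?_
    filter_upwards [h0] with x hx hxΩ using sub_eq_zero.1 (hx hxΩ)
  exact Measure.eqOn_open_of_ae_eq h1 Ω.isOpen hf hg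

/-- `ψ'` comes from the transpose of `∂^α` and does not depend on `T`; equations involving
derivatives thereby become closed conditions on `L²` functions. -/
theorem exists_multiDeriv_apply_eq (α : Fin n → ℕ) (ψ : 𝓓(Ω, ℝ)) :
    ∃ ψ' : 𝓓(Ω, ℝ), ∀ T : 𝓓'(Ω, ℂ), multiDeriv α T ψ = T ψ' := by
  have hpow : ∀ (i : Fin n) (m : ℕ) (ψ : 𝓓(Ω, ℝ)), ∃ ψ' : 𝓓(Ω, ℝ), ∀ T : 𝓓'(Ω, ℂ),
      ((partialDeriv i : Module.End ℂ 𝓓'(Ω, ℂ)) ^ m) T ψ = T ψ' := by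
    intro i m
    induction m with
    | zero => exact fun ψ => ⟨ψ, fun T => rfl⟩
    | succ m ih =>
      intro ψ
      obtain ⟨ψ', h⟩ := ih (-∂_{EuclideanSpace.single i (1 : ℝ)} ψ)
      refine ⟨ψ', fun T => ?_⟩
      rw [pow_succ', Module.End.mul_apply, partialDeriv_apply, ← h, map_neg]
  rw [multiDeriv]
  induction List.finRange n generalizing ψ with
  | nil => exact ⟨ψ, fun T => rfl⟩
  | cons i l ih =>
    obtain ⟨ψ', h⟩ := hpow i (α i) ψ
    obtain ⟨ψ'', h'⟩ := ih ψ'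
    refine ⟨ψ'', fun T => ?_⟩
    rw [List.map_cons, List.prod_cons, Module.End.mul_apply, h, h']

theorem partialDeriv_ofFun {h : Eucl n → ℂ} (hh : ContDiff ℝ ∞ h) (i : Fin n) :
    partialDeriv i (ofFun Ω h) =
      ofFun Ω fun x => fderiv ℝ h x (EuclideanSpace.single i (1 : ℝ)) := by
  have hh' : Continuous fun x => fderiv ℝ h x (EuclideanSpace.single i (1 : ℝ)) :=
    (hh.continuous_fderiv (by simp)).clm_apply continuous_const
  ext ψ
  have hzero : ∀ (θ : 𝓓(Ω, ℝ)) (f : Eucl n → ℂ), ∫ x in (Ω : Set (Eucl n)), θ x • f x =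
      ∫ x, θ x • f x := fun θ f => setIntegral_eq_integral_of_forall_compl_eq_zero fun x hx => by
    rw [image_eq_zero_of_notMem_tsupport fun hx' => hx (θ.tsupport_subset hx'), zero_smul]
  rw [partialDeriv_apply, ofFun_apply (hh.continuous.locallyIntegrable.locallyIntegrableOn _),
    ofFun_apply (hh'.locallyIntegrable.locallyIntegrableOn _), hzero, hzero]
  have hint : ∀ (θ : 𝓓(Ω, ℝ)) {f : Eucl n → ℂ}, Continuous f → Integrable fun x => θ x • f x :=
    fun θ f hf => (θ.continuous.smul hf).integrable_of_hasCompactSupport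
      θ.hasCompactSupport.smul_right
  simp only [lineDerivOp_testFunction_apply]
  have hi1 := hint (∂_{EuclideanSpace.single i (1 : ℝ)} ψ) hh.continuous
  simp only [lineDerivOp_testFunction_apply] at hi1
  have h1 := integral_bilinear_hasFDerivAt_right_eq_neg_left_of_integrable
    (B := (ContinuousLinearMap.lsmul ℝ ℝ : ℝ →L[ℝ] ℂ →L[ℝ] ℂ)) (f := ψ) (g := h)
    (v := EuclideanSpace.single i (1 : ℝ)) hi1 (hint ψ hh') (hint ψ hh.continuous)
    (fun x _ => (ψ.contDiff.differentiable (by simp)).differentiableAt.hasFDerivAt)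
    (fun x _ => (hh.differentiable (by simp)).differentiableAt.hasFDerivAt)
  exact h1.symm

theorem norm_iteratedFDeriv_fderiv_apply_le {h : Eucl n → ℂ} (hh : ContDiff ℝ ∞ h) (i : Fin n)
    (m : ℕ) (x : Eucl n) :
    ‖iteratedFDeriv ℝ m (fun x => fderiv ℝ h x (EuclideanSpace.single i (1 : ℝ))) x‖ ≤
      ‖iteratedFDeriv ℝ (m + 1) h x‖ := by
  let L : (Eucl n →L[ℝ] ℂ) →L[ℝ] ℂ :=
    ContinuousLinearMap.apply ℝ ℂ (EuclideanSpace.single i (1 : ℝ))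
  have hf : ContDiff ℝ ∞ (fderiv ℝ h) := hh.fderiv_right (by simp)
  have h1 := L.norm_iteratedFDeriv_comp_left (hf.contDiffAt (x := x)) (n := m)
    (by exact_mod_cast le_top)
  have h2 : ‖L‖ ≤ 1 := ContinuousLinearMap.opNorm_le_bound _ zero_le_one fun A => by
    rw [one_mul]
    refine (A.le_opNorm _).trans_eq ?_
    simp
  rw [← norm_iteratedFDeriv_fderiv]
  exact h1.trans (mul_le_of_le_one_left (norm_nonneg _) h2)

theorem tsupport_fderiv_apply_subset (h : Eucl n → ℂ) (v : Eucl n) :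
    tsupport (fun x => fderiv ℝ h x v) ⊆ tsupport h := by
  refine closure_minimal (fun x hx => ?_) (isClosed_tsupport h)
  by_contra hx'
  rw [notMem_tsupport_iff_eventuallyEq] at hx'
  refine hx ?_
  simp only [hx'.fderiv_eq]
  simp

theorem exists_multiDeriv_ofFun {h : Eucl n → ℂ} (hh : ContDiff ℝ ∞ h) (α : Fin n → ℕ) :
    ∃ h' : Eucl n → ℂ, ContDiff ℝ ∞ h' ∧ tsupport h' ⊆ tsupport h ∧
      multiDeriv α (ofFun Ω h) = ofFun Ω h' ∧
        ∀ x, ‖h' x‖ ≤ ‖iteratedFDeriv ℝ (∑ i, α i) h x‖ := by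
  -- The bound is strengthened to derivatives of every order so that it passes through the
  -- induction.
  let P : 𝓓'(Ω, ℂ) → ℕ → Prop := fun T N => ∃ h' : Eucl n → ℂ, ContDiff ℝ ∞ h' ∧
    tsupport h' ⊆ tsupport h ∧ T = ofFun Ω h' ∧
      ∀ m x, ‖iteratedFDeriv ℝ m h' x‖ ≤ ‖iteratedFDeriv ℝ (m + N) h x‖
  have hpow : ∀ T N, P T N → ∀ (i : Fin n) (m : ℕ),
      P (((partialDeriv i : Module.End ℂ 𝓓'(Ω, ℂ)) ^ m) T) (m + N) := by
    intro T N hT i m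
    induction m with
    | zero => simpa using hT
    | succ m ih =>
      obtain ⟨h', h1, h2, h3, h4⟩ := ih
      refine ⟨_, (h1.fderiv_right (by simp)).clm_apply contDiff_const,
        (tsupport_fderiv_apply_subset h' _).trans h2, ?_, fun l x =>
          (norm_iteratedFDeriv_fderiv_apply_le h1 i l x).trans ((h4 _ x).trans_eq ?_)⟩
      · rw [pow_succ', Module.End.mul_apply, h3, partialDeriv_ofFun h1]
      · rw [show l + 1 + (m + N) = l + (m + 1 + N) by omega]
  have key : P (multiDeriv α (ofFun Ω h)) (∑ i, α i) := by
    simp only [Fin.sum_univ_def, multiDeriv]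
    induction List.finRange n with
    | nil => exact ⟨h, hh, Subset.rfl, rfl, fun m x => le_rfl⟩
    | cons i l ih =>
      simp only [List.map_cons, List.prod_cons, List.sum_cons, Module.End.mul_apply]
      exact hpow _ _ ih i _
  obtain ⟨h', h1, h2, h3, h4⟩ := key
  exact ⟨h', h1, h2, h3, fun x => by
    have h5 := h4 0 x
    rwa [norm_iteratedFDeriv_zero, zero_add] at h5⟩

theorem exists_ofL2_eq_ofFun (hK : IsCompact K) {h : Eucl n → ℂ} (hh : Continuous h)
    (hhK : tsupport h ⊆ K) {B : ℝ} (hB : ∀ x, ‖h x‖ ≤ B) :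
    ∃ g : L2 Ω, ofL2 Ω g = ofFun Ω h ∧ ‖g‖ ^ 2 ≤ volume.real K * B ^ 2 := by
  have hc : HasCompactSupport h := hK.of_isClosed_subset (isClosed_tsupport h) hhK
  have hm : MemLp h 2 := hh.memLp_of_hasCompactSupport hc
  refine ⟨(hm.restrict Ω).toLp h, ?_, ?_⟩
  · ext ψ
    change ofFun Ω _ ψ = _
    rw [ofFun_apply (locallyIntegrableOn_L2 _),
      ofFun_apply (hh.locallyIntegrable.locallyIntegrableOn _)]
    refine integral_congr_ae ?_
    filter_upwards [(hm.restrict (Ω : Set (Eucl n))).coeFn_toLp] with x hx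
    rw [hx]
  · rw [L2_norm_sq]
    calc _ = ∫ x in (Ω : Set (Eucl n)), ‖h x‖ ^ 2 := integral_congr_ae (by
          filter_upwards [(hm.restrict (Ω : Set (Eucl n))).coeFn_toLp] with x hx
          rw [hx])
      _ ≤ ∫ x, ‖h x‖ ^ 2 := setIntegral_le_integral (hm.integrable_norm_pow (by norm_num))
          (ae_of_all _ fun _ => by positivity)
      _ ≤ ∫ x, K.indicator (fun _ => B ^ 2) x := by
          refine integral_mono (hm.integrable_norm_pow (by norm_num))
            ((integrable_indicator_iff hK.measurableSet).2
              (integrableOn_const hK.measure_lt_top.ne)) fun x => ?_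
          by_cases hx : x ∈ K
          · simp only [indicator_of_mem hx]
            exact pow_le_pow_left₀ (norm_nonneg _) (hB x) 2
          · simp [indicator_of_notMem hx,
              image_eq_zero_of_notMem_tsupport fun hx' => hx (hhK hx')]
      _ = _ := by rw [integral_indicator_const _ hK.measurableSet, smul_eq_mul]

/-- Smooth compactly supported functions belong to all Sobolev spaces. -/
theorem ofFun_mem_sobolev {h : Eucl n → ℂ} (hh : ContDiff ℝ ∞ h) (hc : HasCompactSupport h)
    (k : ℕ) : ofFun Ω h ∈ sobolev k Ω := by
  refine mem_sobolev.2 fun α _ => ?_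
  obtain ⟨h', h1, h2, h3, -⟩ := exists_multiDeriv_ofFun (Ω := Ω) hh α
  have hc' : HasCompactSupport h' := hc.of_isClosed_subset (isClosed_tsupport _) h2
  obtain ⟨B, hB⟩ := h1.continuous.bounded_above_of_compact_support hc'
  obtain ⟨g, hg, -⟩ := exists_ofL2_eq_ofFun (Ω := Ω) hc h1.continuous h2 hB
  exact ⟨g, hg.trans h3.symm⟩

theorem sobolevNorm_ofFun_le (hK : IsCompact K) {h : Eucl n → ℂ} (hh : ContDiff ℝ ∞ h)
    (hhK : tsupport h ⊆ K) {k : ℕ} {B : ℝ} (hB : ∀ m ≤ k, ∀ x, ‖iteratedFDeriv ℝ m h x‖ ≤ B)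
    (hmem : ofFun Ω h ∈ sobolev k Ω) :
    sobolevNorm k Ω ⟨ofFun Ω h, hmem⟩ ≤
      Real.sqrt ((multiIndices n k).card * volume.real K) * B := by
  have hB0 : 0 ≤ B := (norm_nonneg _).trans (hB 0 (Nat.zero_le k) 0)
  rw [sobolevNorm_apply, Real.sqrt_le_left (by positivity), mul_pow,
    Real.sq_sqrt (by positivity)]
  refine (Finset.sum_le_card_nsmul _ _ (volume.real K * B ^ 2) fun α _ => ?_).trans_eq
    (by rw [Finset.card_univ, Fintype.card_coe, nsmul_eq_mul, mul_assoc])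
  obtain ⟨h', h1, h2, h3, h4⟩ := exists_multiDeriv_ofFun (Ω := Ω) hh (α : Fin n → ℕ)
  obtain ⟨g, hg, hg'⟩ := exists_ofL2_eq_ofFun (Ω := Ω) hK h1.continuous (h2.trans hhK)
    fun x => (h4 x).trans (hB _ (mem_multiIndices.1 α.2) x)
  rwa [show derivL2 α ⟨ofFun Ω h, hmem⟩ = g from
    ofL2_injective Ω ((ofL2_derivL2 α _).trans (h3.trans hg.symm))]

theorem continuous_ofL2_apply (ψ : 𝓓(Ω, ℝ)) : Continuous fun g : L2 Ω => ofL2 Ω g ψ := by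
  have hψ : MemLp (fun x => (ψ x : ℂ)) 2 (volume.restrict (Ω : Set (Eucl n))) :=
    ((Complex.continuous_ofReal.comp ψ.continuous).memLp_of_hasCompactSupport
      (ψ.hasCompactSupport.comp_left Complex.ofReal_zero)).restrict _
  have h : ∀ g : L2 Ω, ofL2 Ω g ψ = inner ℂ (hψ.toLp _) g := fun g => by
    rw [L2.inner_def]
    change ofFun Ω g ψ = _
    rw [ofFun_apply (locallyIntegrableOn_L2 g)]
    refine integral_congr_ae ?_
    filter_upwards [hψ.coeFn_toLp] with x hx
    rw [hx, RCLike.inner_apply, Complex.conj_ofReal, Complex.real_smul, mul_comm]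
  simp_rw [h]
  fun_prop

end OfFun

/-! ### Changes of charts -/

section Transition

open Filter

variable {n : ℕ} {M : Type*} [TopologicalSpace M] [ChartedSpace (Eucl n) M]

theorem contDiff_continuousLinearMap_det : ContDiff ℝ ∞ fun A : Eucl n →L[ℝ] Eucl n => A.det := by
  let b := (EuclideanSpace.basisFun (Fin n) ℝ).toBasis
  have h : (fun A : Eucl n →L[ℝ] Eucl n => A.det) = fun A : Eucl n →L[ℝ] Eucl n =>
      ∑ σ : Equiv.Perm (Fin n), Equiv.Perm.sign σ • ∏ i, A (b i) (σ i) := by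
    funext A
    rw [ContinuousLinearMap.det, ← LinearMap.det_toMatrix b, Matrix.det_apply]
    refine Finset.sum_congr rfl fun σ _ => ?_
    congr 1
    refine Finset.prod_congr rfl fun i _ => ?_
    rw [LinearMap.toMatrix_apply]
    simp [b]
  rw [h]
  refine ContDiff.sum fun σ _ => ?_
  have h1 : ContDiff ℝ ∞ fun A : Eucl n →L[ℝ] Eucl n => ∏ i, A (b i) (σ i) := by
    refine contDiff_prod fun i _ => ?_
    have h2 : ContDiff ℝ ∞ fun A : Eucl n →L[ℝ] Eucl n => A (b i) :=
      contDiff_id.clm_apply contDiff_const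
    exact (EuclideanSpace.proj (σ i) : Eucl n →L[ℝ] ℝ).contDiff.comp h2
  exact h1.const_smul ((Equiv.Perm.sign σ : ℤˣ) : ℤ)

theorem mem_transition_source {e e' : Chart (𝓡 n) M} {x : Eucl n} :
    x ∈ (e.1.symm ≫ₕ e'.1).source ↔ x ∈ e.1.target ∧ e.1.symm x ∈ e'.1.source := by
  rw [OpenPartialHomeomorph.trans_source]; rfl

theorem contDiffOn_transition [IsManifold (𝓡 n) ∞ M] (e e' : Chart (𝓡 n) M) :
    ContDiffOn ℝ ∞ (e.1.symm ≫ₕ e'.1) (e.1.symm ≫ₕ e'.1).source := by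
  have h1 := contMDiffOn_symm_of_mem_maximalAtlas e.2
  have h2 := contMDiffOn_of_mem_maximalAtlas e'.2
  rw [← contMDiffOn_iff_contDiffOn]
  refine h2.comp (h1.mono fun x hx => ?_) fun x hx => ?_
  · exact (mem_transition_source.1 hx).1
  · exact (mem_transition_source.1 hx).2

theorem mem_transition_target {e e' : Chart (𝓡 n) M} {y : Eucl n} :
    y ∈ (e.1.symm ≫ₕ e'.1).target ↔ y ∈ e'.1.target ∧ e'.1.symm y ∈ e.1.source := by
  rw [OpenPartialHomeomorph.trans_target]; rfl

theorem transition_apply (e e' : Chart (𝓡 n) M) (x : Eucl n) :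
    (e.1.symm ≫ₕ e'.1) x = e'.1 (e.1.symm x) := rfl

theorem symm_transition {e e' : Chart (𝓡 n) M} {x : Eucl n}
    (hx : x ∈ (e.1.symm ≫ₕ e'.1).source) : e'.1.symm ((e.1.symm ≫ₕ e'.1) x) = e.1.symm x :=
  e'.1.left_inv (mem_transition_source.1 hx).2

/-- Chain rule with the inverse transition. It makes the absolute value of the Jacobian smooth and
allows division by it. -/
theorem det_fderiv_transition_ne_zero [IsManifold (𝓡 n) ∞ M] (e e' : Chart (𝓡 n) M) {x : Eucl n}
    (hx : x ∈ (e.1.symm ≫ₕ e'.1).source) : (fderiv ℝ (e.1.symm ≫ₕ e'.1) x).det ≠ 0 := by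
  have hx' : (e.1.symm ≫ₕ e'.1) x ∈ (e'.1.symm ≫ₕ e.1).source :=
    mem_transition_source.2 (mem_transition_target.1 ((e.1.symm ≫ₕ e'.1).map_source hx))
  have h1 := ((contDiffOn_transition e e').differentiableOn (by simp)).differentiableAt
    ((e.1.symm ≫ₕ e'.1).open_source.mem_nhds hx)
  have h2 := ((contDiffOn_transition e' e).differentiableOn (by simp)).differentiableAt
    ((e'.1.symm ≫ₕ e.1).open_source.mem_nhds hx')
  have h3 : (e'.1.symm ≫ₕ e.1) ∘ (e.1.symm ≫ₕ e'.1) =ᶠ[𝓝 x] id := by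
    filter_upwards [(e.1.symm ≫ₕ e'.1).open_source.mem_nhds hx] with y hy
    rw [Function.comp_apply, transition_apply e' e, symm_transition hy]
    exact e.1.right_inv (mem_transition_source.1 hy).1
  have h4 := h3.fderiv_eq (𝕜 := ℝ)
  rw [fderiv_comp x h2 h1, fderiv_id] at h4
  intro h0
  have h5 := congrArg (fun A : Eucl n →L[ℝ] Eucl n => LinearMap.det A.toLinearMap) h4
  simp only [ContinuousLinearMap.toLinearMap_comp, LinearMap.det_comp] at h5
  rw [ContinuousLinearMap.det] at h0
  rw [h0, mul_zero] at h5
  exact zero_ne_one (h5.trans LinearMap.det_id)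

theorem contDiffOn_abs_det [IsManifold (𝓡 n) ∞ M] (e e' : Chart (𝓡 n) M) :
    ContDiffOn ℝ ∞ (fun x => |(fderiv ℝ (e.1.symm ≫ₕ e'.1) x).det|)
      (e.1.symm ≫ₕ e'.1).source := fun x hx => by
  have hd : ContDiffAt ℝ ∞ (fderiv ℝ (e.1.symm ≫ₕ e'.1)) x :=
    ((contDiffOn_transition e e').contDiffAt
      ((e.1.symm ≫ₕ e'.1).open_source.mem_nhds hx)).fderiv_right (by simp)
  have h : ContDiffAt ℝ ∞ (fun x => (fderiv ℝ (e.1.symm ≫ₕ e'.1) x).det) x :=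
    contDiff_continuousLinearMap_det.contDiffAt.comp x hd
  exact (h.abs (det_fderiv_transition_ne_zero e e' hx)).contDiffWithinAt

open Classical in
/-- The test function `|det Dτ| (ψ ∘ τ)`, where `τ = e' ∘ e⁻¹`, extended by zero. -/
def transferTest [T2Space M] [IsManifold (𝓡 n) ∞ M] (e e' : Chart (𝓡 n) M)
    (ψ : 𝓓(Chart.image e', ℝ)) (hψ : tsupport ψ ⊆ (e.1.symm ≫ₕ e'.1).target) :
    𝓓(Chart.image e, ℝ) :=
  have hK : IsCompact ((e.1.symm ≫ₕ e'.1).symm '' tsupport ψ) :=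
    ψ.hasCompactSupport.image_of_continuousOn ((e.1.symm ≫ₕ e'.1).continuousOn_symm.mono hψ)
  have hKs : (e.1.symm ≫ₕ e'.1).symm '' tsupport ψ ⊆ (e.1.symm ≫ₕ e'.1).source := by
    rintro _ ⟨y, hy, rfl⟩
    exact (e.1.symm ≫ₕ e'.1).map_target (hψ hy)
  have hzero : ∀ x ∉ (e.1.symm ≫ₕ e'.1).symm '' tsupport ψ,
      (if x ∈ (e.1.symm ≫ₕ e'.1).source then
        |(fderiv ℝ (e.1.symm ≫ₕ e'.1) x).det| * ψ ((e.1.symm ≫ₕ e'.1) x) else 0) = 0 :=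
    fun x hx => by
      split_ifs with h
      · have h0 : ψ ((e.1.symm ≫ₕ e'.1) x) = 0 := image_eq_zero_of_notMem_tsupport
          fun h' => hx ⟨_, h', (e.1.symm ≫ₕ e'.1).left_inv h⟩
        rw [h0, mul_zero]
      · rfl
  have hts : tsupport (fun x => if x ∈ (e.1.symm ≫ₕ e'.1).source then
        |(fderiv ℝ (e.1.symm ≫ₕ e'.1) x).det| * ψ ((e.1.symm ≫ₕ e'.1) x) else 0) ⊆
      (e.1.symm ≫ₕ e'.1).symm '' tsupport ψ :=
    closure_minimal (fun x hx => by_contra fun h => hx (hzero x h)) hK.isClosed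
  { toFun := fun x => if x ∈ (e.1.symm ≫ₕ e'.1).source then
        |(fderiv ℝ (e.1.symm ≫ₕ e'.1) x).det| * ψ ((e.1.symm ≫ₕ e'.1) x) else 0
    contDiff' := by
      rw [contDiff_iff_contDiffAt]
      intro x
      by_cases hx : x ∈ (e.1.symm ≫ₕ e'.1).source
      · have hn := (e.1.symm ≫ₕ e'.1).open_source.mem_nhds hx
        refine (((contDiffOn_abs_det e e').contDiffAt hn).mul
          (ψ.contDiff.contDiffAt.comp x ((contDiffOn_transition e e').contDiffAt hn)))
            |>.congr_of_eventuallyEq ?_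
        filter_upwards [hn] with y hy
        rw [if_pos hy]; rfl
      -- The transported support of `ψ` is compact, hence closed, and lies in the overlap; so the
      -- extension by zero vanishes near any point outside the overlap.
      · refine (contDiffAt_const (c := (0 : ℝ))).congr_of_eventuallyEq ?_
        filter_upwards [hK.isClosed.isOpen_compl.mem_nhds fun h => hx (hKs h)] with y hy
        exact hzero y hy
    hasCompactSupport' := hK.of_isClosed_subset (isClosed_tsupport _) hts
    tsupport_subset' := (hts.trans hKs).trans fun _ hx => (mem_transition_source.1 hx).1 }

section

variable [T2Space M] [IsManifold (𝓡 n) ∞ M] {e e' : Chart (𝓡 n) M} {ψ : 𝓓(Chart.image e', ℝ)}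
  (hψ : tsupport ψ ⊆ (e.1.symm ≫ₕ e'.1).target)

theorem transferTest_apply {x : Eucl n} (hx : x ∈ (e.1.symm ≫ₕ e'.1).source) :
    transferTest e e' ψ hψ x =
      |(fderiv ℝ (e.1.symm ≫ₕ e'.1) x).det| * ψ ((e.1.symm ≫ₕ e'.1) x) := if_pos hx

theorem transferTest_of_notMem {x : Eucl n} (hx : x ∉ (e.1.symm ≫ₕ e'.1).source) :
    transferTest e e' ψ hψ x = 0 := if_neg hx

theorem ManifoldDistribution.rep_transferTest (u : ManifoldDistribution n M) :
    ManifoldDistribution.rep e' u ψ = ManifoldDistribution.rep e u (transferTest e e' ψ hψ) :=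
  u.2 e e' ψ _ hψ (fun _ hx => transferTest_apply hψ hx) fun _ hx => transferTest_of_notMem hψ hx

end

/-- Both integrals live on the overlap, where this is the change of variables formula. It gives
functions on `M` the transformation law of distributions. -/
theorem integral_transition [IsManifold (𝓡 n) ∞ M] (e e' : Chart (𝓡 n) M)
    {ψ : Eucl n → ℝ} {θ : Eucl n → ℝ} (w : Eucl n → ℂ)
    (h1 : tsupport ψ ⊆ (e.1.symm ≫ₕ e'.1).target)
    (h2 : ∀ x ∈ (e.1.symm ≫ₕ e'.1).source,
      θ x = |(fderiv ℝ (e.1.symm ≫ₕ e'.1) x).det| * ψ ((e.1.symm ≫ₕ e'.1) x))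
    (h3 : ∀ x ∉ (e.1.symm ≫ₕ e'.1).source, θ x = 0) :
    ∫ y in e'.1.target, ψ y • w y = ∫ x in e.1.target, θ x • w ((e.1.symm ≫ₕ e'.1) x) := by
  have ha : ∫ y in e'.1.target, ψ y • w y =
      ∫ y in (e.1.symm ≫ₕ e'.1).target, ψ y • w y := by
    refine setIntegral_eq_of_subset_of_forall_sdiff_eq_zero e'.1.open_target.measurableSet
      (fun y hy => (mem_transition_target.1 hy).1) fun y hy => ?_
    rw [image_eq_zero_of_notMem_tsupport fun h => hy.2 (h1 h), zero_smul]
  have hb : ∫ x in e.1.target, θ x • w ((e.1.symm ≫ₕ e'.1) x) =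
      ∫ x in (e.1.symm ≫ₕ e'.1).source, θ x • w ((e.1.symm ≫ₕ e'.1) x) :=
    setIntegral_eq_of_subset_of_forall_sdiff_eq_zero e.1.open_target.measurableSet
      (fun y hy => (mem_transition_source.1 hy).1) fun y hy => by rw [h3 y hy.2, zero_smul]
  rw [ha, hb, ← (e.1.symm ≫ₕ e'.1).image_source_eq_target,
    integral_image_eq_integral_abs_det_fderiv_smul volume
      (e.1.symm ≫ₕ e'.1).open_source.measurableSet
      (fun x hx => (((contDiffOn_transition e e').differentiableOn (by simp)).differentiableAt
        ((e.1.symm ≫ₕ e'.1).open_source.mem_nhds hx)).hasFDerivAt.hasFDerivWithinAt)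
      (e.1.symm ≫ₕ e'.1).injOn]
  refine setIntegral_congr_fun (e.1.symm ≫ₕ e'.1).open_source.measurableSet fun x hx => ?_
  simp only [h2 x hx, smul_smul]

theorem locallyIntegrableOn_comp_transition [IsManifold (𝓡 n) ∞ M] (e e' : Chart (𝓡 n) M)
    {w : Eucl n → ℂ} (hw : LocallyIntegrableOn w e'.1.target volume) :
    LocallyIntegrableOn (fun x => w ((e.1.symm ≫ₕ e'.1) x)) (e.1.symm ≫ₕ e'.1).source volume := by
  set τ := e.1.symm ≫ₕ e'.1
  rw [locallyIntegrableOn_iff τ.open_source.isLocallyClosed]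
  intro K hKs hK
  have hi : IntegrableOn w (τ '' K) :=
    hw.integrableOn_compact_subset (by
      rintro _ ⟨x, hx, rfl⟩
      exact (mem_transition_target.1 (τ.map_source (hKs hx))).1)
      (hK.image_of_continuousOn (τ.continuousOn.mono hKs))
  rw [integrableOn_image_iff_integrableOn_abs_det_fderiv_smul volume hK.measurableSet
    (fun x hx => (((contDiffOn_transition e e').differentiableOn (by simp)).differentiableAt
      (τ.open_source.mem_nhds (hKs hx))).hasFDerivAt.hasFDerivWithinAt)
    (τ.injOn.mono hKs)] at hi
  have hc : ContinuousOn (fun x => |(fderiv ℝ τ x).det|⁻¹) K :=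
    ((contDiffOn_abs_det e e').continuousOn.mono hKs).inv₀ fun x hx =>
      abs_ne_zero.2 (det_fderiv_transition_ne_zero e e' (hKs hx))
  refine (hi.continuousOn_smul hc hK).congr_fun (fun x hx => ?_) hK.measurableSet
  exact inv_smul_smul₀ (abs_ne_zero.2 (det_fderiv_transition_ne_zero e e' (hKs hx))) _

/-- The distribution defined by a function that is locally integrable in the charts. -/
def distOfFun [IsManifold (𝓡 n) ∞ M] (F : M → ℂ) (hF : ∀ e : Chart (𝓡 n) M,
    LocallyIntegrableOn (F ∘ e.1.symm) e.1.target volume) : ManifoldDistribution n M :=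
  ⟨fun e => ofFun (Chart.image e) (F ∘ e.1.symm), fun e e' ψ θ h1 h2 h3 => by
    rw [ofFun_apply (hF e'), ofFun_apply (hF e)]
    refine (integral_transition e e' (F ∘ e'.1.symm) h1 h2 h3).trans ?_
    refine setIntegral_congr_fun e.1.open_target.measurableSet fun x _ => ?_
    by_cases hx : x ∈ (e.1.symm ≫ₕ e'.1).source
    · simp only [Function.comp_apply, symm_transition hx]
    · simp only [h3 x hx, zero_smul]⟩

theorem rep_distOfFun [IsManifold (𝓡 n) ∞ M] {F : M → ℂ} (hF : ∀ e : Chart (𝓡 n) M,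
    LocallyIntegrableOn (F ∘ e.1.symm) e.1.target volume) (e : Chart (𝓡 n) M) :
    ManifoldDistribution.rep e (distOfFun F hF) = ofFun (Chart.image e) (F ∘ e.1.symm) := rfl

theorem ManifoldDistribution.ext {u v : ManifoldDistribution n M}
    (h : ∀ e, ManifoldDistribution.rep e u = ManifoldDistribution.rep e v) : u = v :=
  Subtype.ext (funext h)

end Transition

/-! ### Localization and synthesis of distributions on a manifold -/

section Synthesis

open Filter

theorem locallyIntegrableOn_of_eventuallyEq {n : ℕ} {U : Set (Eucl n)} {F : Eucl n → ℂ}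
    (h : ∀ x ∈ U, ∃ G, IntegrableAtFilter G (𝓝 x) ∧ F =ᶠ[𝓝 x] G) :
    LocallyIntegrableOn F U volume := fun x hx => by
  obtain ⟨G, ⟨s, hs, hG⟩, hFG⟩ := h x hx
  obtain ⟨t, ht, hto, hxt⟩ := mem_nhds_iff.1 (inter_mem hs hFG)
  exact ⟨t, mem_nhdsWithin_of_mem_nhds (hto.mem_nhds hxt),
    (hG.mono_set fun y hy => (ht hy).1).congr_fun (fun y hy => ((ht hy).2).symm)
      hto.measurableSet⟩

theorem testFunction_sum_apply {n : ℕ} {κ : Type*} {Ω : Opens (Eucl n)} (s : Finset κ) (f : κ → 𝓓(Ω, ℝ))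
    (x : Eucl n) : (∑ j ∈ s, f j) x = ∑ j ∈ s, f j x :=
  map_sum (⟨⟨fun θ => θ x, rfl⟩, fun _ _ => rfl⟩ : 𝓓(Ω, ℝ) →+ ℝ) f s

variable {n : ℕ} {M : Type*} [TopologicalSpace M] [ChartedSpace (Eucl n) M]

theorem contDiffOn_comp_chart_symm {V : Type*} [NormedAddCommGroup V] [NormedSpace ℝ V]
    {f : M → V} (hf : ContMDiff (𝓡 n) 𝓘(ℝ, V) ∞ f) (e : Chart (𝓡 n) M) :
    ContDiffOn ℝ ∞ (f ∘ e.1.symm) (Chart.image e : Set (Eucl n)) :=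
  (hf.comp_contMDiffOn (contMDiffOn_symm_of_mem_maximalAtlas e.2)).contDiffOn

/-- The product of a test function on the image of a chart with a smooth function on `M`. -/
def smoothMulTest {f : M → ℝ} (hf : ContMDiff (𝓡 n) 𝓘(ℝ, ℝ) ∞ f) (e : Chart (𝓡 n) M)
    (ψ : 𝓓(Chart.image e, ℝ)) : 𝓓(Chart.image e, ℝ) :=
  mulTest (contDiffOn_comp_chart_symm hf e) ψ

theorem smoothMulTest_apply {f : M → ℝ} (hf : ContMDiff (𝓡 n) 𝓘(ℝ, ℝ) ∞ f) (e : Chart (𝓡 n) M)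
    (ψ : 𝓓(Chart.image e, ℝ)) (x : Eucl n) :
    smoothMulTest hf e ψ x = ψ x * f (e.1.symm x) := rfl

theorem tsupport_smoothMulTest_subset {f : M → ℝ} (hf : ContMDiff (𝓡 n) 𝓘(ℝ, ℝ) ∞ f)
    {e e' : Chart (𝓡 n) M} (hfe : tsupport f ⊆ e'.1.source) (ψ : 𝓓(Chart.image e, ℝ)) :
    tsupport (smoothMulTest hf e ψ) ⊆ (e'.1.symm ≫ₕ e.1).target := by
  have hsub : tsupport ψ ⊆ e.1.target := ψ.tsupport_subset
  have hcl : IsClosed (tsupport ψ ∩ e.1.symm ⁻¹' tsupport f) :=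
    (e.1.continuousOn_symm.mono hsub).preimage_isClosed_of_isClosed (isClosed_tsupport ψ)
      (isClosed_tsupport f)
  have h : tsupport (smoothMulTest hf e ψ) ⊆ tsupport ψ ∩ e.1.symm ⁻¹' tsupport f := by
    refine closure_minimal (fun x hx => ?_) hcl
    rw [Function.mem_support, smoothMulTest_apply] at hx
    exact ⟨subset_tsupport _ (left_ne_zero_of_mul hx),
      subset_tsupport _ (right_ne_zero_of_mul hx)⟩
  exact fun x hx => mem_transition_target.2 ⟨hsub (h hx).1, hfe (h hx).2⟩

variable {ι : Type*} (A : LocalizingAtlas n M ι)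

/-- Cutoffs with `η_j φ_j = φ_j` allow `φ_j u`, known only in the `j`-th chart, to be tested in any
chart. -/
theorem LocalizingAtlas.exists_cutoff [IsManifold (𝓡 n) ∞ M] [T2Space M] [SigmaCompactSpace M]
    (j : ι) : ∃ η : M → ℝ, ContMDiff (𝓡 n) 𝓘(ℝ, ℝ) ∞ η ∧ (∀ x ∈ tsupport (A.φ j), η x = 1) ∧
      tsupport η ⊆ (A.chart j).1.source := by
  have := ChartedSpace.locallyCompactSpace (Eucl n) M
  obtain ⟨V, hV, hsV, hVU⟩ := normal_exists_closure_subset (isClosed_tsupport (A.φ j))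
    (A.chart j).1.open_source (A.subordinate j)
  obtain ⟨f, h1, h0, -⟩ := exists_contMDiffMap_one_nhds_of_subset_interior (𝓡 n) (n := ⊤)
    (isClosed_tsupport (A.φ j))
    (hsV.trans (interior_maximal subset_closure hV) : _ ⊆ interior (closure V))
  have hsub : tsupport f ⊆ closure V :=
    closure_minimal (fun x hx => by_contra fun h => hx (h0 x h)) isClosed_closure
  exact ⟨f, f.contMDiff, fun x hx => h1.self_of_nhdsSet x hx, hsub.trans hVU⟩

theorem LocalizingAtlas.finite_inter_tsupport (e : Chart (𝓡 n) M) (ψ : 𝓓(Chart.image e, ℝ)) :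
    {j | ((A.chart j).1.source ∩ e.1.symm '' tsupport ψ).Nonempty}.Finite :=
  A.locallyFinite.finite_nonempty_inter_compact
    (ψ.hasCompactSupport.image_of_continuousOn (e.1.continuousOn_symm.mono ψ.tsupport_subset))

/-- The charts whose domains meet the support of a test function. -/
def LocalizingAtlas.relevant (e : Chart (𝓡 n) M) (ψ : 𝓓(Chart.image e, ℝ)) : Finset ι :=
  (A.finite_inter_tsupport e ψ).toFinset

theorem LocalizingAtlas.mem_relevant {e : Chart (𝓡 n) M} {ψ : 𝓓(Chart.image e, ℝ)} {x : Eucl n}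
    (hx : x ∈ tsupport ψ) {j : ι} (hj : e.1.symm x ∈ (A.chart j).1.source) :
    j ∈ A.relevant e ψ :=
  (A.finite_inter_tsupport e ψ).mem_toFinset.2 ⟨_, hj, mem_image_of_mem _ hx⟩

/-! ### Decomposition into localizations, and patching -/

section

variable [IsManifold (𝓡 n) ∞ M] [T2Space M] [SigmaCompactSpace M]

/-- A smooth function supported in the domain of the `j`-th chart and equal to `1` on the support
of `φ_j`. -/
def LocalizingAtlas.cutoff (j : ι) : M → ℝ := (A.exists_cutoff j).choose

theorem LocalizingAtlas.contMDiff_cutoff (j : ι) : ContMDiff (𝓡 n) 𝓘(ℝ, ℝ) ∞ (A.cutoff j) :=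
  (A.exists_cutoff j).choose_spec.1

theorem LocalizingAtlas.cutoff_eq_one {j : ι} {x : M} (hx : x ∈ tsupport (A.φ j)) :
    A.cutoff j x = 1 := (A.exists_cutoff j).choose_spec.2.1 x hx

theorem LocalizingAtlas.tsupport_cutoff_subset (j : ι) :
    tsupport (A.cutoff j) ⊆ (A.chart j).1.source := (A.exists_cutoff j).choose_spec.2.2

theorem LocalizingAtlas.cutoff_eq_zero {j : ι} {x : M} (hx : x ∉ (A.chart j).1.source) :
    A.cutoff j x = 0 :=
  image_eq_zero_of_notMem_tsupport fun h => hx (A.tsupport_cutoff_subset j h)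

theorem LocalizingAtlas.cutoff_mul (j : ι) (x : M) : A.cutoff j x * A.φ j x = A.φ j x := by
  by_cases hx : x ∈ tsupport (A.φ j)
  · rw [A.cutoff_eq_one hx, one_mul]
  · rw [image_eq_zero_of_notMem_tsupport hx, mul_zero]

/-- The part of a test function near the support of `φ_j`, transferred to the `j`-th chart. -/
def localTest (j : ι) (e : Chart (𝓡 n) M) (ψ : 𝓓(Chart.image e, ℝ)) :
    𝓓(Chart.image (A.chart j), ℝ) :=
  transferTest (A.chart j) e (smoothMulTest (A.contMDiff_cutoff j) e ψ)
    (tsupport_smoothMulTest_subset _ (A.tsupport_cutoff_subset j) ψ)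

/-- This is `u = ∑ φ_j u`, a finite sum on the support of `ψ`. Since `η_j φ_j = φ_j`, the factor
`φ_j` can stay with `u` while `η_j ψ` is moved to the `j`-th chart; these test functions do not
depend on `u`. -/
theorem rep_eq_sum_localize (u : ManifoldDistribution n M) (e : Chart (𝓡 n) M)
    (ψ : 𝓓(Chart.image e, ℝ)) :
    ManifoldDistribution.rep e u ψ =
      ∑ j ∈ A.relevant e ψ, localize A j u (localTest A j e ψ) := by
  have hψ : ψ = ∑ j ∈ A.relevant e ψ, smoothMulTest (A.φ j).contMDiff e ψ := by
    ext x
    rw [testFunction_sum_apply]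
    simp only [smoothMulTest_apply]
    rw [← Finset.mul_sum]
    by_cases hx : x ∈ tsupport ψ
    · have h1 := A.φ.sum_eq_one (mem_univ (e.1.symm x))
      rw [finsum_eq_sum_of_support_subset _ (s := A.relevant e ψ) fun j hj =>
        A.mem_relevant hx (A.subordinate j (subset_tsupport _ hj))] at h1
      rw [h1, mul_one]
    · rw [image_eq_zero_of_notMem_tsupport hx, zero_mul]
  conv_lhs => rw [hψ, map_sum]
  refine Finset.sum_congr rfl fun j _ => ?_
  rw [ManifoldDistribution.rep_transferTest
    (tsupport_smoothMulTest_subset (A.φ j).contMDiff (A.subordinate j) ψ) u]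
  change _ = ManifoldDistribution.rep (A.chart j) u (mulTest (A.contDiffOn j) (localTest A j e ψ))
  congr 1
  ext x
  change _ = localTest A j e ψ x * A.φ j ((A.chart j).1.symm x)
  by_cases hx : x ∈ ((A.chart j).1.symm ≫ₕ e.1).source
  · rw [localTest, transferTest_apply _ hx, transferTest_apply _ hx, smoothMulTest_apply,
      smoothMulTest_apply, symm_transition hx]
    linear_combination -(|(fderiv ℝ ((A.chart j).1.symm ≫ₕ e.1) x).det| *
      ψ (((A.chart j).1.symm ≫ₕ e.1) x)) * A.cutoff_mul j ((A.chart j).1.symm x)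
  · rw [localTest, transferTest_of_notMem _ hx, transferTest_of_notMem _ hx, zero_mul]

theorem localize_injective {u v : ManifoldDistribution n M}
    (h : ∀ j, localize A j u = localize A j v) : u = v :=
  ManifoldDistribution.ext fun e => by
    ext ψ
    rw [rep_eq_sum_localize A, rep_eq_sum_localize A]
    simp only [h]

/-- The function on `M` obtained by patching together functions on the images of the charts. -/
def synth (w : ι → Eucl n → ℂ) (x : M) : ℂ := ∑ᶠ j, A.cutoff j x • w j ((A.chart j).1 x)

/-- On the support of the cutoff this is a coordinate change of `w` times a continuous function; off
it, the function is locally zero. -/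
theorem integrableAtFilter_cutoff_smul {w : Eucl n → ℂ} {j : ι}
    (hw : LocallyIntegrableOn w (A.chart j).1.target volume) (e : Chart (𝓡 n) M) {x : Eucl n}
    (hx : x ∈ e.1.target) :
    IntegrableAtFilter (fun x => A.cutoff j (e.1.symm x) • w ((A.chart j).1 (e.1.symm x)))
      (𝓝 x) := by
  by_cases hxj : e.1.symm x ∈ tsupport (A.cutoff j)
  · have hs : x ∈ (e.1.symm ≫ₕ (A.chart j).1).source :=
      mem_transition_source.2 ⟨hx, A.tsupport_cutoff_subset j hxj⟩
    have h1 := locallyIntegrableOn_comp_transition e (A.chart j) hw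
    have h2 : ContinuousOn (fun x => A.cutoff j (e.1.symm x))
        (e.1.symm ≫ₕ (A.chart j).1).source :=
      (contDiffOn_comp_chart_symm (A.contMDiff_cutoff j) e).continuousOn.mono
        fun y hy => (mem_transition_source.1 hy).1
    have h3 := h1.continuousOn_smul
      (e.1.symm ≫ₕ (A.chart j).1).open_source.isLocallyClosed h2
    have h4 := h3 x hs
    rwa [(e.1.symm ≫ₕ (A.chart j).1).open_source.nhdsWithin_eq hs] at h4
  · have h1 : ∀ᶠ y in 𝓝 x, e.1.symm y ∈ (tsupport (A.cutoff j))ᶜ :=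
      (e.1.continuousAt_symm hx).eventually_mem
        ((isClosed_tsupport _).isOpen_compl.mem_nhds hxj)
    obtain ⟨t, ht, hto, hxt⟩ := mem_nhds_iff.1 h1
    refine ⟨t, hto.mem_nhds hxt, integrableOn_zero.congr_fun (fun y hy => ?_) hto.measurableSet⟩
    simp only [image_eq_zero_of_notMem_tsupport (ht hy), zero_smul]

theorem locallyIntegrableOn_synth {w : ι → Eucl n → ℂ}
    (hw : ∀ j, LocallyIntegrableOn (w j) (A.chart j).1.target volume) (e : Chart (𝓡 n) M) :
    LocallyIntegrableOn (synth A w ∘ e.1.symm) e.1.target volume := by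
  refine locallyIntegrableOn_of_eventuallyEq fun x hx => ?_
  obtain ⟨V, hV, hfin⟩ := A.locallyFinite (e.1.symm x)
  refine ⟨fun x => ∑ j ∈ hfin.toFinset,
    A.cutoff j (e.1.symm x) • w j ((A.chart j).1 (e.1.symm x)), ?_, ?_⟩
  · have : ∀ s : Finset ι, IntegrableAtFilter (fun x => ∑ j ∈ s,
        A.cutoff j (e.1.symm x) • w j ((A.chart j).1 (e.1.symm x))) (𝓝 x) := by
      classical
      intro s
      induction s using Finset.induction_on with
      | empty => simpa using ⟨univ, univ_mem, integrableOn_zero⟩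
      | insert j s hj ih =>
        simp only [Finset.sum_insert hj]
        exact (integrableAtFilter_cutoff_smul A (hw j) e hx).add ih
    exact this _
  · filter_upwards [(e.1.continuousAt_symm hx).eventually_mem hV] with y hy
    refine finsum_eq_sum_of_support_subset _ fun j hj => ?_
    rw [Finite.coe_toFinset]
    refine ⟨_, by_contra fun h => hj ?_, hy⟩
    simp only
    rw [A.cutoff_eq_zero h, zero_smul]

/-- The formula of `rep_eq_sum_localize` with `w j` in place of the localizations. It holds even if
the `w j` are not the localizations of one distribution, which later allows compatibility to be
written as equations in `w`. -/
theorem rep_distOfFun_synth {w : ι → Eucl n → ℂ}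
    (hw : ∀ j, LocallyIntegrableOn (w j) (A.chart j).1.target volume) (e : Chart (𝓡 n) M)
    (ψ : 𝓓(Chart.image e, ℝ)) :
    ManifoldDistribution.rep e (distOfFun (synth A w) (locallyIntegrableOn_synth A hw)) ψ =
      ∑ j ∈ A.relevant e ψ, ofFun (Chart.image (A.chart j)) (w j) (localTest A j e ψ) := by
  rw [rep_distOfFun, ofFun_apply (locallyIntegrableOn_synth A hw e)]
  have h1 : ∀ x, ψ x • synth A w (e.1.symm x) = ∑ j ∈ A.relevant e ψ,
      ψ x • (A.cutoff j (e.1.symm x) • w j ((A.chart j).1 (e.1.symm x))) := fun x => by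
    by_cases hx : x ∈ tsupport ψ
    · rw [← Finset.smul_sum]
      congr 1
      refine finsum_eq_sum_of_support_subset _ fun j hj => ?_
      refine A.mem_relevant hx (by_contra fun h => hj ?_)
      simp only
      rw [A.cutoff_eq_zero h, zero_smul]
    · simp [image_eq_zero_of_notMem_tsupport hx]
  simp only [Function.comp_apply, h1]
  rw [integral_finsetSum]
  · refine Finset.sum_congr rfl fun j _ => ?_
    rw [ofFun_apply (hw j)]
    have h2 := integral_transition (A.chart j) e (ψ := smoothMulTest (A.contMDiff_cutoff j) e ψ)
      (θ := localTest A j e ψ) (fun y => w j ((A.chart j).1 (e.1.symm y)))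
      (tsupport_smoothMulTest_subset _ (A.tsupport_cutoff_subset j) ψ)
      (fun x hx => transferTest_apply _ hx) (fun x hx => transferTest_of_notMem _ hx)
    simp only [smoothMulTest_apply, mul_smul] at h2
    refine h2.trans (setIntegral_congr_fun (A.chart j).1.open_target.measurableSet fun x hx => ?_)
    by_cases hxs : x ∈ ((A.chart j).1.symm ≫ₕ e.1).source
    · simp only [symm_transition hxs, (A.chart j).1.right_inv hx]
    · simp only [localTest, transferTest_of_notMem _ hxs, zero_smul]
  · intro j _
    have h3 : LocallyIntegrableOn (fun x => A.cutoff j (e.1.symm x) •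
        w j ((A.chart j).1 (e.1.symm x))) (Chart.image e : Set (Eucl n)) volume := fun x hx =>
      (integrableAtFilter_cutoff_smul A (hw j) e hx).filter_mono nhdsWithin_le_nhds
    exact (TestFunction.integrable_bilin (ContinuousLinearMap.lsmul ℝ ℝ) h3 ψ).integrableOn

/-- A distribution whose localizations are functions is a function. -/
theorem eq_distOfFun_synth {w : ι → Eucl n → ℂ}
    (hw : ∀ j, LocallyIntegrableOn (w j) (A.chart j).1.target volume)
    {u : ManifoldDistribution n M}
    (hu : ∀ j, localize A j u = ofFun (Chart.image (A.chart j)) (w j)) :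
    u = distOfFun (synth A w) (locallyIntegrableOn_synth A hw) :=
  ManifoldDistribution.ext fun e => by
    ext ψ
    rw [rep_eq_sum_localize A, rep_distOfFun_synth A hw]
    simp only [hu]

end

end Synthesis

/-! ### The local Sobolev spaces of a manifold -/

section LocalSobolev

open Filter

variable {n : ℕ} {M : Type*} [TopologicalSpace M] [ChartedSpace (Eucl n) M]
  {ι : Type*} (A : LocalizingAtlas n M ι)

/-- The support of `φ_j`, in the `j`-th chart. -/
def LocalizingAtlas.suppImage (j : ι) : Set (Eucl n) := (A.chart j).1 '' tsupport (A.φ j)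

theorem LocalizingAtlas.isCompact_tsupport (j : ι) : IsCompact (tsupport (A.φ j)) :=
  (A.precompact j).of_isClosed_subset (isClosed_tsupport _)
    ((A.subordinate j).trans subset_closure)

theorem LocalizingAtlas.isCompact_suppImage (j : ι) : IsCompact (A.suppImage j) :=
  (A.isCompact_tsupport j).image_of_continuousOn
    ((A.chart j).1.continuousOn.mono (A.subordinate j))

theorem LocalizingAtlas.suppImage_subset (j : ι) :
    A.suppImage j ⊆ (Chart.image (A.chart j) : Set (Eucl n)) := by
  rintro _ ⟨x, hx, rfl⟩
  exact (A.chart j).1.map_source (A.subordinate j hx)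

theorem LocalizingAtlas.mem_suppImage {j : ι} {x : Eucl n} (hx : x ∈ (A.chart j).1.target)
    (h : (A.chart j).1.symm x ∈ tsupport (A.φ j)) : x ∈ A.suppImage j :=
  ⟨_, h, (A.chart j).1.right_inv hx⟩

theorem localize_apply (j : ι) (u : ManifoldDistribution n M) (ψ : 𝓓(Chart.image (A.chart j), ℝ)) :
    localize A j u ψ =
      ManifoldDistribution.rep (A.chart j) u (mulTest (A.contDiffOn j) ψ) := rfl

theorem suppIn_localize (j : ι) (u : ManifoldDistribution n M) :
    SuppIn (A.suppImage j) (localize A j u) := fun ψ hψ => by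
  rw [localize_apply]
  have h : mulTest (A.contDiffOn j) ψ = 0 := by
    ext x
    change ψ x * A.φ j ((A.chart j).1.symm x) = 0
    by_contra hx
    have h1 := subset_tsupport _ (left_ne_zero_of_mul hx)
    exact disjoint_left.1 hψ h1 (A.mem_suppImage (ψ.tsupport_subset h1)
      (subset_tsupport _ (right_ne_zero_of_mul hx)))
  rw [h, map_zero]

/-- The seminorms of `H^k_loc(M)`. -/
def hlocSeminorm (k : ℕ) (j : ι) : Seminorm ℂ (Hloc A k) :=
  (sobolevNorm k (Chart.image (A.chart j))).comp (localizeSobolev A k j)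

theorem hlocSeminorm_apply (k : ℕ) (j : ι) (u : Hloc A k) :
    hlocSeminorm A k j u = sobolevNorm k _ (localizeSobolev A k j u) := rfl

theorem withSeminorms_hloc (k : ℕ) : WithSeminorms (hlocSeminorm A k) :=
  withSeminorms_seminormTopology (hlocSeminorm A k)

/-- The derivatives of the localizations of an element of `H^k_loc(M)`. -/
def hlocCoord (k : ℕ) : Hloc A k →ₗ[ℂ]
    ∀ p : ι × multiIndices n k, L2 (Chart.image (A.chart p.1)) :=
  LinearMap.pi fun p => derivL2 p.2 ∘ₗ localizeSobolev A k p.1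

theorem ofL2_hlocCoord (k : ℕ) (u : Hloc A k) (p : ι × multiIndices n k) :
    ofL2 _ (hlocCoord A k u p) = multiDeriv (p.2 : Fin n → ℕ) (localize A p.1 (Subtype.val u)) :=
  ofL2_derivL2 p.2 (localizeSobolev A k p.1 u)

/-- The multi-index `0`. -/
def zeroIndex (n k : ℕ) : multiIndices n k := ⟨0, mem_multiIndices.2 (by simp)⟩

theorem ofL2_hlocCoord_zero (k : ℕ) (u : Hloc A k) (j : ι) :
    ofL2 _ (hlocCoord A k u (j, zeroIndex n k)) = localize A j (Subtype.val u) :=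
  (ofL2_hlocCoord A k u _).trans (multiDeriv_zero _)

/-- Each Sobolev seminorm is a finite Euclidean sum of norms of coordinates, and dominates each of
them. -/
theorem isInducing_hlocCoord (k : ℕ) : Topology.IsInducing (hlocCoord A k) := by
  have hp := withSeminorms_hloc A k
  have := hp.topologicalAddGroup
  rw [IsTopologicalAddGroup.isInducing_iff_nhds_zero]
  refine le_antisymm (tendsto_iff_comap.1 ?_) ?_
  · have hc : Continuous (hlocCoord A k) := continuous_pi fun p => by
      refine WithSeminorms.continuous_of_continuous_comp (norm_withSeminorms ℂ _)
        (derivL2 p.2 ∘ₗ localizeSobolev A k p.1) fun _ => ?_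
      refine Seminorm.continuous_of_le (hp.continuous_seminorm p.1) fun u => ?_
      exact norm_derivL2_le p.2 (localizeSobolev A k p.1 u)
    simpa using hc.tendsto 0
  · rw [(SeminormFamily.withSeminorms_iff_nhds_eq_iInf _).1 hp]
    refine le_iInf fun j => tendsto_iff_comap.1 ?_
    let g : (∀ p : ι × multiIndices n k, L2 (Chart.image (A.chart p.1))) → ℝ :=
      fun w => Real.sqrt (∑ α : multiIndices n k, ‖w (j, α)‖ ^ 2)
    have hg : Continuous g := by fun_prop
    have hgΘ : (hlocSeminorm A k j : Hloc A k → ℝ) = g ∘ hlocCoord A k := by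
      funext u
      rw [hlocSeminorm_apply, sobolevNorm_apply]
      rfl
    rw [hgΘ]
    have h0 : Tendsto g (𝓝 0) (𝓝 0) := hg.tendsto' 0 0 (by simp [g])
    exact h0.comp tendsto_comap

/-- A multi-index of length at most `k`, as one of length at most `k + 1`. -/
def succIndex {n k : ℕ} (α : multiIndices n k) : multiIndices n (k + 1) :=
  ⟨α, mem_multiIndices.2 ((mem_multiIndices.1 α.2).trans (Nat.le_succ k))⟩

theorem hlocCoord_hlocEmbedding (k : ℕ) (u : Hloc A (k + 1)) (p : ι × multiIndices n k) :
    hlocCoord A k (hlocEmbedding A k u) p = hlocCoord A (k + 1) u (p.1, succIndex p.2) :=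
  ofL2_injective _ ((ofL2_hlocCoord A k (hlocEmbedding A k u) p).trans
    (ofL2_hlocCoord A (k + 1) u (p.1, succIndex p.2)).symm)

/-! ### The closed embedding into a product of `L²` spaces, and compactness -/

section

variable [IsManifold (𝓡 n) ∞ M] [T2Space M] [SigmaCompactSpace M]

theorem hlocCoord_injective (k : ℕ) : Function.Injective (hlocCoord A k) := fun u v h =>
  Subtype.ext (localize_injective A fun j => by
    rw [← ofL2_hlocCoord_zero, ← ofL2_hlocCoord_zero, h])

/-- A family comes from a distribution exactly when its entries are the derivatives of those of
index zero and the distribution patched from the latter has them as its localizations. -/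
theorem range_hlocCoord (k : ℕ) : range (hlocCoord A k) =
    {w | (∀ p : ι × multiIndices n k, ofL2 _ (w p) =
        multiDeriv (p.2 : Fin n → ℕ) (ofL2 _ (w (p.1, zeroIndex n k)))) ∧
      ∀ i, localize A i (distOfFun (synth A fun j => w (j, zeroIndex n k))
        (locallyIntegrableOn_synth A fun j => locallyIntegrableOn_L2 (w (j, zeroIndex n k)))) =
          ofL2 _ (w (i, zeroIndex n k))} := by
  ext w
  constructor
  · rintro ⟨u, rfl⟩
    refine ⟨fun p => ?_, fun i => ?_⟩
    · rw [ofL2_hlocCoord, ofL2_hlocCoord_zero]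
    · rw [ofL2_hlocCoord_zero, ← eq_distOfFun_synth A
        (fun j => locallyIntegrableOn_L2 (hlocCoord A k u (j, zeroIndex n k)))
        fun j => (ofL2_hlocCoord_zero A k u j).symm]
  · rintro ⟨h1, h2⟩
    refine ⟨⟨distOfFun (synth A fun j => w (j, zeroIndex n k))
      (locallyIntegrableOn_synth A fun j => locallyIntegrableOn_L2 (w (j, zeroIndex n k))),
        (Submodule.mem_iInf _).2 fun i => mem_sobolev.2 fun α hα => ?_⟩, ?_⟩
    · rw [h2]
      exact ⟨w (i, ⟨α, mem_multiIndices.2 hα⟩), h1 (i, ⟨α, mem_multiIndices.2 hα⟩)⟩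
    · funext p
      exact ofL2_injective _ ((ofL2_hlocCoord A k _ p).trans
        ((congrArg (multiDeriv (p.2 : Fin n → ℕ)) (h2 p.1)).trans (h1 p).symm))

/-- After testing, both conditions equate finite sums of pairings of coordinates of `w` with fixed
test functions; such pairings are `L²`-continuous. -/
theorem isClosed_range_hlocCoord (k : ℕ) : IsClosed (range (hlocCoord A k)) := by
  rw [range_hlocCoord]
  have hc : ∀ (p : ι × multiIndices n k) (ψ : 𝓓(Chart.image (A.chart p.1), ℝ)),
      Continuous fun w : ∀ p : ι × multiIndices n k, L2 (Chart.image (A.chart p.1)) =>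
        ofL2 _ (w p) ψ := fun p ψ => (continuous_ofL2_apply ψ).comp (continuous_apply p)
  refine IsClosed.inter (s₁ := {w | ∀ _, _}) (s₂ := {w | ∀ _, _}) ?_ ?_
  · have h : {w : ∀ p : ι × multiIndices n k, L2 (Chart.image (A.chart p.1)) |
        ∀ p, ofL2 _ (w p) = multiDeriv (p.2 : Fin n → ℕ) (ofL2 _ (w (p.1, zeroIndex n k)))} =
        ⋂ (p : ι × multiIndices n k) (ψ : 𝓓(Chart.image (A.chart p.1), ℝ)), {w | ofL2 _ (w p) ψ =
          multiDeriv (p.2 : Fin n → ℕ) (ofL2 _ (w (p.1, zeroIndex n k))) ψ} := by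
      ext w
      simp only [mem_iInter]
      exact forall_congr' fun p => DFunLike.ext_iff
    rw [h]
    refine isClosed_iInter fun p => isClosed_iInter fun ψ => isClosed_eq (hc p ψ) ?_
    obtain ⟨ψ', hψ'⟩ := exists_multiDeriv_apply_eq (p.2 : Fin n → ℕ) ψ
    simp only [hψ']
    exact hc (p.1, zeroIndex n k) ψ'
  · have h : {w : ∀ p : ι × multiIndices n k, L2 (Chart.image (A.chart p.1)) |
        ∀ i, localize A i (distOfFun (synth A fun j => w (j, zeroIndex n k))
          (locallyIntegrableOn_synth A fun j => locallyIntegrableOn_L2 (w (j, zeroIndex n k)))) =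
            ofL2 _ (w (i, zeroIndex n k))} =
        ⋂ (i : ι) (ψ : 𝓓(Chart.image (A.chart i), ℝ)), {w |
          ∑ j ∈ A.relevant _ (mulTest (A.contDiffOn i) ψ), ofL2 _ (w (j, zeroIndex n k))
            (localTest A j _ (mulTest (A.contDiffOn i) ψ)) = ofL2 _ (w (i, zeroIndex n k)) ψ} := by
      ext w
      simp only [mem_iInter]
      refine forall_congr' fun i => DFunLike.ext_iff.trans (forall_congr' fun ψ => ?_)
      rw [localize_apply, rep_distOfFun_synth A fun j => locallyIntegrableOn_L2 (w (j, zeroIndex n k))]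
      rfl
    rw [h]
    exact isClosed_iInter fun i => isClosed_iInter fun ψ => isClosed_eq
      (continuous_finsetSum _ fun j _ => hc (j, zeroIndex n k) _) (hc (i, zeroIndex n k) ψ)

theorem isClosedEmbedding_hlocCoord (k : ℕ) : Topology.IsClosedEmbedding (hlocCoord A k) :=
  ⟨⟨isInducing_hlocCoord A k, hlocCoord_injective A k⟩, isClosed_range_hlocCoord A k⟩

theorem isCompactEmbedding_hlocEmbedding (k : ℕ) : IsCompactEmbedding (hlocEmbedding A k) where
  injective := Submodule.inclusion_injective _
  continuous := by
    rw [(isInducing_hlocCoord A k).continuous_iff]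
    refine continuous_pi fun p => ?_
    simp only [Function.comp_apply, hlocCoord_hlocEmbedding]
    exact (continuous_apply _).comp (isInducing_hlocCoord A (k + 1)).continuous
  isCompact_closure_image B hB := by
    rw [(withSeminorms_hloc A (k + 1)).isVonNBounded_iff_seminorm_bounded] at hB
    choose r _ hr using hB
    -- Rellich makes each `S p` compact, as `L²` is complete, and Tychonoff their product; its
    -- preimage under the closed embedding is compact and contains the image of `B`.
    let S : ∀ p : ι × multiIndices n k, Set (L2 (Chart.image (A.chart p.1))) := fun p =>
      closure {g | ∃ v : sobolev (k + 1) (Chart.image (A.chart p.1)),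
        SuppIn (A.suppImage p.1) (v : 𝓓'(Chart.image (A.chart p.1), ℂ)) ∧
          sobolevNorm (k + 1) _ v ≤ r p.1 ∧ ofL2 _ g = multiDeriv (p.2 : Fin n → ℕ)
            (v : 𝓓'(Chart.image (A.chart p.1), ℂ))}
    have hS : IsCompact (univ.pi S) := isCompact_univ_pi fun p =>
      (totallyBounded_derivL2 (A.isCompact_suppImage p.1) (A.suppImage_subset p.1) p.2
        (r p.1)).closure.isCompact_of_isClosed isClosed_closure
    have hcl : IsClosed (univ.pi S) := isClosed_set_pi fun p _ => isClosed_closure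
    refine ((isClosedEmbedding_hlocCoord A k).isCompact_preimage hS).of_isClosed_subset
      isClosed_closure (closure_minimal ?_ (hcl.preimage (isInducing_hlocCoord A k).continuous))
    rintro _ ⟨u, hu, rfl⟩ p -
    exact subset_closure ⟨localizeSobolev A (k + 1) p.1 u, suppIn_localize A p.1 _,
      (hr p.1 u hu).le, ofL2_hlocCoord A k _ p⟩

end

end LocalSobolev

/-! ### Smooth functions and local Sobolev spaces -/

section SmoothSobolev

open Filter

theorem continuous_of_le_mul_sum {S κ : Type*} [AddCommGroup S] [Module ℂ S] [TopologicalSpace S]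
    [IsTopologicalAddGroup S] {p : Seminorm ℂ S} {q : κ → Seminorm ℂ S} {F : Finset κ} {C : ℝ}
    (hq : ∀ l ∈ F, Continuous (q l)) (h : ∀ s, p s ≤ C * ∑ l ∈ F, q l s) : Continuous p := by
  refine Seminorm.continuous_of_continuousAt_zero ?_
  have hc : Continuous fun s => C * ∑ l ∈ F, q l s :=
    continuous_const.mul (continuous_finsetSum _ fun l hl => hq l hl)
  rw [ContinuousAt, map_zero]
  exact squeeze_zero (fun s => apply_nonneg p s) h (hc.tendsto' 0 0 (by simp))

variable {n : ℕ} {M : Type*} [TopologicalSpace M] [ChartedSpace (Eucl n) M]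
  {ι : Type*} (A : LocalizingAtlas n M ι)

/-- The function `(φ_j f) ∘ χ_j⁻¹`, extended by zero. -/
def LocalizingAtlas.localizeFun (j : ι) (f : M → ℂ) : Eucl n → ℂ :=
  (A.chart j).1.target.indicator fun y =>
    A.φ j ((A.chart j).1.symm y) • f ((A.chart j).1.symm y)

theorem LocalizingAtlas.localizeFun_apply {j : ι} (f : M → ℂ) {y : Eucl n}
    (hy : y ∈ (A.chart j).1.target) :
    A.localizeFun j f y = A.φ j ((A.chart j).1.symm y) • f ((A.chart j).1.symm y) :=
  indicator_of_mem hy _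

theorem LocalizingAtlas.localizeFun_eventuallyEq {j : ι} (f : M → ℂ) {y : Eucl n}
    (hy : y ∈ (A.chart j).1.target) : A.localizeFun j f =ᶠ[𝓝 y] fun y =>
      A.φ j ((A.chart j).1.symm y) • f ((A.chart j).1.symm y) :=
  Filter.eventuallyEq_of_mem ((A.chart j).1.open_target.mem_nhds hy) fun _ h =>
    A.localizeFun_apply f h

theorem LocalizingAtlas.tsupport_localizeFun_subset (j : ι) (f : M → ℂ) :
    tsupport (A.localizeFun j f) ⊆ A.suppImage j := by
  refine closure_minimal (fun y hy => ?_) (A.isCompact_suppImage j).isClosed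
  have hyt : y ∈ (A.chart j).1.target := by_contra fun h => hy (indicator_of_notMem h _)
  rw [Function.mem_support, A.localizeFun_apply f hyt] at hy
  exact A.mem_suppImage hyt (subset_tsupport _ (left_ne_zero_of_smul hy))

theorem LocalizingAtlas.hasCompactSupport_localizeFun (j : ι) (f : M → ℂ) :
    HasCompactSupport (A.localizeFun j f) :=
  (A.isCompact_suppImage j).of_isClosed_subset (isClosed_tsupport _)
    (A.tsupport_localizeFun_subset j f)

theorem LocalizingAtlas.contDiff_localizeFun (j : ι) {f : M → ℂ}
    (hf : ContMDiff (𝓡 n) 𝓘(ℝ, ℂ) ∞ f) : ContDiff ℝ ∞ (A.localizeFun j f) := by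
  rw [contDiff_iff_contDiffAt]
  intro y
  by_cases hy : y ∈ (A.chart j).1.target
  · exact (((A.contDiffOn j).smul (contDiffOn_comp_chart_symm hf (A.chart j))).contDiffAt
      ((A.chart j).1.open_target.mem_nhds hy)).congr_of_eventuallyEq
        (A.localizeFun_eventuallyEq f hy)
  · exact contDiffAt_const.congr_of_eventuallyEq (notMem_tsupport_iff_eventuallyEq.1 fun h =>
      hy (A.suppImage_subset j (A.tsupport_localizeFun_subset j f h)))

theorem SmoothFun.contMDiff (f : SmoothFun (𝓡 n) M) : ContMDiff (𝓡 n) 𝓘(ℝ, ℂ) ∞ f.val := f.2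

theorem SmoothFun.continuousOn_comp_chart_symm (f : SmoothFun (𝓡 n) M) (e : Chart (𝓡 n) M) :
    ContinuousOn (f.val ∘ e.1.symm) (Chart.image e : Set (Eucl n)) :=
  (contDiffOn_comp_chart_symm f.contMDiff e).continuousOn

theorem SmoothFun.locallyIntegrableOn_comp_chart_symm (f : SmoothFun (𝓡 n) M)
    (e : Chart (𝓡 n) M) : LocallyIntegrableOn (f.val ∘ e.1.symm) e.1.target volume :=
  (f.continuousOn_comp_chart_symm e).locallyIntegrableOn e.1.open_target.measurableSet

theorem HlocInter.localize_mem_sobolev (u : HlocInter A) (j : ι) (k : ℕ) :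
    localize A j u.toDistribution ∈ sobolev k (Chart.image (A.chart j)) :=
  (localizeSobolev A k j (HlocInter.incl A k u)).2

/-- The image under `χ_j` of the set where `φ_j ≥ 1 / (m + 1)`. -/
def LocalizingAtlas.superlevel (j : ι) (m : ℕ) : Set (Eucl n) :=
  (A.chart j).1 '' {x | 1 / ((m : ℝ) + 1) ≤ A.φ j x}

theorem LocalizingAtlas.setOf_le_subset_tsupport (j : ι) (m : ℕ) :
    {x | 1 / ((m : ℝ) + 1) ≤ A.φ j x} ⊆ tsupport (A.φ j) := fun x hx =>
  subset_tsupport _ (lt_of_lt_of_le (by positivity) (show 1 / ((m : ℝ) + 1) ≤ A.φ j x from hx)).ne'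

theorem LocalizingAtlas.isCompact_superlevel (j : ι) (m : ℕ) : IsCompact (A.superlevel j m) :=
  ((A.isCompact_tsupport j).of_isClosed_subset
    (isClosed_le continuous_const (A.φ j).contMDiff.continuous)
    (A.setOf_le_subset_tsupport j m)).image_of_continuousOn
      ((A.chart j).1.continuousOn.mono ((A.setOf_le_subset_tsupport j m).trans (A.subordinate j)))

theorem LocalizingAtlas.superlevel_subset_target (j : ι) (m : ℕ) :
    A.superlevel j m ⊆ (A.chart j).1.target := by
  rintro _ ⟨x, hx, rfl⟩
  exact (A.chart j).1.map_source (A.subordinate j (A.setOf_le_subset_tsupport j m hx))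

theorem LocalizingAtlas.ne_zero_of_mem_superlevel {j : ι} {m : ℕ} {y : Eucl n}
    (hy : y ∈ A.superlevel j m) : A.φ j ((A.chart j).1.symm y) ≠ 0 := by
  obtain ⟨x, hx, rfl⟩ := hy
  rw [(A.chart j).1.left_inv (A.subordinate j (A.setOf_le_subset_tsupport j m hx))]
  exact (lt_of_lt_of_le (by positivity) (show 1 / ((m : ℝ) + 1) ≤ A.φ j x from hx)).ne'

/-- Some `φ_j` is positive at `x`. These compact sets therefore suffice to define the topology of
`C^∞(M)`, and on them `φ_j` can be divided out. -/
theorem LocalizingAtlas.exists_superlevel_mem_nhds (x : M) : ∃ p : ι × ℕ,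
    x ∈ (A.chart p.1).1.source ∧ (A.chart p.1).1 ⁻¹' A.superlevel p.1 p.2 ∈ 𝓝 x := by
  obtain ⟨j, hj⟩ := A.φ.exists_pos_of_mem (mem_univ x)
  obtain ⟨m, hm⟩ := exists_nat_one_div_lt hj
  refine ⟨(j, m), A.subordinate j (subset_tsupport _ hj.ne'), ?_⟩
  filter_upwards [(A.φ j).contMDiff.continuous.continuousAt.eventually (lt_mem_nhds hm)]
    with y hy using mem_image_of_mem _ hy.le

theorem HlocInter.continuous_incl (k : ℕ) : Continuous (HlocInter.incl A k) :=
  continuous_iInf_dom continuous_induced_dom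

theorem HlocInter.isTopologicalAddGroup : IsTopologicalAddGroup (HlocInter A) := by
  refine topologicalAddGroup_iInf fun k => ?_
  have := (withSeminorms_hloc A k).topologicalAddGroup
  exact topologicalAddGroup_induced (HlocInter.incl A k)

variable [IsManifold (𝓡 n) ∞ M]

/-- The distribution defined by a smooth function. -/
def SmoothFun.toDistribution (f : SmoothFun (𝓡 n) M) : ManifoldDistribution n M :=
  distOfFun f.val f.locallyIntegrableOn_comp_chart_symm

theorem SmoothFun.isDefinedBy_toDistribution (f : SmoothFun (𝓡 n) M) :
    IsDefinedBy f.toDistribution f := fun e ψ =>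
  ofFun_apply (f.locallyIntegrableOn_comp_chart_symm e) ψ

theorem SmoothFun.toDistribution_injective :
    Function.Injective (SmoothFun.toDistribution : SmoothFun (𝓡 n) M → _) := fun f g h => by
  refine SmoothFun.ext fun x => ?_
  let e : Chart (𝓡 n) M := ⟨chartAt (Eucl n) x, IsManifold.chart_mem_maximalAtlas x⟩
  have hx : x ∈ e.1.source := mem_chart_source (Eucl n) x
  have h1 := eqOn_of_ofFun_eq (f.continuousOn_comp_chart_symm e)
    (g.continuousOn_comp_chart_symm e) (congrArg (ManifoldDistribution.rep e) h)
      (e.1.map_source hx)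
  simpa only [Function.comp_apply, e.1.left_inv hx] using h1

theorem SmoothFun.toDistribution_add (f g : SmoothFun (𝓡 n) M) :
    (f + g).toDistribution = f.toDistribution + g.toDistribution :=
  ManifoldDistribution.ext fun e => by
    ext ψ
    rw [map_add]
    change ManifoldDistribution.rep e _ ψ =
      ManifoldDistribution.rep e _ ψ + ManifoldDistribution.rep e _ ψ
    have hi : ∀ f : SmoothFun (𝓡 n) M,
        IntegrableOn (fun x => ψ x • f.val (e.1.symm x)) e.1.target volume := fun f =>
      (TestFunction.integrable_bilin (ContinuousLinearMap.lsmul ℝ ℝ)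
        (f.locallyIntegrableOn_comp_chart_symm e) ψ).integrableOn
    rw [f.isDefinedBy_toDistribution, g.isDefinedBy_toDistribution,
      (f + g).isDefinedBy_toDistribution, ← integral_add (hi f) (hi g)]
    simp only [← smul_add]
    rfl

theorem SmoothFun.toDistribution_smul (c : ℂ) (f : SmoothFun (𝓡 n) M) :
    (c • f).toDistribution = c • f.toDistribution :=
  ManifoldDistribution.ext fun e => by
    ext ψ
    rw [map_smul]
    change ManifoldDistribution.rep e (c • f).toDistribution ψ =
      c • ManifoldDistribution.rep e f.toDistribution ψ
    rw [f.isDefinedBy_toDistribution, (c • f).isDefinedBy_toDistribution, ← integral_smul]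
    simp only [smul_comm c]
    rfl

theorem localize_toDistribution (j : ι) (f : SmoothFun (𝓡 n) M) :
    localize A j f.toDistribution =
      ofFun (Chart.image (A.chart j)) (A.localizeFun j f.val) := by
  ext ψ
  rw [localize_apply, f.isDefinedBy_toDistribution,
    ofFun_apply ((A.contDiff_localizeFun j f.contMDiff).continuous.locallyIntegrable.locallyIntegrableOn _)]
  refine setIntegral_congr_fun (A.chart j).1.open_target.measurableSet fun x hx => ?_
  simp only [A.localizeFun_apply f.val hx, ← mul_smul]
  rfl

theorem SmoothFun.toDistribution_mem_hloc (f : SmoothFun (𝓡 n) M) (k : ℕ) :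
    f.toDistribution ∈ hloc A k := (Submodule.mem_iInf _).2 fun j => by
  rw [Submodule.mem_comap, localize_toDistribution]
  exact ofFun_mem_sobolev (A.contDiff_localizeFun j f.contMDiff) (A.hasCompactSupport_localizeFun j f.val) k

/-- The embedding of `C^∞(M)` in the intersection of the spaces `H^k_loc(M)`. -/
def smoothToHlocInter : SmoothFun (𝓡 n) M →ₗ[ℂ] HlocInter A where
  toFun f := ⟨f.toDistribution, (Submodule.mem_iInf _).2 (f.toDistribution_mem_hloc A)⟩
  map_add' f g := Subtype.ext (f.toDistribution_add g)
  map_smul' c f := Subtype.ext (f.toDistribution_smul c)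

/-- The seminorms of `C^∞(M)` in the charts of the atlas, on the supports of the partition of
unity. -/
def suppSeminorm (j : ι) (i : ℕ) : Seminorm ℂ (SmoothFun (𝓡 n) M) :=
  repSeminorm SmoothFun.isLocalRep.contDiffOn ⟨A.chart j, A.suppImage j, A.isCompact_suppImage j,
    by simpa using A.suppImage_subset j, i⟩

theorem norm_le_suppSeminorm {j : ι} {i : ℕ} (f : SmoothFun (𝓡 n) M) {x : Eucl n}
    (hx : x ∈ A.suppImage j) :
    ‖iteratedFDeriv ℝ i (f.val ∘ (A.chart j).1.symm) x‖ ≤ suppSeminorm A j i f := by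
  have h : f.val ∘ (A.chart j).1.symm = SmoothFun.rep (A.chart j) f := rfl
  rw [h]
  exact norm_le_derivSeminorm (hΩ := (A.chart j).1.isOpen_extend_target)
    (hK := A.isCompact_suppImage j) (hKΩ := by simpa using A.suppImage_subset j)
    (hrep := SmoothFun.contDiffOn_rep (A.chart j)) f hx

theorem exists_norm_iteratedFDeriv_localizeFun_le (j : ι) (i : ℕ) :
    ∃ C : ℝ, 0 ≤ C ∧ ∀ (f : SmoothFun (𝓡 n) M) (x : Eucl n),
      ‖iteratedFDeriv ℝ i (A.localizeFun j f.val) x‖ ≤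
        C * ∑ l ∈ Finset.range (i + 1), suppSeminorm A j l f := by
  -- The Leibniz rule, as the case `τ = id` with `A` the multiplication by `φ_j`.
  obtain ⟨C, hC, h⟩ := exists_norm_iteratedFDeriv_clm_apply_comp_le (V := ℂ) (V' := ℂ)
    (U := (A.chart j).1.target) (Ω := (A.chart j).1.target) (τ := id)
    (A := fun y => A.φ j ((A.chart j).1.symm y) • ContinuousLinearMap.id ℝ ℂ)
    (A.chart j).1.open_target (A.chart j).1.open_target (A.isCompact_suppImage j)
    (A.suppImage_subset j) contDiffOn_id (mapsTo_id _)
    ((A.contDiffOn j).smul contDiffOn_const) i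
  simp only [smul_apply, ContinuousLinearMap.id_apply, id] at h
  refine ⟨C, hC, fun f x => ?_⟩
  have hS : 0 ≤ C * ∑ l ∈ Finset.range (i + 1), suppSeminorm A j l f :=
    mul_nonneg hC (Finset.sum_nonneg fun _ _ => apply_nonneg _ _)
  by_cases hx : x ∈ A.suppImage j
  · have h1 := (A.localizeFun_eventuallyEq f.val (A.suppImage_subset j hx)).iteratedFDeriv ℝ i
    rw [h1.self_of_nhds]
    have h2 := h (f.val ∘ (A.chart j).1.symm)
      (contDiffOn_comp_chart_symm f.contMDiff (A.chart j)) x hx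
    refine LE.le.trans h2 ?_
    refine mul_le_mul_of_nonneg_left (Finset.sum_le_sum fun l _ => ?_) hC
    exact norm_le_suppSeminorm A f hx
  · have h1 := (notMem_tsupport_iff_eventuallyEq.1 fun h =>
      hx (A.tsupport_localizeFun_subset j f.val h)).iteratedFDeriv ℝ i
    rw [h1.self_of_nhds]
    simpa using hS

theorem exists_hlocSeminorm_smooth_le (k : ℕ) (j : ι) :
    ∃ C : ℝ, ∀ f : SmoothFun (𝓡 n) M,
      hlocSeminorm A k j (HlocInter.incl A k (smoothToHlocInter A f)) ≤
        C * ∑ l ∈ Finset.range (k + 1), suppSeminorm A j l f := by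
  choose C hC h using exists_norm_iteratedFDeriv_localizeFun_le A j
  refine ⟨Real.sqrt ((multiIndices n k).card * volume.real (A.suppImage j)) *
    ∑ i ∈ Finset.range (k + 1), C i, fun f => ?_⟩
  have hmem : ofFun (Chart.image (A.chart j)) (A.localizeFun j f.val) ∈
      sobolev k (Chart.image (A.chart j)) :=
    ofFun_mem_sobolev (A.contDiff_localizeFun j f.contMDiff) (A.hasCompactSupport_localizeFun j f.val) k
  have heq : localizeSobolev A k j (HlocInter.incl A k (smoothToHlocInter A f)) =
      ⟨_, hmem⟩ := Subtype.ext (localize_toDistribution A j f)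
  rw [hlocSeminorm_apply, heq, mul_assoc]
  refine sobolevNorm_ofFun_le (A.isCompact_suppImage j) (A.contDiff_localizeFun j f.contMDiff)
    (A.tsupport_localizeFun_subset j f.val) (fun m hm x => (h m f x).trans ?_) hmem
  refine mul_le_mul ?_ ?_ (Finset.sum_nonneg fun _ _ => apply_nonneg _ _)
    (Finset.sum_nonneg fun i _ => hC i)
  · exact Finset.single_le_sum (f := C) (fun i _ => hC i) (Finset.mem_range.2 (by omega))
  · exact Finset.sum_le_sum_of_subset_of_nonneg (Finset.range_mono (by omega))
      fun _ _ _ => apply_nonneg _ _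

theorem continuous_smoothToHlocInter : Continuous (smoothToHlocInter A) := by
  have hs := SmoothFun.withSeminorms (I := 𝓡 n) (N := M)
  have := hs.topologicalAddGroup
  refine continuous_iInf_rng.2 fun k => continuous_induced_rng.2 ?_
  refine WithSeminorms.continuous_of_continuous_comp (withSeminorms_hloc A k)
    (HlocInter.incl A k ∘ₗ smoothToHlocInter A) fun j => ?_
  obtain ⟨C, hC⟩ := exists_hlocSeminorm_smooth_le A k j
  exact continuous_of_le_mul_sum (fun l _ => hs.continuous_seminorm ⟨A.chart j, A.suppImage j,
    A.isCompact_suppImage j, by simpa using A.suppImage_subset j, l⟩) hC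

theorem smoothToHlocInter_injective : Function.Injective (smoothToHlocInter A) := fun _ _ h =>
  SmoothFun.toDistribution_injective (congrArg HlocInter.toDistribution h)

/-- Near `K` one has `f = φ_j⁻¹ v`, with `v` the smooth representative of `φ_j f`; Sobolev's
estimate bounds the derivatives of `v` and the Leibniz rule those of `f`. -/
theorem exists_norm_iteratedFDeriv_le_hlocSeminorm (j : ι) {K : Set (Eucl n)} (hK : IsCompact K)
    (hKt : K ⊆ (A.chart j).1.target) (hKφ : ∀ x ∈ K, A.φ j ((A.chart j).1.symm x) ≠ 0) (i : ℕ) :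
    ∃ C : ℝ, 0 ≤ C ∧ ∀ (f : SmoothFun (𝓡 n) M), ∀ x ∈ K,
      ‖iteratedFDeriv ℝ i (f.val ∘ (A.chart j).1.symm) x‖ ≤ C * ∑ l ∈ Finset.range (i + 1),
        hlocSeminorm A (n + 1 + l) j (HlocInter.incl A (n + 1 + l) (smoothToHlocInter A f)) := by
  let U : Set (Eucl n) := (A.chart j).1.target ∩ (A.φ j ∘ (A.chart j).1.symm) ⁻¹' {0}ᶜ
  have hU : IsOpen U := (A.contDiffOn j).continuousOn.isOpen_inter_preimage
    (A.chart j).1.open_target isOpen_ne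
  obtain ⟨D, hD⟩ := exists_smooth_representative (A.isCompact_suppImage j) (A.suppImage_subset j)
  obtain ⟨C, hC, h⟩ := exists_norm_iteratedFDeriv_clm_apply_comp_le (V := ℂ) (V' := ℂ)
    (Ω := univ) (τ := id)
    (A := fun y => ((A.φ j ∘ (A.chart j).1.symm) y)⁻¹ • ContinuousLinearMap.id ℝ ℂ)
    hU isOpen_univ hK (fun x hx => ⟨hKt hx, hKφ x hx⟩) contDiffOn_id (mapsTo_univ _ _)
    ((((A.contDiffOn j).mono inter_subset_left).inv fun y hy => hy.2).smul contDiffOn_const) i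
  simp only [smul_apply, ContinuousLinearMap.id_apply, id, Function.comp_apply] at h
  have hD0 : 0 ≤ ∑ l ∈ Finset.range (i + 1), |D l| := Finset.sum_nonneg fun _ _ => abs_nonneg _
  refine ⟨C * ∑ l ∈ Finset.range (i + 1), |D l|, mul_nonneg hC hD0, fun f x hx => ?_⟩
  obtain ⟨v, hv, hfv, hvD⟩ := hD _ (suppIn_localize A j (smoothToHlocInter A f).toDistribution)
    (HlocInter.localize_mem_sobolev A _ j)
  have hEq : EqOn v (A.localizeFun j f.val) (Chart.image (A.chart j)) :=
    eqOn_of_ofFun_eq hv.continuous.continuousOn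
      (A.contDiff_localizeFun j f.contMDiff).continuous.continuousOn
      (hfv.symm.trans (localize_toDistribution A j f))
  have hfx : f.val ∘ (A.chart j).1.symm =ᶠ[𝓝 x]
      fun y => (A.φ j ((A.chart j).1.symm y))⁻¹ • v y := by
    filter_upwards [hU.mem_nhds ⟨hKt hx, hKφ x hx⟩] with y hy
    rw [hEq hy.1, A.localizeFun_apply f.val hy.1, inv_smul_smul₀ (show A.φ j ((A.chart j).1.symm y) ≠ 0 from hy.2),
       Function.comp_apply]
  rw [(hfx.iteratedFDeriv ℝ i).self_of_nhds, mul_assoc]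
  refine LE.le.trans (h v hv.contDiffOn x hx) (mul_le_mul_of_nonneg_left ?_ hC)
  rw [Finset.mul_sum]
  refine Finset.sum_le_sum fun l hl => (hvD l x (HlocInter.localize_mem_sobolev A _ j _)).trans ?_
  exact mul_le_mul_of_nonneg_right ((le_abs_self _).trans
    (Finset.single_le_sum (f := fun l => |D l|) (fun _ _ => abs_nonneg _) hl)) (apply_nonneg _ _)

theorem LocalizingAtlas.withSeminorms_superlevel : WithSeminorms (ι := (ι × ℕ) × ℕ)
    fun c => repSeminorm (SmoothFun.isLocalRep (I := 𝓡 n) (N := M)).contDiffOn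
      ⟨A.chart c.1.1, A.superlevel c.1.1 c.1.2, A.isCompact_superlevel c.1.1 c.1.2,
        by simpa using A.superlevel_subset_target c.1.1 c.1.2, c.2⟩ :=
  withSeminorms_repSeminorm_of_cover SmoothFun.isLocalRep SmoothFun.withSeminorms
    (fun p : ι × ℕ => ⟨A.chart p.1, A.superlevel p.1 p.2, A.isCompact_superlevel p.1 p.2,
      by simpa using A.superlevel_subset_target p.1 p.2, 0⟩) A.exists_superlevel_mem_nhds

theorem SmoothFun.repSeminorm_le (a : SeminormIndex (𝓡 n) M) {f : SmoothFun (𝓡 n) M} {C : ℝ}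
    (hC : 0 ≤ C) (h : ∀ x ∈ a.K, ‖iteratedFDeriv ℝ a.order (f.val ∘ a.e.1.symm) x‖ ≤ C) :
    repSeminorm SmoothFun.isLocalRep.contDiffOn a f ≤ C :=
  derivSeminorm_le (rep := SmoothFun.rep a.e) hC h

/-- Continuity need only be tested on the seminorms over the superlevel sets of the `φ_j`, where the
preceding estimate applies to `T u`. -/
theorem continuous_of_smoothToHlocInter_eq {T : HlocInter A →ₗ[ℂ] SmoothFun (𝓡 n) M}
    (hT : ∀ u, smoothToHlocInter A (T u) = u) : Continuous T := by
  have := HlocInter.isTopologicalAddGroup A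
  refine WithSeminorms.continuous_of_continuous_comp A.withSeminorms_superlevel T fun c => ?_
  obtain ⟨C, hC, h⟩ := exists_norm_iteratedFDeriv_le_hlocSeminorm A c.1.1
    (A.isCompact_superlevel c.1.1 c.1.2) (A.superlevel_subset_target c.1.1 c.1.2)
    (fun _ => A.ne_zero_of_mem_superlevel) c.2
  refine continuous_of_le_mul_sum (q := fun l => (hlocSeminorm A (n + 1 + l) c.1.1).comp
    (HlocInter.incl A (n + 1 + l))) (F := Finset.range (c.2 + 1)) (C := C) (fun l _ => ?_)
    fun u => ?_
  · exact ((withSeminorms_hloc A (n + 1 + l)).continuous_seminorm c.1.1).comp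
      (HlocInter.continuous_incl A (n + 1 + l))
  · have h1 := h (T u)
    rw [hT u] at h1
    exact SmoothFun.repSeminorm_le _ (mul_nonneg hC (Finset.sum_nonneg fun _ _ => apply_nonneg _ _)) h1

variable [T2Space M] [SigmaCompactSpace M]

theorem contMDiff_synth {w : ι → Eucl n → ℂ} (hw : ∀ j, ContDiff ℝ ∞ (w j)) :
    ContMDiff (𝓡 n) 𝓘(ℝ, ℂ) ∞ (synth A w) := by
  refine contMDiff_finsum (fun j => contMDiff_of_tsupport fun x hx => ?_)
    (A.locallyFinite.subset fun j x hx => by_contra fun h => hx ?_)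
  · have hxs := A.tsupport_cutoff_subset j (tsupport_smul_subset_left _ _ hx)
    exact (A.contMDiff_cutoff j x).smul ((hw j).contMDiff.contMDiffAt.comp x
      (contMDiffOn_of_mem_maximalAtlas (A.chart j).2 |>.contMDiffAt
        ((A.chart j).1.open_source.mem_nhds hxs)))
  · simp only
    rw [A.cutoff_eq_zero h, zero_smul]

/-- Sobolev's theorem makes every localization a smooth function, and a distribution whose
localizations are functions is the one obtained by patching them. -/
theorem smoothToHlocInter_surjective : Function.Surjective (smoothToHlocInter A) := fun u => by
  have h : ∀ j, ∃ v, ContDiff ℝ ∞ v ∧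
      localize A j u.toDistribution = ofFun (Chart.image (A.chart j)) v := fun j => by
    obtain ⟨_, hD⟩ := exists_smooth_representative (A.isCompact_suppImage j) (A.suppImage_subset j)
    obtain ⟨v, hv, huv, -⟩ := hD _ (suppIn_localize A j u.toDistribution)
      (HlocInter.localize_mem_sobolev A u j)
    exact ⟨v, hv, huv⟩
  choose v hv huv using h
  exact ⟨⟨synth A v, contMDiff_synth A hv⟩, Subtype.ext (eq_distOfFun_synth A
    (fun j => (hv j).continuous.locallyIntegrable.locallyIntegrableOn _) huv).symm⟩

/-- The identification of `C^∞(M)` with the intersection of the spaces `H^k_loc(M)`. -/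
def smoothEquivHlocInter : SmoothFun (𝓡 n) M ≃L[ℂ] HlocInter A where
  toLinearEquiv := LinearEquiv.ofBijective (smoothToHlocInter A)
    ⟨smoothToHlocInter_injective A, smoothToHlocInter_surjective A⟩
  continuous_toFun := continuous_smoothToHlocInter A
  continuous_invFun := continuous_of_smoothToHlocInter_eq A
    (T := (LinearEquiv.ofBijective (smoothToHlocInter A)
      ⟨smoothToHlocInter_injective A, smoothToHlocInter_surjective A⟩).symm.toLinearMap)
    (LinearEquiv.ofBijective (smoothToHlocInter A)
      ⟨smoothToHlocInter_injective A, smoothToHlocInter_surjective A⟩).apply_symm_apply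

end SmoothSobolev

end SobolevFS

end

theorem theorem2p6 (n : ℕ) (M : Type*) [TopologicalSpace M] [ChartedSpace (SobolevFS.Eucl n) M]
    [IsManifold (𝓡 n) ∞ M] [T2Space M] [SigmaCompactSpace M] :
    (∀ (ι : Type) (A : SobolevFS.LocalizingAtlas n M ι),
      (∀ k : ℕ, SobolevFS.IsCompactEmbedding (SobolevFS.hlocEmbedding A k)) ∧
      ∃ Φ : SobolevFS.SmoothFun (𝓡 n) M ≃L[ℂ] SobolevFS.HlocInter A,
        ∀ f, SobolevFS.IsDefinedBy (Φ f).toDistribution f) ∧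
    SobolevFS.IsFrechetSchwartz (SobolevFS.SmoothFun (𝓡 n) M) ∧
    (∀ q : ℕ, SobolevFS.IsFrechetSchwartz (SobolevFS.SmoothForm (𝓡 n) M q)) ∧
    (∀ m q : ℕ, SobolevFS.IsFrechetSchwartz
      (SobolevFS.SmoothForm ((𝓡 n).prod (SobolevFS.torusModel m)) (M × SobolevFS.Torus m) q)) ∧
    (∀ m q : ℕ, SobolevFS.IsFrechetSchwartz (SobolevFS.horizontalForms n M m q)) :=
  ⟨fun _ A => ⟨SobolevFS.isCompactEmbedding_hlocEmbedding A, SobolevFS.smoothEquivHlocInter A,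
      fun f => f.isDefinedBy_toDistribution⟩,
    SobolevFS.SmoothFun.isFrechetSchwartz, fun _ => SobolevFS.SmoothForm.isFrechetSchwartz,
    SobolevFS.isFrechetSchwartz_smoothForm_torus n M,
    SobolevFS.isFrechetSchwartz_horizontalForms n M⟩
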